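/- Let $L>0$ and let $u_0\in L^1(\mathbb R)$ be a complex-valued function with $u_0(x)=0$ for $|x|>L$. Consider the focusing Zakharov–Shabat system $$X_1'=-ikX_1+u_0X_2,\qquad X_2'=ikX_2-\overline{u_0}\,X_1 ,$$ and, for $\operatorname{Im}k\ge 0$, its Jost solutions $\phi(k,x)$ and $\psi(k,x)$, determined by $e^{ikx}\phi(k,x)\to(1,0)$ as $x\to-\infty$ and $e^{-ikx}\psi(k,x)\to(0,1)$ as $x\to+\infty$. Let $a(k)=\lim_{x\to+\infty}e^{ikx}\phi_1(k,x)$ for $\operatorname{Im}k\ge0$ and, for real $k$, $b(k)=\lim_{x\to+\infty}e^{-ikx}\phi_2(k,x)$, $c(k)=\lim_{x\to-\infty}e^{ikx}\psi_1(k,x)$. The transmission coefficient is $T=1/a$, the reflection coefficients from the right and from the left are $R=b/a$ and $\mathcal L=c/a$, and it is assumed that $a(k)\neq0$ for all real $k$, so that they are defined on $\mathbb R$. The bound states $k_1,\dots,k_n$ are the poles of $T$ in the open upper half plane, with multiplicities $m_1,\dots,m_n$. For each $j$ let $\tau_{js}$ and $\sigma_{js}$ $(0\le s<m_j)$ be the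 unique numbers such that, for every $x$, $$T(k)\phi(k,x)-\sum_{s}\frac{\tau_{js}}{(k-k_j)^{s+1}}\psi(k,x)\quad\text{and}\quad T(k)\psi(k,x)-\sum_{s}\frac{\sigma_{js}}{(k-k_j)^{s+1}}\phi(k,x)$$ stay bounded as $k\to k_j$; the norming constants are $(\Gamma_\ell)_{js}=-i\,i^{s}\tau_{js}$ and $(\Gamma_r)_{js}=-i(-i)^{s}\sigma_{js}$. The left and right Marchenko kernels are $$\Omega_\ell(\alpha)=\frac1{2\pi}\int_{-\infty}^{\infty}R(k)e^{ik\alpha}\,dk+\sum_{j}e^{ik_j\alpha}\sum_{s}(\Gamma_\ell)_{js}\frac{\alpha^s}{s!}\quad(\alpha\ge0),$$ $$\Omega_r(\alpha)=\frac1{2\pi}\int_{-\infty}^{\infty}\mathcal L(k)e^{-ik\alpha}\,dk+\sum_{j}e^{-ik_j\alpha}\sum_{s}(\Gamma_r)_{js}\frac{\alpha^s}{s!}\quad(\alpha\le0).$$ Then there are only finitely many bound states, and the following hold. 1. With the integrals read as $\lim_{N\to\infty}\int_{-N}^{N}$, one has $\Omega_\ell(z)=0$ for every $z>2L$ and $\Omega_r(z)=0$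 for every $z<-2L$ (in particular the limits exist there). 2. With the inverse Fourier transforms read as $L^1$ functions, $\Omega_\ell$ has a representative on $(0,\infty)$ that vanishes at every $z>2L$ and $\Omega_r$ has a representative on $(-\infty,0)$ that vanishes at every $z<-2L$; thus $\Omega_\ell$ is supported in $[0,2L]$ and $\Omega_r$ in $[-2L,0]$. If $u_0$ is left-continuous at $L$, the representative of $\Omega_\ell$ can moreover be chosen left-continuous at $2L$, and its value there is $$\Omega_\ell(2L)=-\tfrac12\,\overline{u_0(L)}$$ (which is $-\tfrac12u_0(L)$ for real $u_0$). -/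

import Mathlib

open Filter Topology MeasureTheory Set

namespace ZakharovShabat

noncomputable section

/-- `X = (X₁, X₂)` solves the focusing Zakharov-Shabat system
`i J X' - V X = k X`, `J = diag(1, -1)`, `V = [[0, i u], [i ū, 0]]`, i.e.
`X₁' = -i k X₁ + u X₂`, `X₂' = i k X₂ - ū X₁`, on the whole line. As `u` is only integrable, the
system is understood in the usual sense (`X` locally absolutely continuous, equation almost
everywhere), written here in the equivalent integrated form. -/
def IsSolution (u : ℝ → ℂ) (k : ℂ) (X : ℝ → ℂ × ℂ) : Prop :=
  Continuous X ∧ ∀ x y : ℝ,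
    (X y).1 - (X x).1 = (∫ t in x..y, (-(Complex.I * k) * (X t).1 + u t * (X t).2)) ∧
    (X y).2 - (X x).2 =
      ∫ t in x..y, (Complex.I * k * (X t).2 - (starRingEnd ℂ) (u t) * (X t).1)

/-- Solution normalized at `-∞`: `X(x) ~ e^{-ikx} (1, 0)` as `x → -∞`. -/
def IsJostMinus (u : ℝ → ℂ) (k : ℂ) (X : ℝ → ℂ × ℂ) : Prop :=
  IsSolution u k X ∧
    Tendsto (fun x : ℝ => Complex.exp (Complex.I * k * x) • X x) atBot (𝓝 ((1 : ℂ), (0 : ℂ)))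

/-- Solution normalized at `+∞`: `X(x) ~ e^{ikx} (0, 1)` as `x → +∞`. -/
def IsJostPlus (u : ℝ → ℂ) (k : ℂ) (X : ℝ → ℂ × ℂ) : Prop :=
  IsSolution u k X ∧
    Tendsto (fun x : ℝ => Complex.exp (-(Complex.I * k * x)) • X x) atTop (𝓝 ((0 : ℂ), (1 : ℂ)))

/-- The Jost solution normalized at `-∞`. For `u ∈ L¹` and `Im k ≥ 0` there is exactly one;
it is only used for such `k`. -/
def jostMinus (u : ℝ → ℂ) (k : ℂ) : ℝ → ℂ × ℂ := Classical.epsilon (IsJostMinus u k)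

/-- The Jost solution normalized at `+∞`. For `u ∈ L¹` and `Im k ≥ 0` there is exactly one;
it is only used for such `k`. -/
def jostPlus (u : ℝ → ℂ) (k : ℂ) : ℝ → ℂ × ℂ := Classical.epsilon (IsJostPlus u k)

/-- The coefficient `a` in `jostMinus ~ (a e^{-ikx}, b e^{ikx})` as `x → +∞`
(meaningful for `Im k ≥ 0`). -/
def coeffA (u : ℝ → ℂ) (k : ℂ) : ℂ :=
  limUnder atTop (fun x : ℝ => Complex.exp (Complex.I * k * x) * (jostMinus u k x).1)

/-- The coefficient `b` in `jostMinus ~ (a e^{-ikx}, b e^{ikx})` as `x → +∞` (`k` real). -/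
def coeffB (u : ℝ → ℂ) (k : ℝ) : ℂ :=
  limUnder atTop (fun x : ℝ => Complex.exp (-(Complex.I * k * x)) * (jostMinus u k x).2)

/-- The coefficient `c` in `jostPlus ~ (c e^{-ikx}, a e^{ikx})` as `x → -∞` (`k` real). -/
def coeffC (u : ℝ → ℂ) (k : ℝ) : ℂ :=
  limUnder atBot (fun x : ℝ => Complex.exp (Complex.I * k * x) * (jostPlus u k x).1)

/-- Transmission coefficient `T = 1 / a`. -/
def transmission (u : ℝ → ℂ) (k : ℂ) : ℂ := 1 / coeffA u k

/-- Reflection coefficient from the right, `R = b / a`. -/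
def reflectionRight (u : ℝ → ℂ) (k : ℝ) : ℂ := coeffB u k / coeffA u k

/-- Reflection coefficient from the left, `L = c / a`. -/
def reflectionLeft (u : ℝ → ℂ) (k : ℝ) : ℂ := coeffC u k / coeffA u k

/-- The bound states: poles of `T = 1 / a` (zeros of the analytic function `a`) in the open
upper half plane. -/
def boundStates (u : ℝ → ℂ) : Set ℂ := {k | 0 < k.im ∧ coeffA u k = 0}

/-- Multiplicity of a bound state: the order of the pole of `T`, i.e. of the zero of `a`. -/
def multiplicity (u : ℝ → ℂ) (k : ℂ) : ℕ := analyticOrderNatAt (coeffA u) k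

/-- `∑ₛ τₛ (w - k)^{-s-1}` is the principal part at `k` which turns `jostPlus` into the singular
part of `T · jostMinus`. At a simple bound state, where `jostMinus = β jostPlus`, this says
`τ₀ = β / a'(k)`. -/
def IsLeftPrincipalPart (u : ℝ → ℂ) (k : ℂ) (τ : Fin (multiplicity u k) → ℂ) : Prop :=
  ∀ x : ℝ, (fun w : ℂ => transmission u w • jostMinus u w x -
    (∑ s, τ s / (w - k) ^ ((s : ℕ) + 1)) • jostPlus u w x) =O[𝓝[≠] k] (fun _ => (1 : ℝ))

/-- The mirror image of `IsLeftPrincipalPart`: the roles of the two Jost solutions are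
interchanged. -/
def IsRightPrincipalPart (u : ℝ → ℂ) (k : ℂ) (τ : Fin (multiplicity u k) → ℂ) : Prop :=
  ∀ x : ℝ, (fun w : ℂ => transmission u w • jostPlus u w x -
    (∑ s, τ s / (w - k) ^ ((s : ℕ) + 1)) • jostMinus u w x) =O[𝓝[≠] k] (fun _ => (1 : ℝ))

/-- Norming constants from the left of the bound state `k`: `Γₛ = -i iˢ τₛ`
(the `τₛ` are uniquely determined). -/
def normingLeft (u : ℝ → ℂ) (k : ℂ) (s : Fin (multiplicity u k)) : ℂ :=
  -Complex.I * Complex.I ^ (s : ℕ) * Classical.epsilon (IsLeftPrincipalPart u k) s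

/-- Norming constants from the right of the bound state `k`: `Γₛ = -i (-i)ˢ τₛ`
(the `τₛ` are uniquely determined). -/
def normingRight (u : ℝ → ℂ) (k : ℂ) (s : Fin (multiplicity u k)) : ℂ :=
  -Complex.I * (-Complex.I) ^ (s : ℕ) * Classical.epsilon (IsRightPrincipalPart u k) s

/-- Spectral sum from the left,
`S_ℓ(α) = ∑ⱼ e^{i kⱼ α} ∑ₛ Γₛ α^s / s!`, used for `α ≥ 0`. -/
def spectralSumLeft (u : ℝ → ℂ) (α : ℝ) : ℂ :=
  ∑ᶠ k ∈ boundStates u, Complex.exp (Complex.I * k * α) *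
    ∑ s : Fin (multiplicity u k), normingLeft u k s * (α : ℂ) ^ (s : ℕ) / (Nat.factorial s : ℂ)

/-- Spectral sum from the right,
`S_r(α) = ∑ⱼ e^{-i kⱼ α} ∑ₛ Γₛ α^s / s!`, used for `α ≤ 0`. -/
def spectralSumRight (u : ℝ → ℂ) (α : ℝ) : ℂ :=
  ∑ᶠ k ∈ boundStates u, Complex.exp (-(Complex.I * k * α)) *
    ∑ s : Fin (multiplicity u k), normingRight u k s * (α : ℂ) ^ (s : ℕ) / (Nat.factorial s : ℂ)

/-- `Ω_ℓ(α) = ρ(α) + S_ℓ(α)` has the value `v` at the point `α`, where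
`ρ(α) = (2π)⁻¹ ∫ R(k) e^{ikα} dk` is taken as an improper integral, `∫_{-N}^{N}` with `N → ∞`. -/
def LeftKernelHasValue (u : ℝ → ℂ) (α : ℝ) (v : ℂ) : Prop :=
  Tendsto (fun N : ℝ => (1 / (2 * (Real.pi : ℂ))) *
    (∫ k in (-N)..N, reflectionRight u k * Complex.exp (Complex.I * k * α)) +
      spectralSumLeft u α) atTop (𝓝 v)

/-- `Ω_r(α) = ℓ(α) + S_r(α)` has the value `v` at the point `α`, where
`ℓ(α) = (2π)⁻¹ ∫ L(k) e^{-ikα} dk` is taken as an improper integral, `∫_{-N}^{N}` with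
`N → ∞`. -/
def RightKernelHasValue (u : ℝ → ℂ) (α : ℝ) (v : ℂ) : Prop :=
  Tendsto (fun N : ℝ => (1 / (2 * (Real.pi : ℂ))) *
    (∫ k in (-N)..N, reflectionLeft u k * Complex.exp (-(Complex.I * k * α))) +
      spectralSumRight u α) atTop (𝓝 v)

/-- `Ω` represents, on `(0, ∞)` and up to null sets, the left Marchenko kernel `ρ + S_ℓ`, where
`ρ ∈ L¹` is the inverse Fourier transform of `R`: `R(k) = ∫ ρ(α) e^{-ikα} dα`. -/
def IsLeftKernel (u Ω : ℝ → ℂ) : Prop :=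
  ∃ ρ : ℝ → ℂ, Integrable ρ ∧
    (∀ k : ℝ, reflectionRight u k = ∫ α : ℝ, ρ α * Complex.exp (-(Complex.I * k * α))) ∧
    ∀ᵐ α : ℝ, 0 < α → Ω α = ρ α + spectralSumLeft u α

/-- `Ω` represents, on `(-∞, 0)` and up to null sets, the right Marchenko kernel `l + S_r`, where
`l ∈ L¹` satisfies `l(α) = (2π)⁻¹ ∫ L(k) e^{-ikα} dk`, that is, `L(k) = ∫ l(α) e^{ikα} dα`. -/
def IsRightKernel (u Ω : ℝ → ℂ) : Prop :=
  ∃ l : ℝ → ℂ, Integrable l ∧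
    (∀ k : ℝ, reflectionLeft u k = ∫ α : ℝ, l α * Complex.exp (Complex.I * k * α)) ∧
    ∀ᵐ α : ℝ, α < 0 → Ω α = l α + spectralSumRight u α

end

end ZakharovShabat

/-!
The factors `e^{± ikx}` are removed from the solution normalized at `-∞`: it becomes
`(e^{-ikx} m, e^{ikx} n)` with `m' = u e^{2ikx} n`, `n' = -ū e^{-2ikx} m`. Since `u` vanishes
outside `[-L, L]`, Picard iteration shows that `m` and `n` are entire in `k`, and `a = m(·, L)`,
`b = n(·, L)`. The solution normalized at `+∞` comes from the mirrored potential `x ↦ conj (u (-x))`,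
which has the same `a` and has `c` as its `b`. Hence the statements about the right kernel are those
about the left kernel of the mirrored potential.

In the closed upper half plane `a → 1` and `e^{2ikx} n(k, x) → 0` at infinity
(`IsFundamental.tendsto_fst`, `IsFundamental.tendsto_snd`), by a Riemann-Lebesgue lemma uniform in
the direction. In particular `a` has finitely many zeros there. The defining property of the numbers
`τ` says that `∑ τ_{js} / (k - k_j)^{s+1} =: Q` collects the principal parts of `b / a`
(`IsFundamental.exists_left_data`). The spectral sum is the Fourier integral of `-Q` on the half
line, so the kernel `Ω`, extended by `ρ` to the negative axis, is the inverse Fourier transform of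
`G = b / a - Q`. This `G` is holomorphic in the closed upper half plane and `G e^{2ikL} → 0` at
infinity. Closing the contour gives `Ω(z) = 0` for `z > 2L`, pointwise for the improper integrals
(`IsFundamental.tendsto_integral_reflection`) and almost everywhere for the `L¹` kernel
(`IsFundamental.kernel_ae_eq_zero`). The latter uses a localized Fourier inversion,
`ae_eq_of_fourier_eq`.

For the value at `2L`, let `v` be the restriction of `u` to `(x₀, ∞)` with `x₀` slightly below `L`,
and let `a₂, b₂` be its coefficients. The Wronskian of the two solutions gives
`b / a - b₂ / a₂ = n(·, x₀) / (a a₂)`, so `G - b₂ / a₂` decays like `o(e^{-2ik x₀})` in the closed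
upper half plane and, by the same localized inversion, does not contribute to `Ω` on `(2 x₀, ∞)`.
There `Ω` is therefore the inverse Fourier transform of `b₂ / a₂`. The first Born approximation of
`b₂ / a₂` contributes exactly `-conj (u (z / 2)) / 2`. The remainder is bounded pointwise by
`∫ |v| |β|²` with the Born term `β`, and Plancherel's theorem and Tonelli's theorem bound the
`L¹` norm of that by a multiple of `‖v‖₁ ‖v‖₂²`
(`IsFundamental.integrable_reflection_sub_bornTerm`), which is `O((L - x₀)²)` because `u` is bounded
near `L`. So `Ω + conj (u (· / 2)) / 2` has essential left limit `0` at `2L`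
(`IsFundamental.norm_kernel_add_half_conj_le`), and a modification on a null set makes `Ω`
left-continuous there.
-/

namespace ZakharovShabat

open Asymptotics
open scoped ContDiff ENNReal FourierTransform BoundedContinuousFunction

/-! ### Primitives of locally integrable functions -/

/-- `F` is a primitive of the locally integrable function `f`: it is locally absolutely continuous
with `F' = f` almost everywhere, expressed through increments. -/
structure IsPrimitive (F f : ℝ → ℂ) : Prop where
  intervalIntegrable : ∀ a b : ℝ, IntervalIntegrable f volume a b
  sub_eq : ∀ a b : ℝ, F b - F a = ∫ t in a..b, f t

namespace IsPrimitive

variable {F G f g : ℝ → ℂ}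

lemma eq_add (h : IsPrimitive F f) (a x : ℝ) : F x = F a + ∫ t in a..x, f t := by
  rw [← h.sub_eq]; ring

lemma continuous (h : IsPrimitive F f) : Continuous F := by
  have : F = fun x => F 0 + ∫ t in (0 : ℝ)..x, f t := funext fun x => h.eq_add 0 x
  rw [this]
  exact continuous_const.add (intervalIntegral.continuous_primitive h.intervalIntegrable 0)

lemma absolutelyContinuousOnInterval (h : IsPrimitive F f) (a b : ℝ) :
    AbsolutelyContinuousOnInterval F a b := by
  have hU := (h.intervalIntegrable a b).norm.absolutelyContinuousOnInterval_intervalIntegral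
    (c := a) (by simp)
  refine squeeze_zero (fun _ => Finset.sum_nonneg fun _ _ => dist_nonneg) (fun E => ?_) hU
  refine Finset.sum_le_sum fun i _ => ?_
  rw [dist_comm, dist_eq_norm, h.sub_eq, dist_comm, Real.dist_eq,
    intervalIntegral.integral_interval_sub_left (h.intervalIntegrable _ _).norm
      (h.intervalIntegrable _ _).norm]
  exact intervalIntegral.norm_integral_le_abs_integral_norm

lemma ae_hasDerivAt (h : IsPrimitive F f) (a b : ℝ) :
    ∀ᵐ x, x ∈ uIcc a b → HasDerivAt F (f x) x := by
  filter_upwards [(h.intervalIntegrable a b).ae_hasDerivAt_integral] with x hx hxm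
  have := (hx hxm a (by simp)).const_add (F a)
  refine this.congr_of_eventuallyEq (Eventually.of_forall fun y => ?_)
  exact h.eq_add a y

/-- A locally absolutely continuous function is a primitive of its almost everywhere derivative. -/
lemma of_ae_hasDerivAt (hf : ∀ a b : ℝ, IntervalIntegrable f volume a b)
    (hF : ∀ a b : ℝ, AbsolutelyContinuousOnInterval F a b)
    (hd : ∀ a b : ℝ, ∀ᵐ x, x ∈ uIcc a b → HasDerivAt F (f x) x) : IsPrimitive F f := by
  refine ⟨hf, fun a b => ?_⟩
  have hP : IsPrimitive (fun x => ∫ t in a..x, f t) f :=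
    ⟨hf, fun c d => intervalIntegral.integral_interval_sub_left (hf _ _) (hf _ _)⟩
  obtain ⟨C, hC⟩ := ((hF a b).sub
      (hP.absolutelyContinuousOnInterval a b)).const_of_ae_hasDerivAt_zero (by
    filter_upwards [hd a b, hP.ae_hasDerivAt a b] with x h1 h2 hx
    simpa using (h1 hx).sub (h2 hx))
  have h1 := hC a (by simp)
  have h2 := hC b (by simp)
  simp only [Pi.sub_apply, intervalIntegral.integral_same, sub_zero] at h1 h2
  rw [h1, ← h2]; ring

lemma mul (hF : IsPrimitive F f) (hG : IsPrimitive G g) :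
    IsPrimitive (fun x => F x * G x) (fun x => f x * G x + F x * g x) := by
  refine of_ae_hasDerivAt (fun a b => ?_) (fun a b => ?_) (fun a b => ?_)
  · exact ((hF.intervalIntegrable a b).mul_continuousOn hG.continuous.continuousOn).add
      ((hG.intervalIntegrable a b).continuousOn_mul hF.continuous.continuousOn)
  · exact (hF.absolutelyContinuousOnInterval a b).smul (hG.absolutelyContinuousOnInterval a b)
  · filter_upwards [hF.ae_hasDerivAt a b, hG.ae_hasDerivAt a b] with x h1 h2 hx
    exact (h1 hx).mul (h2 hx)

lemma of_hasDerivAt (hF : ∀ x, HasDerivAt F (f x) x) (hf : Continuous f) : IsPrimitive F f :=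
  ⟨fun a b => hf.intervalIntegrable a b, fun a b =>
    (intervalIntegral.integral_eq_sub_of_hasDerivAt (fun x _ => hF x)
      (hf.intervalIntegrable a b)).symm⟩

lemma sub (hF : IsPrimitive F f) (hG : IsPrimitive G g) :
    IsPrimitive (fun x => F x - G x) (fun x => f x - g x) :=
  ⟨fun a b => (hF.intervalIntegrable a b).sub (hG.intervalIntegrable a b), fun a b => by
    rw [intervalIntegral.integral_sub (hF.intervalIntegrable a b) (hG.intervalIntegrable a b),
      ← hF.sub_eq, ← hG.sub_eq]; ring⟩

lemma const_mul (c : ℂ) (hF : IsPrimitive F f) :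
    IsPrimitive (fun x => c * F x) (fun x => c * f x) :=
  ⟨fun a b => (hF.intervalIntegrable a b).const_mul c, fun a b => by
    rw [intervalIntegral.integral_const_mul, ← hF.sub_eq]; ring⟩

lemma conj (hF : IsPrimitive F f) :
    IsPrimitive (fun x => (starRingEnd ℂ) (F x)) (fun x => (starRingEnd ℂ) (f x)) := by
  refine ⟨fun a b => ?_, fun a b => ?_⟩
  · have := hF.intervalIntegrable a b
    rw [intervalIntegrable_iff] at this ⊢
    exact Complex.conjLIE.integrable_comp_iff.2 this
  · rw [← map_sub, hF.sub_eq, intervalIntegral.intervalIntegral_eq_integral_uIoc,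
      intervalIntegral.intervalIntegral_eq_integral_uIoc, integral_conj]
    split_ifs <;> simp

lemma comp_neg (hF : IsPrimitive F f) :
    IsPrimitive (fun x => F (-x)) (fun x => -f (-x)) :=
  ⟨fun a b => by
    have := ((hF.intervalIntegrable (-a) (-b)).comp_sub_left 0).neg
    simp only [zero_sub, sub_neg_eq_add, zero_add] at this
    exact this, fun a b => by
    rw [hF.sub_eq, intervalIntegral.integral_neg, intervalIntegral.integral_comp_neg,
      intervalIntegral.integral_symm]⟩

lemma congr {f' : ℝ → ℂ} (hF : IsPrimitive F f) (h : ∀ x, f x = f' x) : IsPrimitive F f' := by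
  have : f = f' := funext h
  exact this ▸ hF

lemma eq_of_ae_eq_zero (hF : IsPrimitive F f) {a b : ℝ} (h : ∀ᵐ t, t ∈ uIoc a b → f t = 0) :
    F b = F a := by
  have := hF.sub_eq a b
  rw [intervalIntegral.integral_congr_ae (g := fun _ => 0) h] at this
  simpa [sub_eq_zero] using this

/-- A primitive of a globally integrable function that is constant far to the left. -/
lemma eq_add_integral_Iic (hF : IsPrimitive F f) (hf : Integrable f) {c : ℂ} {M : ℝ}
    (hM : ∀ x ≤ M, F x = c) (x : ℝ) : F x = c + ∫ t in Iic x, f t := by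
  have h1 : Tendsto (fun a : ℝ => ∫ t in a..x, f t) atBot (𝓝 (∫ t in Iic x, f t)) :=
    intervalIntegral_tendsto_integral_Iic x hf.integrableOn tendsto_id
  have h2 : Tendsto (fun a : ℝ => ∫ t in a..x, f t) atBot (𝓝 (F x - c)) := by
    refine tendsto_const_nhds.congr' ?_
    filter_upwards [eventually_le_atBot M] with a ha
    rw [← hF.sub_eq, hM a ha]
  rw [tendsto_nhds_unique h1 h2]; ring

lemma of_integral_Iic (hf : Integrable f) (c : ℂ) :
    IsPrimitive (fun x => c + ∫ t in Iic x, f t) f :=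
  ⟨fun a b => hf.intervalIntegrable, fun a b => by
    rw [← intervalIntegral.integral_Iic_sub_Iic hf.integrableOn hf.integrableOn]; ring⟩

end IsPrimitive

/-! ### Volterra operators and the fundamental solution in the interaction picture -/

noncomputable section

variable {u w : ℝ → ℂ} {L : ℝ}

/-- Cumulative mass `∫_{-∞}^x |u|`. -/
def cumMass (u : ℝ → ℂ) (x : ℝ) : ℝ := ∫ t in Iic x, ‖u t‖

lemma cumMass_nonneg (u : ℝ → ℂ) (x : ℝ) : 0 ≤ cumMass u x :=
  integral_nonneg fun _ => norm_nonneg _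

lemma cumMass_le (hu : Integrable u) (x : ℝ) : cumMass u x ≤ ∫ t, ‖u t‖ :=
  setIntegral_le_integral hu.norm (Eventually.of_forall fun _ => norm_nonneg _)

lemma isPrimitive_cumMass (hu : Integrable u) :
    IsPrimitive (fun x => (cumMass u x : ℂ)) (fun x => (‖u x‖ : ℂ)) := by
  have h := IsPrimitive.of_integral_Iic (f := fun x => ((‖u x‖ : ℝ) : ℂ)) hu.norm.ofReal 0
  have e : (fun x => (0 : ℂ) + ∫ t in Iic x, ((‖u t‖ : ℝ) : ℂ)) = fun x => (cumMass u x : ℂ) := by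
    funext x
    rw [zero_add]; exact integral_ofReal
  rwa [e] at h

lemma continuous_cumMass (hu : Integrable u) : Continuous (cumMass u) := by
  exact Complex.continuous_re.comp (isPrimitive_cumMass hu).continuous

lemma isPrimitive_cumMass_pow (hu : Integrable u) (n : ℕ) :
    IsPrimitive (fun x => (cumMass u x : ℂ) ^ (n + 1))
      (fun x => (n + 1 : ℂ) * ((‖u x‖ : ℂ) * (cumMass u x : ℂ) ^ n)) := by
  induction n with
  | zero => simpa using isPrimitive_cumMass hu
  | succ n ih =>
    have h := (ih.mul (isPrimitive_cumMass hu))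
    refine (h.congr (f' := _) fun x => ?_)
    push_cast
    ring

lemma integrable_norm_mul_cumMass_pow (hu : Integrable u) (n : ℕ) :
    Integrable fun t => ‖u t‖ * cumMass u t ^ n := by
  refine hu.norm.mul_bdd (c := (∫ t, ‖u t‖) ^ n)
    ((continuous_cumMass hu).pow n).aestronglyMeasurable (Eventually.of_forall fun t => ?_)
  rw [norm_pow, Real.norm_of_nonneg (cumMass_nonneg u t)]
  exact pow_le_pow_left₀ (cumMass_nonneg u t) (cumMass_le hu t) n

lemma cumMass_eq_zero (hsupp : ∀ x, L < |x| → u x = 0) {x : ℝ} (hx : x ≤ -L) :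
    cumMass u x = 0 := by
  unfold cumMass
  rw [integral_Iic_eq_integral_Iio]
  refine (setIntegral_congr_fun (g := fun _ => (0 : ℝ)) measurableSet_Iio fun t ht => ?_).trans
    (by simp)
  have : u t = 0 := hsupp t (by
    have : t < -L := lt_of_lt_of_le ht hx
    have := neg_le_abs t
    linarith)
  simp [this]

lemma integral_norm_mul_cumMass_pow (hu : Integrable u) (hsupp : ∀ x, L < |x| → u x = 0)
    (n : ℕ) (x : ℝ) :
    ∫ t in Iic x, ‖u t‖ * cumMass u t ^ n = cumMass u x ^ (n + 1) / (n + 1) := by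
  have h := (isPrimitive_cumMass_pow hu n).eq_add_integral_Iic (c := 0) (M := -L) ?_ ?_ x
  · rw [integral_const_mul] at h
    have h2 : ∫ t in Iic x, ((‖u t‖ : ℂ) * (cumMass u t : ℂ) ^ n) =
        ((∫ t in Iic x, ‖u t‖ * cumMass u t ^ n : ℝ) : ℂ) := by
      refine Eq.trans ?_ integral_ofReal
      push_cast; rfl
    rw [h2, zero_add] at h
    have h3 : cumMass u x ^ (n + 1) = (n + 1) * ∫ t in Iic x, ‖u t‖ * cumMass u t ^ n := by
      exact_mod_cast h
    rw [h3]; field_simp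
  · refine Integrable.const_mul ?_ _
    have := (integrable_norm_mul_cumMass_pow hu n).ofReal (𝕜 := ℂ)
    push_cast at this
    exact this
  · intro y hy
    simp [cumMass_eq_zero hsupp hy]

lemma integrable_mul_bcf (hw : Integrable w) (f : ℝ →ᵇ ℂ) : Integrable fun t => w t * f t :=
  hw.mul_bdd (c := ‖f‖) f.continuous.aestronglyMeasurable
    (Eventually.of_forall fun t => f.norm_coe_le_norm t)

/-- The Volterra operator `f ↦ ∫_{-∞}^x w f` on bounded continuous functions. -/
def volterra (w : ℝ → ℂ) (hw : Integrable w) : (ℝ →ᵇ ℂ) →L[ℂ] (ℝ →ᵇ ℂ) :=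
  LinearMap.mkContinuous
    { toFun := fun f => BoundedContinuousFunction.ofNormedAddCommGroup
        (fun x => ∫ t in Iic x, w t * f t)
        (by simpa using (IsPrimitive.of_integral_Iic (integrable_mul_bcf hw f) 0).continuous)
        (∫ t, ‖w t * f t‖)
        (fun x => (norm_integral_le_integral_norm _).trans
          (setIntegral_le_integral (integrable_mul_bcf hw f).norm
            (Eventually.of_forall fun _ => norm_nonneg _)))
      map_add' := fun f g => by
        ext x
        simp only [BoundedContinuousFunction.coe_add, Pi.add_apply, mul_add,
          BoundedContinuousFunction.coe_ofNormedAddCommGroup]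
        exact integral_add (integrable_mul_bcf hw f).integrableOn
          (integrable_mul_bcf hw g).integrableOn
      map_smul' := fun c f => by
        ext x
        simp only [BoundedContinuousFunction.coe_smul, smul_eq_mul, RingHom.id_apply,
          BoundedContinuousFunction.coe_ofNormedAddCommGroup]
        rw [← integral_const_mul]
        exact integral_congr_ae (Eventually.of_forall fun t => by ring) }
    (∫ t, ‖w t‖) fun f => by
      rw [BoundedContinuousFunction.norm_le
        (mul_nonneg (integral_nonneg fun _ => norm_nonneg _) (norm_nonneg _))]
      intro x
      refine (norm_integral_le_integral_norm _).trans ((setIntegral_le_integral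
        (integrable_mul_bcf hw f).norm (Eventually.of_forall fun _ => norm_nonneg _)).trans ?_)
      rw [← integral_mul_const]
      refine integral_mono (integrable_mul_bcf hw f).norm (hw.norm.mul_const _) fun t => ?_
      rw [norm_mul]
      exact mul_le_mul_of_nonneg_left (f.norm_coe_le_norm t) (norm_nonneg _)

/-- The coordinate function truncated to `[-L, L]`, as a bounded continuous function. -/
def clamp (L : ℝ) : ℝ →ᵇ ℂ := BoundedContinuousFunction.ofNormedAddCommGroup
  (fun x : ℝ => ((max (-L) (min x L) : ℝ) : ℂ)) (by fun_prop) |L| fun x => by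
    rw [Complex.norm_real, Real.norm_eq_abs, abs_le]
    refine ⟨?_, ?_⟩
    · exact (neg_le_neg (le_abs_self L)).trans (le_max_left _ _)
    · exact max_le (neg_le_abs L) ((min_le_right _ _).trans (le_abs_self L))

lemma clamp_apply {x : ℝ} (hx : |x| ≤ L) : clamp L x = x := by
  have h := abs_le.1 hx
  change ((max (-L) (min x L) : ℝ) : ℂ) = x
  rw [min_eq_left h.2, max_eq_right h.1]

/-- The exponential `e^{2ikx}`, with `x` truncated to `[-L, L]`. It is entire in `k` with values
in the Banach algebra of bounded continuous functions. -/
def expClamp (L : ℝ) (k : ℂ) : ℝ →ᵇ ℂ := NormedSpace.exp ((2 * Complex.I * k) • clamp L)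

lemma expClamp_apply (k : ℂ) {x : ℝ} (hx : |x| ≤ L) :
    expClamp L k x = Complex.exp (2 * Complex.I * k * x) := by
  let ev : (ℝ →ᵇ ℂ) →ₐ[ℂ] ℂ :=
    { toFun := fun f => f x
      map_one' := rfl
      map_mul' := fun _ _ => rfl
      map_zero' := rfl
      map_add' := fun _ _ => rfl
      commutes' := fun c => by simp [BoundedContinuousFunction.algebraMap_apply] }
  have hev : Continuous ev := (BoundedContinuousFunction.evalCLM ℂ x).continuous
  have := NormedSpace.map_exp ev hev ((2 * Complex.I * k) • clamp L)
  change ev (expClamp L k) = _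
  rw [expClamp, this, Complex.exp_eq_exp_ℂ]
  congr 1
  change (2 * Complex.I * k) * clamp L x = _
  rw [clamp_apply hx]

lemma differentiable_expClamp (L : ℝ) : Differentiable ℂ (expClamp L) := by
  intro k
  have h1 : DifferentiableAt ℂ (NormedSpace.exp : (ℝ →ᵇ ℂ) → (ℝ →ᵇ ℂ))
      ((2 * Complex.I * k) • clamp L) := (NormedSpace.exp_analytic (𝕂 := ℂ) _).differentiableAt
  exact h1.comp k (by fun_prop)

/-- One half of the Picard iteration: `f ↦ ∫_{-∞}^x w e^{2ikt} f`. -/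
def halfStep (w : ℝ → ℂ) (hw : Integrable w) (L : ℝ) (k : ℂ) : (ℝ →ᵇ ℂ) →L[ℂ] (ℝ →ᵇ ℂ) :=
  volterra w hw * ContinuousLinearMap.mul ℂ (ℝ →ᵇ ℂ) (expClamp L k)

lemma halfStep_apply (hw : Integrable w) (hsupp : ∀ x, L < |x| → w x = 0) (k : ℂ) (f : ℝ →ᵇ ℂ)
    (x : ℝ) : halfStep w hw L k f x =
      ∫ t in Iic x, w t * Complex.exp (2 * Complex.I * k * t) * f t := by
  change ∫ t in Iic x, w t * (expClamp L k t * f t) = _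
  refine integral_congr_ae (Eventually.of_forall fun t => ?_)
  by_cases ht : L < |t|
  · simp [hsupp t ht]
  · simp only [expClamp_apply k (not_lt.1 ht)]; ring

lemma differentiable_halfStep (hw : Integrable w) (L : ℝ) :
    Differentiable ℂ (halfStep w hw L) := by
  unfold halfStep
  exact (differentiable_const _).mul
    ((ContinuousLinearMap.mul ℂ (ℝ →ᵇ ℂ)).differentiable.comp (differentiable_expClamp L))

/-- Each half step integrates one more power of the cumulative mass, which produces the factorial
decay of the Picard iterates. -/
lemma norm_halfStep_le (hu : Integrable u) (hw : Integrable w) (hwu : ∀ x, ‖w x‖ = ‖u x‖)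
    (hsupp : ∀ x, L < |x| → u x = 0) (k : ℂ) {f : ℝ →ᵇ ℂ} {c : ℝ} {n : ℕ}
    (hf : ∀ x, ‖f x‖ ≤ c * cumMass u x ^ n) (x : ℝ) :
    ‖halfStep w hw L k f x‖ ≤ ‖expClamp L k‖ * c * (cumMass u x ^ (n + 1) / (n + 1)) := by
  change ‖∫ t in Iic x, w t * (expClamp L k t * f t)‖ ≤ _
  rw [← integral_norm_mul_cumMass_pow hu hsupp, ← integral_const_mul]
  refine norm_integral_le_of_norm_le
    ((integrable_norm_mul_cumMass_pow hu n).const_mul _).integrableOn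
    (Eventually.of_forall fun t => ?_)
  rw [norm_mul, norm_mul, hwu]
  calc ‖u t‖ * (‖expClamp L k t‖ * ‖f t‖)
      ≤ ‖u t‖ * (‖expClamp L k‖ * (c * cumMass u t ^ n)) := by
        gcongr
        · exact (expClamp L k).norm_coe_le_norm t
        · exact hf t
    _ = _ := by ring

lemma integrable_neg_conj (hu : Integrable u) : Integrable fun x => -(starRingEnd ℂ) (u x) :=
  (Complex.conjLIE.integrable_comp_iff.2 hu).neg

/-- The Picard operator for the first component of the interaction picture system. -/
def picard (u : ℝ → ℂ) (hu : Integrable u) (L : ℝ) (k : ℂ) : (ℝ →ᵇ ℂ) →L[ℂ] (ℝ →ᵇ ℂ) :=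
  halfStep u hu L k * halfStep _ (integrable_neg_conj hu) L (-k)

lemma differentiable_picard (hu : Integrable u) (L : ℝ) : Differentiable ℂ (picard u hu L) := by
  have h : Differentiable ℂ fun k => halfStep _ (integrable_neg_conj hu) L (-k) :=
    Differentiable.comp (g := halfStep _ (integrable_neg_conj hu) L) (f := fun k => -k)
      (differentiable_halfStep (integrable_neg_conj hu) L) differentiable_id.fun_neg
  exact (differentiable_halfStep hu L).clm_comp h

lemma norm_picard_pow_apply_le (hu : Integrable u) (hsupp : ∀ x, L < |x| → u x = 0) (k : ℂ)
    (f : ℝ →ᵇ ℂ) (n : ℕ) (x : ℝ) :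
    ‖(picard u hu L k ^ n) f x‖ ≤
      ‖f‖ * (‖expClamp L k‖ * ‖expClamp L (-k)‖) ^ n / (2 * n).factorial *
        cumMass u x ^ (2 * n) := by
  induction n generalizing x with
  | zero => simpa using f.norm_coe_le_norm x
  | succ n ih =>
    have h1 := norm_halfStep_le hu (integrable_neg_conj hu) (fun x => by simp) hsupp (-k) ih
    have h2 := norm_halfStep_le hu hu (fun x => rfl) hsupp k
      (f := halfStep _ (integrable_neg_conj hu) L (-k) ((picard u hu L k ^ n) f))
      (c := ‖expClamp L (-k)‖ * (‖f‖ * (‖expClamp L k‖ * ‖expClamp L (-k)‖) ^ n /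
        (2 * n).factorial) / ((2 * n : ℕ) + 1)) (n := 2 * n + 1)
      (fun x => (h1 x).trans (le_of_eq (by ring))) x
    rw [pow_succ']
    refine h2.trans (le_of_eq ?_)
    rw [show 2 * (n + 1) = (2 * n + 1) + 1 by ring, Nat.factorial_succ, Nat.factorial_succ]
    push_cast
    field_simp
    ring

lemma summable_picard_pow (hu : Integrable u) (hsupp : ∀ x, L < |x| → u x = 0) (k : ℂ) :
    Summable (picard u hu L k ^ ·) := by
  set C := (‖expClamp L k‖ * ‖expClamp L (-k)‖) * (∫ t, ‖u t‖) ^ 2 with hC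
  have hC0 : 0 ≤ C := by positivity
  refine Summable.of_norm_bounded (Real.summable_pow_div_factorial C) fun n => ?_
  refine ContinuousLinearMap.opNorm_le_bound _ (by positivity) fun f => ?_
  rw [BoundedContinuousFunction.norm_le (by positivity)]
  intro x
  refine (norm_picard_pow_apply_le hu hsupp k f n x).trans ?_
  have h1 : cumMass u x ^ (2 * n) ≤ (∫ t, ‖u t‖) ^ (2 * n) :=
    pow_le_pow_left₀ (cumMass_nonneg u x) (cumMass_le hu x) _
  have h2 : ((n.factorial : ℕ) : ℝ) ≤ ((2 * n).factorial : ℕ) := by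
    exact_mod_cast Nat.factorial_le (by omega)
  calc _ ≤ ‖f‖ * (‖expClamp L k‖ * ‖expClamp L (-k)‖) ^ n / n.factorial *
        (∫ t, ‖u t‖) ^ (2 * n) := by
          have := cumMass_nonneg u x
          gcongr
    _ = _ := by rw [hC, mul_pow, pow_mul]; ring

lemma isUnit_one_sub_picard (hu : Integrable u) (hsupp : ∀ x, L < |x| → u x = 0) (k : ℂ) :
    IsUnit (1 - picard u hu L k) :=
  ⟨⟨_, _, (summable_picard_pow hu hsupp k).one_sub_mul_tsum_pow,
    (summable_picard_pow hu hsupp k).tsum_pow_mul_one_sub⟩, rfl⟩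

/-- In the interaction picture the Zakharov-Shabat system reads `f' = u e^{2ikx} g`,
`g' = -ū e^{-2ikx} f`, where `X = (e^{-ikx} f, e^{ikx} g)`. -/
structure IsInteractionSolution (u : ℝ → ℂ) (k : ℂ) (f g : ℝ → ℂ) : Prop where
  fst : IsPrimitive f fun t => u t * Complex.exp (2 * Complex.I * k * t) * g t
  snd : IsPrimitive g fun t =>
    -(starRingEnd ℂ) (u t) * Complex.exp (-(2 * Complex.I * k * t)) * f t

/-- Existence of the solution of the interaction picture system with data `(1, 0)` at `-∞`,
together with its analytic dependence on the spectral parameter. -/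
theorem exists_interactionSolution (hu : Integrable u) (hsupp : ∀ x, L < |x| → u x = 0) :
    ∃ m n : ℂ → ℝ → ℂ, (∀ k, IsInteractionSolution u k (m k) (n k)) ∧
      (∀ k x, x ≤ -L → m k x = 1) ∧ (∀ k x, x ≤ -L → n k x = 0) ∧
      (∀ x, Differentiable ℂ fun k => m k x) ∧ (∀ x, Differentiable ℂ fun k => n k x) := by
  have hs' : ∀ x, L < |x| → -(starRingEnd ℂ) (u x) = 0 := fun x hx => by simp [hsupp x hx]
  set M : ℂ → (ℝ →ᵇ ℂ) := fun k => Ring.inverse (1 - picard u hu L k) 1 with hM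
  set N : ℂ → (ℝ →ᵇ ℂ) := fun k => halfStep _ (integrable_neg_conj hu) L (-k) (M k) with hN
  have hMd : Differentiable ℂ M := by
    have : Differentiable ℂ fun k => Ring.inverse (1 - picard u hu L k) :=
      Differentiable.inverse (R := (ℝ →ᵇ ℂ) →L[ℂ] (ℝ →ᵇ ℂ)) (h := fun k => 1 - picard u hu L k)
        (Differentiable.const_sub (f := picard u hu L) (differentiable_picard hu L)
          (1 : (ℝ →ᵇ ℂ) →L[ℂ] (ℝ →ᵇ ℂ))) (isUnit_one_sub_picard hu hsupp)
    exact this.clm_apply (differentiable_const _)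
  have hNd : Differentiable ℂ N :=
    Differentiable.clm_apply (c := fun k => halfStep _ (integrable_neg_conj hu) L (-k))
      (Differentiable.comp (g := halfStep _ (integrable_neg_conj hu) L) (f := fun k => -k)
        (differentiable_halfStep (integrable_neg_conj hu) L) differentiable_id.fun_neg) hMd
  have hMe : ∀ k, M k = 1 + halfStep u hu L k (N k) := fun k => by
    have h : (1 - picard u hu L k) (M k) = 1 := by
      change ((1 - picard u hu L k) * Ring.inverse (1 - picard u hu L k)) 1 = 1
      rw [Ring.mul_inverse_cancel _ (isUnit_one_sub_picard hu hsupp k)]; rfl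
    have h' : M k - picard u hu L k (M k) = 1 := h
    rw [sub_eq_iff_eq_add] at h'
    exact h'
  have e1 : ∀ k x, M k x = 1 + ∫ t in Iic x, u t * Complex.exp (2 * Complex.I * k * t) * N k t := by
    intro k x
    conv_lhs => rw [hMe k]
    rw [← halfStep_apply hu hsupp]; rfl
  have e2 : ∀ k x, N k x = 0 + ∫ t in Iic x,
      -(starRingEnd ℂ) (u t) * Complex.exp (-(2 * Complex.I * k * t)) * M k t := by
    intro k x
    have := halfStep_apply (integrable_neg_conj hu) hs' (-k) (M k) x
    rw [zero_add]
    refine this.trans (integral_congr_ae (Eventually.of_forall fun t => ?_))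
    simp only
    congr 3
    ring
  have hint : ∀ (w : ℝ → ℂ) (hw : Integrable w) (hws : ∀ x, L < |x| → w x = 0) (k : ℂ)
      (f : ℝ →ᵇ ℂ), Integrable fun t => w t * Complex.exp (2 * Complex.I * k * t) * f t := by
    intro w hw hws k f
    refine (integrable_mul_bcf hw (expClamp L k * f)).congr (Eventually.of_forall fun t => ?_)
    by_cases ht : L < |t|
    · simp [hws t ht]
    · simp only [BoundedContinuousFunction.mul_apply, expClamp_apply k (not_lt.1 ht)]; ring
  have hint2 : ∀ k, Integrable fun t =>
      -(starRingEnd ℂ) (u t) * Complex.exp (-(2 * Complex.I * k * t)) * M k t := fun k =>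
    (hint _ (integrable_neg_conj hu) hs' (-k) (M k)).congr (Eventually.of_forall fun t => by
      simp only
      congr 3
      ring)
  have hvan : ∀ (F : ℝ → ℂ), (∀ x, L < |x| → F x = 0) → ∀ x ≤ -L, ∫ t in Iic x, F t = 0 := by
    intro F hF x hx
    rw [integral_Iic_eq_integral_Iio]
    refine (setIntegral_congr_fun (g := fun _ => (0 : ℂ)) measurableSet_Iio fun t ht => ?_).trans
      (by simp)
    have h1 : t < -L := lt_of_lt_of_le ht hx
    have h2 := neg_le_abs t
    exact hF t (by linarith)
  refine ⟨fun k => M k, fun k => N k, fun k => ⟨?_, ?_⟩, fun k x hx => ?_, fun k x hx => ?_,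
    fun x => ?_, fun x => ?_⟩
  · simp only
    rw [show (M k : ℝ → ℂ) = _ from funext (e1 k)]
    exact IsPrimitive.of_integral_Iic (hint u hu hsupp k (N k)) 1
  · simp only
    rw [show (N k : ℝ → ℂ) = _ from funext (e2 k)]
    exact IsPrimitive.of_integral_Iic (hint2 k) 0
  · simp only
    rw [e1, hvan _ (fun t ht => by simp [hsupp t ht]) x hx, add_zero]
  · simp only
    rw [e2, hvan _ (fun t ht => by simp [hsupp t ht]) x hx, add_zero]
  · exact (BoundedContinuousFunction.evalCLM ℂ x).differentiable.comp hMd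
  · exact (BoundedContinuousFunction.evalCLM ℂ x).differentiable.comp hNd

end

/-! ### Solutions in the interaction picture -/

noncomputable section

variable {u : ℝ → ℂ} {L : ℝ} {k : ℂ}

/-- The potential `x ↦ conj (u (-x))` of the system obtained by reflecting the line and exchanging
the two components; this exchanges the two Jost solutions. -/
def reflected (u : ℝ → ℂ) (x : ℝ) : ℂ := (starRingEnd ℂ) (u (-x))

lemma reflected_reflected (u : ℝ → ℂ) : reflected (reflected u) = u := by
  funext x; simp [reflected]

lemma integrable_reflected (hu : Integrable u) : Integrable (reflected u) :=
  Complex.conjLIE.integrable_comp_iff.2 hu.comp_neg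

lemma reflected_eq_zero (hsupp : ∀ x, L < |x| → u x = 0) (x : ℝ) (hx : L < |x|) :
    reflected u x = 0 := by
  simp [reflected, hsupp (-x) (by rwa [abs_neg])]

namespace IsInteractionSolution

variable {f g f' g' : ℝ → ℂ}

lemma sub (h : IsInteractionSolution u k f g) (h' : IsInteractionSolution u k f' g') :
    IsInteractionSolution u k (fun x => f x - f' x) (fun x => g x - g' x) :=
  ⟨(h.fst.sub h'.fst).congr fun x => by ring, (h.snd.sub h'.snd).congr fun x => by ring⟩

lemma const_mul (c : ℂ) (h : IsInteractionSolution u k f g) :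
    IsInteractionSolution u k (fun x => c * f x) (fun x => c * g x) :=
  ⟨(h.fst.const_mul c).congr fun x => by ring, (h.snd.const_mul c).congr fun x => by ring⟩

lemma conj (h : IsInteractionSolution u ((starRingEnd ℂ) k) f g) :
    IsInteractionSolution u k (fun x => (starRingEnd ℂ) (g x))
      (fun x => -(starRingEnd ℂ) (f x)) := by
  refine ⟨h.snd.conj.congr fun x => ?_, ?_⟩
  · simp only [map_mul, map_neg, Complex.conj_conj, ← Complex.exp_conj, Complex.conj_ofReal,
      Complex.conj_I, Complex.conj_ofNat]
    ring_nf
  · have := (h.fst.conj.const_mul (-1)).congr (f' := fun t =>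
      -(starRingEnd ℂ) (u t) * Complex.exp (-(2 * Complex.I * k * t)) * (starRingEnd ℂ) (g t))
      fun x => by
        simp only [map_mul, ← Complex.exp_conj, Complex.conj_ofReal,
          Complex.conj_I, Complex.conj_ofNat, Complex.conj_conj]
        ring_nf
    simpa using this

lemma comp_neg (h : IsInteractionSolution (reflected u) k f g) :
    IsInteractionSolution u k (fun x => g (-x)) (fun x => f (-x)) := by
  refine ⟨h.snd.comp_neg.congr fun x => ?_, h.fst.comp_neg.congr fun x => ?_⟩
  · simp only [reflected, Complex.conj_conj, neg_neg, Complex.ofReal_neg]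
    ring_nf
  · simp only [reflected, neg_neg, Complex.ofReal_neg]
    ring_nf

/-- The Wronskian of two solutions is constant, since the system has trace zero. -/
lemma wronskian_eq (h : IsInteractionSolution u k f g) (h' : IsInteractionSolution u k f' g')
    (x y : ℝ) : f x * g' x - g x * f' x = f y * g' y - g y * f' y := by
  refine ((h.fst.mul h'.snd).sub (h.snd.mul h'.fst)).eq_of_ae_eq_zero
    (Eventually.of_forall fun t _ => ?_)
  ring

lemma eq_of_le (h : IsInteractionSolution u k f g) (hsupp : ∀ x, L < |x| → u x = 0) {x : ℝ}
    (hx : L ≤ x) : f x = f L ∧ g x = g L := by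
  have : ∀ t ∈ uIoc L x, u t = 0 := fun t ht => by
    rw [uIoc_of_le hx] at ht
    exact hsupp t (ht.1.trans_le (le_abs_self t))
  exact ⟨h.fst.eq_of_ae_eq_zero (Eventually.of_forall fun t ht => by simp [this t ht]),
    h.snd.eq_of_ae_eq_zero (Eventually.of_forall fun t ht => by simp [this t ht])⟩

lemma eq_of_le_neg (h : IsInteractionSolution u k f g) (hsupp : ∀ x, L < |x| → u x = 0) {x : ℝ}
    (hx : x ≤ -L) : f x = f (-L) ∧ g x = g (-L) := by
  have : ∀ᵐ t : ℝ, t ∈ uIoc (-L) x → u t = 0 := by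
    filter_upwards [compl_mem_ae_iff.2 (measure_singleton (-L))] with t htL ht
    rw [uIoc_of_ge hx] at ht
    have : t < -L := lt_of_le_of_ne ht.2 htL
    have := neg_le_abs t
    exact hsupp t (by linarith)
  exact ⟨h.fst.eq_of_ae_eq_zero (this.mono fun t h ht => by simp [h ht]),
    h.snd.eq_of_ae_eq_zero (this.mono fun t h ht => by simp [h ht])⟩

end IsInteractionSolution

lemma intervalIntegrable_of_continuous (hu : Integrable u) {v w : ℝ → ℂ} (hv : Continuous v)
    (hw : Continuous w) (a b : ℝ) : IntervalIntegrable (fun t => v t + u t * w t) volume a b :=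
  (hv.intervalIntegrable a b).add
    ((hu.intervalIntegrable (a := a) (b := b)).mul_continuousOn hw.continuousOn)

lemma hasDerivAt_cexp_mul (c : ℂ) (x : ℝ) :
    HasDerivAt (fun x : ℝ => Complex.exp (c * x)) (c * Complex.exp (c * x)) x := by
  have h1 : HasDerivAt (fun x : ℝ => c * (x : ℂ)) (c * 1) x :=
    (Complex.ofRealCLM.hasDerivAt (x := x)).const_mul c
  simpa [mul_comm] using h1.cexp

lemma isPrimitive_cexp_mul (c : ℂ) :
    IsPrimitive (fun x : ℝ => Complex.exp (c * x)) (fun x => c * Complex.exp (c * x)) :=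
  .of_hasDerivAt (hasDerivAt_cexp_mul c) (by fun_prop)

lemma IsSolution.interaction (hu : Integrable u) {X : ℝ → ℂ × ℂ} (h : IsSolution u k X) :
    IsInteractionSolution u k (fun x => Complex.exp (Complex.I * k * x) * (X x).1)
      (fun x => Complex.exp (-(Complex.I * k) * x) * (X x).2) := by
  have c1 : Continuous fun x => (X x).1 := continuous_fst.comp h.1
  have c2 : Continuous fun x => (X x).2 := continuous_snd.comp h.1
  have p1 : IsPrimitive (fun x => (X x).1)
      (fun t => -(Complex.I * k) * (X t).1 + u t * (X t).2) :=
    ⟨intervalIntegrable_of_continuous hu (by fun_prop) c2, fun x y => (h.2 x y).1⟩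
  have p2 : IsPrimitive (fun x => (X x).2)
      (fun t => Complex.I * k * (X t).2 - (starRingEnd ℂ) (u t) * (X t).1) :=
    ⟨fun a b => ((intervalIntegrable_of_continuous (integrable_neg_conj hu)
      (v := fun t => Complex.I * k * (X t).2) (by fun_prop) c1) a b).congr
        (fun t _ => by ring), fun x y => (h.2 x y).2⟩
  refine ⟨((isPrimitive_cexp_mul (Complex.I * k)).mul p1).congr fun x => ?_,
    ((isPrimitive_cexp_mul (-(Complex.I * k))).mul p2).congr fun x => ?_⟩
  · rw [show 2 * Complex.I * k * x = Complex.I * k * x + Complex.I * k * x by ring,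
      show -(Complex.I * k) * x = -(Complex.I * k * x) by ring, Complex.exp_add, Complex.exp_neg]
    field_simp
    ring
  · rw [show -(2 * Complex.I * k * x) = -(Complex.I * k * x) + -(Complex.I * k * x) by ring,
      show -(Complex.I * k) * x = -(Complex.I * k * x) by ring, Complex.exp_add, Complex.exp_neg]
    field_simp
    ring

lemma IsInteractionSolution.isSolution {f g : ℝ → ℂ} (h : IsInteractionSolution u k f g) :
    IsSolution u k (fun x => (Complex.exp (-(Complex.I * k) * x) * f x,
      Complex.exp (Complex.I * k * x) * g x)) := by
  have c1 := h.fst.continuous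
  have c2 := h.snd.continuous
  refine ⟨by fun_prop, fun x y => ⟨?_, ?_⟩⟩
  · refine (((isPrimitive_cexp_mul (-(Complex.I * k))).mul h.fst).congr
      (f' := fun t => -(Complex.I * k) * (Complex.exp (-(Complex.I * k) * t) * f t) +
        u t * (Complex.exp (Complex.I * k * t) * g t)) fun x => ?_).sub_eq x y
    rw [show 2 * Complex.I * k * x = Complex.I * k * x + Complex.I * k * x by ring,
      show -(Complex.I * k) * x = -(Complex.I * k * x) by ring, Complex.exp_add, Complex.exp_neg]
    field_simp
  · refine (((isPrimitive_cexp_mul (Complex.I * k)).mul h.snd).congr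
      (f' := fun t => Complex.I * k * (Complex.exp (Complex.I * k * t) * g t) -
        (starRingEnd ℂ) (u t) * (Complex.exp (-(Complex.I * k) * t) * f t)) fun x => ?_).sub_eq x y
    rw [show -(2 * Complex.I * k * x) = -(Complex.I * k * x) + -(Complex.I * k * x) by ring,
      show -(Complex.I * k) * x = -(Complex.I * k * x) by ring, Complex.exp_add, Complex.exp_neg]
    field_simp
    ring

/-- `(m k, n k)` is, for every spectral parameter `k`, the solution in the interaction picture with
data `(1, 0)` to the left of the support of `u`, and depends analytically on `k`. Up to exponential
factors this is the Jost solution normalized at `-∞`. -/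
structure IsFundamental (u : ℝ → ℂ) (L : ℝ) (m n : ℂ → ℝ → ℂ) : Prop where
  sol : ∀ k, IsInteractionSolution u k (m k) (n k)
  fst_eq_one : ∀ k x, x ≤ -L → m k x = 1
  snd_eq_zero : ∀ k x, x ≤ -L → n k x = 0
  differentiable_fst : ∀ x, Differentiable ℂ fun k => m k x
  differentiable_snd : ∀ x, Differentiable ℂ fun k => n k x

lemma exists_isFundamental (hu : Integrable u) (hsupp : ∀ x, L < |x| → u x = 0) :
    ∃ m n, IsFundamental u L m n := by
  obtain ⟨m, n, h1, h2, h3, h4, h5⟩ := exists_interactionSolution hu hsupp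
  exact ⟨m, n, h1, h2, h3, h4, h5⟩

namespace IsFundamental

variable {m n m' n' : ℂ → ℝ → ℂ}

/-- A solution vanishing at one point vanishes identically: its Wronskians with the two members of
a fundamental system are zero. -/
lemma eq_zero (hm : IsFundamental u L m n) {f g : ℝ → ℂ} (h : IsInteractionSolution u k f g)
    {x₀ : ℝ} (hf : f x₀ = 0) (hg : g x₀ = 0) (x : ℝ) : f x = 0 ∧ g x = 0 := by
  have hC := (hm.sol ((starRingEnd ℂ) k)).conj
  have w1 := h.wronskian_eq (hm.sol k) x x₀
  have w2 := h.wronskian_eq hC x x₀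
  have w3 := (hm.sol k).wronskian_eq hC x (-L)
  simp only [hf, hg, zero_mul, sub_zero] at w1 w2
  simp only [hm.fst_eq_one _ _ le_rfl, hm.snd_eq_zero _ _ le_rfl, map_one] at w3
  set C1 := (starRingEnd ℂ) (n ((starRingEnd ℂ) k) x)
  set C2 := (starRingEnd ℂ) (m ((starRingEnd ℂ) k) x)
  constructor
  · linear_combination C1 * w1 - (m k x) * w2 + f x * w3
  · linear_combination -C2 * w1 - (n k x) * w2 + g x * w3

lemma unique (hm : IsFundamental u L m n) {f g f' g' : ℝ → ℂ}
    (h : IsInteractionSolution u k f g) (h' : IsInteractionSolution u k f' g') {x₀ : ℝ}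
    (hf : f x₀ = f' x₀) (hg : g x₀ = g' x₀) (x : ℝ) : f x = f' x ∧ g x = g' x := by
  have := hm.eq_zero (h.sub h') (x₀ := x₀) (by simp [hf]) (by simp [hg]) x
  simpa [sub_eq_zero] using this

variable (hm : IsFundamental u L m n) (hm' : IsFundamental (reflected u) L m' n')
include hm

lemma eq_of_le (hsupp : ∀ x, L < |x| → u x = 0) {x : ℝ} (hx : L ≤ x) :
    m k x = m k L ∧ n k x = n k L := (hm.sol k).eq_of_le hsupp hx

lemma isJostMinus_iff (hu : Integrable u) (hsupp : ∀ x, L < |x| → u x = 0) (hL : 0 < L)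
    (hk : 0 ≤ k.im) (X : ℝ → ℂ × ℂ) : IsJostMinus u k X ↔
      X = fun x : ℝ => (Complex.exp (-(Complex.I * k) * x) * m k x,
        Complex.exp (Complex.I * k * x) * n k x) := by
  constructor
  · rintro ⟨h1, h2⟩
    have hs := h1.interaction hu
    rw [nhds_prod_eq, tendsto_prod_iff'] at h2
    simp only [Prod.smul_fst, Prod.smul_snd, smul_eq_mul] at h2
    have e1 : Complex.exp (Complex.I * k * (-L : ℝ)) * (X (-L)).1 = 1 := by
      refine tendsto_nhds_unique (tendsto_const_nhds.congr' ?_) h2.1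
      filter_upwards [eventually_le_atBot (-L)] with x hx
      exact (hs.eq_of_le_neg hsupp hx).1.symm
    have e2 : Complex.exp (-(Complex.I * k) * (-L : ℝ)) * (X (-L)).2 = 0 := by
      have h3 := h2.2.norm
      rw [norm_zero] at h3
      refine norm_le_zero_iff.1 (ge_of_tendsto h3 ?_)
      filter_upwards [eventually_le_atBot (-L)] with x hx
      -- the component is constant there in the interaction picture, where its weight `e^{-ikx}` is
      -- dominated by the weight `e^{ikx}` of the normalization
      have hx2 := (hs.eq_of_le_neg hsupp hx).2
      rw [← hx2, norm_mul, norm_mul]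
      refine mul_le_mul_of_nonneg_right ?_ (norm_nonneg _)
      rw [Complex.norm_exp, Complex.norm_exp, Real.exp_le_exp]
      simp only [Complex.neg_re, Complex.mul_re, Complex.I_re, zero_mul, Complex.I_im, one_mul,
        zero_sub, Complex.ofReal_re, Complex.mul_im, Complex.ofReal_im, mul_zero, sub_zero,
        neg_neg, zero_add, Complex.neg_im]
      nlinarith
    have hun := hm.unique hs (hm.sol k) (x₀ := -L) (by simpa [hm.fst_eq_one] using e1)
      (by simpa [hm.snd_eq_zero] using e2)
    funext x
    refine Prod.ext ?_ ?_
    · rw [← (hun x).1, ← mul_assoc, ← Complex.exp_add]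
      simp
    · rw [← (hun x).2, ← mul_assoc, ← Complex.exp_add]
      simp
  · rintro rfl
    refine ⟨(hm.sol k).isSolution, tendsto_const_nhds.congr' ?_⟩
    filter_upwards [eventually_le_atBot (-L)] with x hx
    rw [hm.fst_eq_one _ _ hx, hm.snd_eq_zero _ _ hx]
    refine Prod.ext ?_ (by simp)
    simp [← Complex.exp_add]

lemma jostMinus_eq (hu : Integrable u) (hsupp : ∀ x, L < |x| → u x = 0) (hL : 0 < L)
    (hk : 0 ≤ k.im) : jostMinus u k = fun x : ℝ => (Complex.exp (-(Complex.I * k) * x) * m k x,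
        Complex.exp (Complex.I * k * x) * n k x) := by
  rw [← hm.isJostMinus_iff hu hsupp hL hk]
  exact Classical.epsilon_spec ⟨_, (hm.isJostMinus_iff hu hsupp hL hk _).2 rfl⟩

include hm'

lemma isJostPlus_iff (hu : Integrable u) (hsupp : ∀ x, L < |x| → u x = 0) (hL : 0 < L)
    (hk : 0 ≤ k.im) (X : ℝ → ℂ × ℂ) : IsJostPlus u k X ↔
      X = fun x : ℝ => (Complex.exp (-(Complex.I * k) * x) * n' k (-x),
        Complex.exp (Complex.I * k * x) * m' k (-x)) := by
  constructor
  · rintro ⟨h1, h2⟩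
    have hs := h1.interaction hu
    rw [nhds_prod_eq, tendsto_prod_iff'] at h2
    simp only [Prod.smul_fst, Prod.smul_snd, smul_eq_mul, ← neg_mul] at h2
    have e2 : Complex.exp (-(Complex.I * k) * L) * (X L).2 = 1 := by
      refine tendsto_nhds_unique (tendsto_const_nhds.congr' ?_) h2.2
      filter_upwards [eventually_ge_atTop L] with x hx
      have := (hs.eq_of_le hsupp hx).2.symm
      simpa only [neg_mul] using this
    have e1 : Complex.exp (Complex.I * k * L) * (X L).1 = 0 := by
      have h3 := h2.1.norm
      rw [norm_zero] at h3
      refine norm_le_zero_iff.1 (ge_of_tendsto h3 ?_)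
      filter_upwards [eventually_ge_atTop L] with x hx
      have hx2 := (hs.eq_of_le hsupp hx).1
      rw [← hx2, norm_mul, norm_mul]
      refine mul_le_mul_of_nonneg_right ?_ (norm_nonneg _)
      rw [Complex.norm_exp, Complex.norm_exp, Real.exp_le_exp]
      simp only [Complex.neg_re, Complex.mul_re, Complex.I_re, zero_mul, Complex.I_im, one_mul,
        zero_sub, Complex.ofReal_re, Complex.mul_im, Complex.ofReal_im, mul_zero, sub_zero,
        zero_add, Complex.neg_im]
      nlinarith
    have hun := hm.unique hs (hm'.sol k).comp_neg (x₀ := L)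
      (by simpa [hm'.snd_eq_zero] using e1) (by simpa [hm'.fst_eq_one] using e2)
    funext x
    refine Prod.ext ?_ ?_
    · rw [← (hun x).1, ← mul_assoc, ← Complex.exp_add]
      simp
    · rw [← (hun x).2, ← mul_assoc, ← Complex.exp_add]
      simp
  · rintro rfl
    refine ⟨(hm'.sol k).comp_neg.isSolution, tendsto_const_nhds.congr' ?_⟩
    filter_upwards [eventually_ge_atTop L] with x hx
    rw [hm'.fst_eq_one _ _ (neg_le_neg hx), hm'.snd_eq_zero _ _ (neg_le_neg hx)]
    refine Prod.ext (by simp) ?_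
    simp [← Complex.exp_add]

lemma jostPlus_eq (hu : Integrable u) (hsupp : ∀ x, L < |x| → u x = 0) (hL : 0 < L)
    (hk : 0 ≤ k.im) : jostPlus u k = fun x : ℝ => (Complex.exp (-(Complex.I * k) * x) * n' k (-x),
        Complex.exp (Complex.I * k * x) * m' k (-x)) := by
  rw [← hm.isJostPlus_iff hm' hu hsupp hL hk]
  exact Classical.epsilon_spec ⟨_, (hm.isJostPlus_iff hm' hu hsupp hL hk _).2 rfl⟩

/-- The coefficient `a` is the same for the reflected potential. -/
lemma reflected_fst_eq (k : ℂ) : m' k L = m k L := by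
  have := (hm.sol k).wronskian_eq (hm'.sol k).comp_neg L (-L)
  simp only [neg_neg, hm'.fst_eq_one _ _ le_rfl, hm'.snd_eq_zero _ _ le_rfl,
    hm.fst_eq_one _ _ le_rfl, hm.snd_eq_zero _ _ le_rfl] at this
  linear_combination -this

omit hm'

lemma coeffA_eq (hu : Integrable u) (hsupp : ∀ x, L < |x| → u x = 0) (hL : 0 < L)
    (hk : 0 ≤ k.im) : coeffA u k = m k L := by
  refine Tendsto.limUnder_eq (tendsto_const_nhds.congr' ?_)
  filter_upwards [eventually_ge_atTop L] with x hx
  rw [hm.jostMinus_eq hu hsupp hL hk, ← mul_assoc, ← Complex.exp_add, (hm.eq_of_le hsupp hx).1]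
  simp

lemma coeffB_eq (hu : Integrable u) (hsupp : ∀ x, L < |x| → u x = 0) (hL : 0 < L)
    (k : ℝ) : coeffB u k = n k L := by
  refine Tendsto.limUnder_eq (tendsto_const_nhds.congr' ?_)
  filter_upwards [eventually_ge_atTop L] with x hx
  rw [hm.jostMinus_eq hu hsupp hL (by simp), ← mul_assoc, ← Complex.exp_add,
    (hm.eq_of_le hsupp hx).2]
  simp

include hm'

lemma coeffC_eq (hu : Integrable u) (hsupp : ∀ x, L < |x| → u x = 0) (hL : 0 < L)
    (k : ℝ) : coeffC u k = n' k L := by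
  refine Tendsto.limUnder_eq (tendsto_const_nhds.congr' ?_)
  filter_upwards [eventually_le_atBot (-L)] with x hx
  rw [hm.jostPlus_eq hm' hu hsupp hL (by simp), ← mul_assoc, ← Complex.exp_add,
    (hm'.eq_of_le (reflected_eq_zero hsupp) (le_neg_of_le_neg hx)).2]
  simp

/-- Decomposition of the left Jost solution along the solutions with data `(1, 0)` and `(0, 1)`
at `+∞`, with coefficients `a` and `b`. -/
lemma eq_add (k : ℂ) (x : ℝ) :
    m k x = m k L * (starRingEnd ℂ) (m' ((starRingEnd ℂ) k) (-x)) + n k L * n' k (-x) ∧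
    n k x = m k L * -(starRingEnd ℂ) (n' ((starRingEnd ℂ) k) (-x)) + n k L * m' k (-x) := by
  have hZ := (hm'.sol k).comp_neg
  have hE := (hm'.sol ((starRingEnd ℂ) k)).comp_neg.conj
  have := hm.unique (((hm.sol k).sub (hE.const_mul (m k L)))) (hZ.const_mul (n k L)) (x₀ := L)
    (by simp [hm'.fst_eq_one, hm'.snd_eq_zero]) (by simp [hm'.fst_eq_one, hm'.snd_eq_zero]) x
  constructor
  · linear_combination this.1
  · linear_combination this.2

end IsFundamental

end

/-! ### Principal parts and bound states -/

noncomputable section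

/-- Taylor expansion to finite order of an analytic function. -/
lemma exists_eq_sum_add_pow_mul {h : ℂ → ℂ} {z : ℂ} (hh : AnalyticAt ℂ h z) (M : ℕ) :
    ∃ (c : ℕ → ℂ) (g : ℂ → ℂ), AnalyticAt ℂ g z ∧
      ∀ w, h w = ∑ i ∈ Finset.range M, c i * (w - z) ^ i + (w - z) ^ M * g w := by
  induction M with
  | zero => exact ⟨0, h, hh, fun w => by simp⟩
  | succ M ih =>
    obtain ⟨c, g, hg, hc⟩ := ih
    obtain ⟨p, hp⟩ := hg
    refine ⟨fun i => if i = M then g z else c i, dslope g z,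
      ⟨_, hp.has_fpower_series_dslope_fslope⟩, fun w => ?_⟩
    have h1 : g w = g z + (w - z) * dslope g z w := by
      have := sub_smul_dslope g z w
      rw [smul_eq_mul] at this
      rw [this]; ring
    rw [hc w, Finset.sum_range_succ]
    simp only [if_true]
    have h2 : ∑ i ∈ Finset.range M, (if i = M then g z else c i) * (w - z) ^ i =
        ∑ i ∈ Finset.range M, c i * (w - z) ^ i :=
      Finset.sum_congr rfl fun i hi => by rw [if_neg (Finset.mem_range.1 hi).ne]
    rw [h2]
    linear_combination (w - z) ^ M * h1

/-- A quotient of analytic functions has a principal part of order at most the order of the zero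
of the denominator. -/
lemma exists_principalPart {a b : ℂ → ℂ} {z : ℂ} (ha : AnalyticAt ℂ a z) (hb : AnalyticAt ℂ b z)
    (hord : analyticOrderAt a z ≠ ⊤) :
    ∃ τ : ℕ → ℂ, (fun w => b w / a w - ∑ s ∈ Finset.range (analyticOrderNatAt a z),
      τ s / (w - z) ^ (s + 1)) =O[𝓝[≠] z] (fun _ => (1 : ℝ)) := by
  obtain ⟨g, hg, hgz, hag⟩ := (ha.analyticOrderNatAt_eq_iff hord).1 rfl
  set M := analyticOrderNatAt a z
  obtain ⟨c, q, hq, hc⟩ := exists_eq_sum_add_pow_mul (hb.div hg hgz) M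
  refine ⟨fun s => c (M - 1 - s), ?_⟩
  have hqO : q =O[𝓝[≠] z] (fun _ => (1 : ℝ)) :=
    (hq.continuousAt.tendsto.isBigO_one ℝ).mono nhdsWithin_le_nhds
  refine hqO.congr' ?_ EventuallyEq.rfl
  filter_upwards [nhdsWithin_le_nhds hag, nhdsWithin_le_nhds (hg.continuousAt.eventually_ne hgz),
    self_mem_nhdsWithin] with w h1 h2 h3
  have hwz : w - z ≠ 0 := sub_ne_zero.2 h3
  have h4 := hc w
  have h5 : b w / a w = (b / g) w / (w - z) ^ M := by
    rw [h1, smul_eq_mul, Pi.div_apply]; field_simp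
  rw [h5, h4, add_div, mul_div_cancel_left₀ _ (pow_ne_zero _ hwz), Finset.sum_div,
    ← Finset.sum_range_reflect]
  rw [eq_comm, sub_eq_iff_eq_add, add_comm, add_right_inj]
  refine Finset.sum_congr rfl fun i hi => ?_
  have hi' := Finset.mem_range.1 hi
  rw [div_eq_div_iff (pow_ne_zero _ hwz) (pow_ne_zero _ hwz), mul_assoc, ← pow_add]
  congr 2
  omega

/-- Riemann's theorem at finitely many isolated singularities. -/
lemma exists_removable {f : ℂ → ℂ} {B : Finset ℂ}
    (hd : ∀ z ∈ B, ∀ᶠ w in 𝓝[≠] z, DifferentiableAt ℂ f w)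
    (hb : ∀ z ∈ B, f =O[𝓝[≠] z] (fun _ => (1 : ℝ))) :
    ∃ G : ℂ → ℂ, (∀ w, w ∉ B → G w = f w) ∧ (∀ w ∈ B, DifferentiableAt ℂ G w) ∧
      ∀ w, w ∉ B → DifferentiableAt ℂ f w → DifferentiableAt ℂ G w := by
  classical
  set G : ℂ → ℂ := fun w => if w ∈ B then limUnder (𝓝[≠] w) f else f w with hG
  have hoff : ∀ w, w ∉ B → G w = f w := fun w hw => by simp [hG, hw]
  have hev : ∀ z, ∀ᶠ w in 𝓝[≠] z, w ∉ B := fun z => by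
    have h : ((B : Set ℂ) \ {z})ᶜ ∈ 𝓝 z :=
      (B.finite_toSet.subset sdiff_subset).isClosed.isOpen_compl.mem_nhds (by simp)
    filter_upwards [nhdsWithin_le_nhds h, self_mem_nhdsWithin] with w h1 h2 h3
    exact h1 ⟨h3, h2⟩
  refine ⟨G, hoff, fun z hz => ?_, fun w hw hf => ?_⟩
  · refine (Complex.analyticAt_of_differentiable_on_punctured_nhds_of_continuousAt ?_ ?_).differentiableAt
    · have h1 := (hd z hz).and (hev z)
      rw [eventually_nhdsWithin_iff, ← eventually_eventually_nhds] at h1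
      rw [eventually_nhdsWithin_iff]
      filter_upwards [h1] with w hw hwz
      have h2 : ∀ᶠ y in 𝓝 w, y ∉ B := by
        filter_upwards [hw, isOpen_compl_singleton.mem_nhds hwz] with y hy hyz using (hy hyz).2
      exact (hw.self_of_nhds hwz).1.congr_of_eventuallyEq (h2.mono hoff)
    · have h1 := Complex.tendsto_limUnder_of_differentiable_on_punctured_nhds_of_bounded_under
        (hd z hz) (by
          have h2 := ((hb z hz).sub (isBigO_const_const (f z) (one_ne_zero (α := ℝ)) _))
          exact (isBigO_one_iff ℝ).1 h2)
      have h2 : G z = limUnder (𝓝[≠] z) f := by simp [hG, hz]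
      rw [continuousAt_iff_punctured_nhds, h2]
      exact h1.congr' ((hev z).mono fun w hw => (hoff w hw).symm)
  · refine hf.congr_of_eventuallyEq ?_
    have : ((B : Set ℂ))ᶜ ∈ 𝓝 w := B.finite_toSet.isClosed.isOpen_compl.mem_nhds (by simpa using hw)
    filter_upwards [this] with y hy using hoff y (by simpa using hy)

lemma analyticOrderAt_ne_top {a : ℂ → ℂ} (ha : Differentiable ℂ a) (h0 : a 0 ≠ 0) (z : ℂ) :
    analyticOrderAt a z ≠ ⊤ := by
  intro h
  rw [analyticOrderAt_eq_top] at h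
  have := AnalyticOnNhd.eqOn_zero_of_preconnected_of_eventuallyEq_zero
    (fun w _ => ha.analyticAt w) isPreconnected_univ (mem_univ z) h
  exact h0 (this (mem_univ 0))

lemma finite_zeros {a : ℂ → ℂ} (ha : Differentiable ℂ a) (h0 : a 0 ≠ 0) {S : Set ℂ} {r : ℝ}
    (hS : ∀ z ∈ S, ‖z‖ ≤ r ∧ a z = 0) : S.Finite := by
  by_contra hinf
  obtain ⟨z, -, hz⟩ := Set.Infinite.exists_accPt_of_subset_isCompact hinf
    (isCompact_closedBall (0 : ℂ) r) fun z hz => by simpa using (hS z hz).1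
  refine analyticOrderAt_ne_top ha h0 z ?_
  rw [analyticOrderAt_eq_top, ← (ha.analyticAt z).frequently_zero_iff_eventually_zero]
  exact (accPt_iff_frequently_nhdsNE.1 hz).mono fun w hw => (hS w hw).2

/-- The rational function `∑_{k ∈ B} ∑_{s < M k} τ k s / (w - k)^{s+1}`. -/
def singularPart (B : Finset ℂ) (M : ℂ → ℕ) (τ : ℂ → ℕ → ℂ) (w : ℂ) : ℂ :=
  ∑ k ∈ B, ∑ s ∈ Finset.range (M k), τ k s / (w - k) ^ (s + 1)

/-- The exponential sum attached to the principal parts `τ`, as it occurs in the Marchenko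
kernel. -/
def exponentialSum (B : Finset ℂ) (M : ℂ → ℕ) (τ : ℂ → ℕ → ℂ) (α : ℝ) : ℂ :=
  ∑ k ∈ B, ∑ s ∈ Finset.range (M k),
    -Complex.I * Complex.I ^ s * τ k s *
      ((α : ℂ) ^ s / (Nat.factorial s : ℂ) * Complex.exp (Complex.I * k * α))

lemma differentiableAt_singularPart {B : Finset ℂ} (M : ℂ → ℕ) (τ : ℂ → ℕ → ℂ) {w : ℂ}
    (hw : w ∉ B) : DifferentiableAt ℂ (singularPart B M τ) w := by
  unfold singularPart
  refine DifferentiableAt.fun_sum fun k hk => DifferentiableAt.fun_sum fun s _ => ?_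
  have : w - k ≠ 0 := sub_ne_zero.2 fun h => hw (h ▸ hk)
  exact (differentiableAt_const _).div (by fun_prop) (pow_ne_zero _ this)

/-- Subtracting all principal parts from `b / a` leaves a function holomorphic on the closed
upper half plane. -/
lemma exists_regularPart {a b : ℂ → ℂ} (ha : Differentiable ℂ a) (hb : Differentiable ℂ b)
    {B : Finset ℂ} {M : ℂ → ℕ} {τ : ℂ → ℕ → ℂ} (h0 : a 0 ≠ 0)
    (hB : ∀ k, 0 ≤ k.im → a k = 0 → k ∈ B)
    (hτ : ∀ k ∈ B, (fun w => b w / a w - ∑ s ∈ Finset.range (M k), τ k s / (w - k) ^ (s + 1))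
      =O[𝓝[≠] k] (fun _ => (1 : ℝ))) :
    ∃ G : ℂ → ℂ, (∀ w, w ∉ B → G w = b w / a w - singularPart B M τ w) ∧
      ∀ w, 0 ≤ w.im → DifferentiableAt ℂ G w := by
  classical
  have hda : ∀ w, a w ≠ 0 → w ∉ B →
      DifferentiableAt ℂ (fun w => b w / a w - singularPart B M τ w) w := fun w h1 h2 =>
    ((hb w).div (ha w) h1).sub (differentiableAt_singularPart M τ h2)
  have hd : ∀ z ∈ B, ∀ᶠ w in 𝓝[≠] z,
      DifferentiableAt ℂ (fun w => b w / a w - singularPart B M τ w) w := fun z hz => by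
    have h1 : ∀ᶠ w in 𝓝[≠] z, a w ≠ 0 :=
      (ha.analyticAt z).eventually_eq_zero_or_eventually_ne_zero.resolve_left fun h =>
        analyticOrderAt_ne_top ha h0 z (analyticOrderAt_eq_top.2 h)
    have h : ((B : Set ℂ) \ {z})ᶜ ∈ 𝓝 z :=
      (B.finite_toSet.subset sdiff_subset).isClosed.isOpen_compl.mem_nhds (by simp)
    filter_upwards [h1, nhdsWithin_le_nhds h, self_mem_nhdsWithin] with w h1 h2 h3
    exact hda w h1 fun h4 => h2 ⟨h4, h3⟩
  have hbd : ∀ z ∈ B, (fun w => b w / a w - singularPart B M τ w) =O[𝓝[≠] z]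
      (fun _ => (1 : ℝ)) := fun z hz => by
    have h1 : (fun w => singularPart (B.erase z) M τ w) =O[𝓝[≠] z] (fun _ => (1 : ℝ)) :=
      ((differentiableAt_singularPart M τ (by simp)).continuousAt.tendsto.isBigO_one ℝ).mono
        nhdsWithin_le_nhds
    refine ((hτ z hz).sub h1).congr_left fun w => ?_
    simp only [singularPart]
    rw [← Finset.add_sum_erase B _ hz]
    ring
  obtain ⟨G, hG1, hG2, hG3⟩ := exists_removable hd hbd
  refine ⟨G, hG1, fun w hw => ?_⟩
  by_cases hwB : w ∈ B
  · exact hG2 w hwB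
  · exact hG3 w hwB (hda w (fun h => hwB (hB w hw h)) hwB)

section SpectralData

variable {u : ℝ → ℂ} {L : ℝ} {m n m' n' : ℂ → ℝ → ℂ}

lemma eventually_im_pos {k : ℂ} (hk : 0 < k.im) : ∀ᶠ w : ℂ in 𝓝 k, 0 < w.im :=
  Complex.continuous_im.continuousAt.eventually_const_lt hk

lemma IsFundamental.multiplicity_eq (hm : IsFundamental u L m n) (hu : Integrable u)
    (hsupp : ∀ x, L < |x| → u x = 0) (hL : 0 < L) {k : ℂ} (hk : 0 < k.im) :
    multiplicity u k = analyticOrderNatAt (fun w => m w L) k := by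
  unfold multiplicity analyticOrderNatAt
  rw [analyticOrderAt_congr]
  filter_upwards [eventually_im_pos hk] with w hw
  exact hm.coeffA_eq hu hsupp hL hw.le

lemma isBigO_one_of_continuousAt {f : ℂ → ℂ} {k : ℂ} (hf : ContinuousAt f k) :
    f =O[𝓝[≠] k] (fun _ => (1 : ℝ)) :=
  (hf.tendsto.isBigO_one ℝ).mono nhdsWithin_le_nhds

/-- The principal part of `b / a` turns the right Jost solution into the singular part of `T` times
the left one: the difference is the sum of the solution with data `(1, 0)` at `+∞` and the regular
part of `b / a` times the right Jost solution. -/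
lemma IsFundamental.isBigO_jost (hm : IsFundamental u L m n)
    (hm' : IsFundamental (reflected u) L m' n') (hu : Integrable u)
    (hsupp : ∀ x, L < |x| → u x = 0) (hL : 0 < L) (h0 : m 0 L ≠ 0) {k : ℂ} (hk : 0 < k.im)
    {M : ℕ} {τ : ℕ → ℂ} (hτ : (fun w => n w L / m w L - ∑ s ∈ Finset.range M,
      τ s / (w - k) ^ (s + 1)) =O[𝓝[≠] k] (fun _ => (1 : ℝ))) (x : ℝ) :
    (fun w : ℂ => transmission u w • jostMinus u w x -
      (∑ s ∈ Finset.range M, τ s / (w - k) ^ (s + 1)) • jostPlus u w x)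
        =O[𝓝[≠] k] (fun _ => (1 : ℝ)) := by
  have ha : Differentiable ℂ fun w => m w L := hm.differentiable_fst L
  have hane : ∀ᶠ w in 𝓝[≠] k, m w L ≠ 0 :=
    (ha.analyticAt k).eventually_eq_zero_or_eventually_ne_zero.resolve_left fun h =>
      analyticOrderAt_ne_top ha h0 k (analyticOrderAt_eq_top.2 h)
  have c1 : Continuous fun w => m' w (-x) := (hm'.differentiable_fst (-x)).continuous
  have c2 : Continuous fun w => n' w (-x) := (hm'.differentiable_snd (-x)).continuous
  have d1 : Continuous fun w => m' ((starRingEnd ℂ) w) (-x) := c1.comp Complex.continuous_conj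
  have d2 : Continuous fun w => n' ((starRingEnd ℂ) w) (-x) := c2.comp Complex.continuous_conj
  have key : (fun w : ℂ => (
      Complex.exp (-(Complex.I * w) * x) * (starRingEnd ℂ) (m' ((starRingEnd ℂ) w) (-x)) +
        (n w L / m w L - ∑ s ∈ Finset.range M, τ s / (w - k) ^ (s + 1)) *
          (Complex.exp (-(Complex.I * w) * x) * n' w (-x)),
      Complex.exp (Complex.I * w * x) * -(starRingEnd ℂ) (n' ((starRingEnd ℂ) w) (-x)) +
        (n w L / m w L - ∑ s ∈ Finset.range M, τ s / (w - k) ^ (s + 1)) *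
          (Complex.exp (Complex.I * w * x) * m' w (-x)))) =O[𝓝[≠] k] (fun _ => (1 : ℝ)) := by
    refine IsBigO.prod_left ?_ ?_
    · refine IsBigO.add (isBigO_one_of_continuousAt (Continuous.continuousAt ?_)) ?_
      · exact (by fun_prop : Continuous fun w : ℂ => Complex.exp (-(Complex.I * w) * x)).mul
          (Complex.continuous_conj.comp d1)
      · simpa using hτ.mul (isBigO_one_of_continuousAt (Continuous.continuousAt
          ((by fun_prop : Continuous fun w : ℂ => Complex.exp (-(Complex.I * w) * x)).mul c2)))
    · refine IsBigO.add (isBigO_one_of_continuousAt (Continuous.continuousAt ?_)) ?_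
      · exact (by fun_prop : Continuous fun w : ℂ => Complex.exp (Complex.I * w * x)).mul
          (Complex.continuous_conj.comp d2).neg
      · simpa using hτ.mul (isBigO_one_of_continuousAt (Continuous.continuousAt
          ((by fun_prop : Continuous fun w : ℂ => Complex.exp (Complex.I * w * x)).mul c1)))
  refine key.congr' ?_ EventuallyEq.rfl
  filter_upwards [hane, nhdsWithin_le_nhds (eventually_im_pos hk)] with w hw hwk
  rw [hm.jostMinus_eq hu hsupp hL hwk.le, hm.jostPlus_eq hm' hu hsupp hL hwk.le, transmission,
    hm.coeffA_eq hu hsupp hL hwk.le]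
  have e := hm.eq_add hm' w x
  refine Prod.ext ?_ ?_
  · simp only [Prod.fst_sub, Prod.smul_fst, smul_eq_mul]
    rw [e.1]
    field_simp
    ring
  · simp only [Prod.snd_sub, Prod.smul_snd, smul_eq_mul]
    rw [e.2]
    field_simp
    ring

lemma IsFundamental.exists_isLeftPrincipalPart (hm : IsFundamental u L m n)
    (hm' : IsFundamental (reflected u) L m' n') (hu : Integrable u)
    (hsupp : ∀ x, L < |x| → u x = 0) (hL : 0 < L) (h0 : m 0 L ≠ 0) {k : ℂ} (hk : 0 < k.im) :
    ∃ τ, IsLeftPrincipalPart u k τ := by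
  obtain ⟨τ, hτ⟩ := exists_principalPart ((hm.differentiable_fst L).analyticAt k)
    ((hm.differentiable_snd L).analyticAt k)
    (analyticOrderAt_ne_top (hm.differentiable_fst L) h0 k)
  rw [← hm.multiplicity_eq hu hsupp hL hk] at hτ
  refine ⟨fun s => τ s, fun x => ?_⟩
  have := hm.isBigO_jost hm' hu hsupp hL h0 hk hτ x
  simpa only [Finset.sum_range] using this

lemma IsFundamental.exists_isRightPrincipalPart (hm : IsFundamental u L m n)
    (hm' : IsFundamental (reflected u) L m' n') (hu : Integrable u)
    (hsupp : ∀ x, L < |x| → u x = 0) (hL : 0 < L) (h0 : m 0 L ≠ 0) {k : ℂ} (hk : 0 < k.im) :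
    ∃ τ, IsRightPrincipalPart u k τ := by
  have hu' := integrable_reflected hu
  have hs' := reflected_eq_zero hsupp
  have h0' : m' 0 L ≠ 0 := by rwa [hm.reflected_fst_eq hm']
  have hmr : IsFundamental (reflected (reflected u)) L m n := by rwa [reflected_reflected]
  obtain ⟨τ, hτ⟩ := exists_principalPart ((hm'.differentiable_fst L).analyticAt k)
    ((hm'.differentiable_snd L).analyticAt k)
    (analyticOrderAt_ne_top (hm'.differentiable_fst L) h0' k)
  have e1 : analyticOrderNatAt (fun w => m' w L) k = multiplicity u k := by
    rw [hm.multiplicity_eq hu hsupp hL hk]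
    congr 1
    funext w
    exact hm.reflected_fst_eq hm' w
  rw [e1] at hτ
  refine ⟨fun s => τ s, fun x => ?_⟩
  have h1 := hm'.isBigO_jost hmr hu' hs' hL h0' hk hτ (-x)
  have h3 := (((ContinuousLinearEquiv.prodComm ℂ ℂ ℂ).toContinuousLinearMap.isBigO_comp _ _).trans h1)
  refine h3.congr' ?_ EventuallyEq.rfl
  filter_upwards [nhdsWithin_le_nhds (eventually_im_pos hk)] with w hwk
  rw [hm.jostMinus_eq hu hsupp hL hwk.le, hm.jostPlus_eq hm' hu hsupp hL hwk.le, transmission,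
    transmission, hm.coeffA_eq hu hsupp hL hwk.le, hm'.coeffA_eq hu' hs' hL hwk.le,
    hm'.jostMinus_eq hu' hs' hL hwk.le, hm'.jostPlus_eq hmr hu' hs' hL hwk.le,
    hm.reflected_fst_eq hm']
  refine Prod.ext ?_ ?_
  · simp [Finset.sum_range]
  · simp [Finset.sum_range]

/-- The norming constants from the left come from the principal parts of `b / a`: at `x = L` the
second component of the defining relation of the numbers `τ` is `b / a - ∑ τ_s / (w - k)^{s+1}`, up
to an exponential factor. -/
lemma IsFundamental.exists_left_data (hm : IsFundamental u L m n)
    (hm' : IsFundamental (reflected u) L m' n') (hu : Integrable u)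
    (hsupp : ∀ x, L < |x| → u x = 0) (hL : 0 < L) (h0 : m 0 L ≠ 0)
    (hfin : (boundStates u).Finite) :
    ∃ τ : ℂ → ℕ → ℂ, (∀ k ∈ hfin.toFinset, (fun w => n w L / m w L -
        ∑ s ∈ Finset.range (multiplicity u k), τ k s / (w - k) ^ (s + 1))
          =O[𝓝[≠] k] (fun _ => (1 : ℝ))) ∧
      ∀ α : ℝ, spectralSumLeft u α = exponentialSum hfin.toFinset (multiplicity u) τ α := by
  classical
  refine ⟨fun k s => if h : s < multiplicity u k then
    Classical.epsilon (IsLeftPrincipalPart u k) ⟨s, h⟩ else 0, fun k hk => ?_, fun α => ?_⟩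
  · have hk' : 0 < k.im := ((hfin.mem_toFinset).1 hk).1
    have h1 := Classical.epsilon_spec (hm.exists_isLeftPrincipalPart hm' hu hsupp hL h0 hk') L
    have h2 := isBigO_snd_prod'.trans h1
    have h3 := (isBigO_one_of_continuousAt (k := k) (f := fun w => Complex.exp (-(Complex.I * w) * L))
      (by fun_prop)).mul h2
    simp only [mul_one] at h3
    refine h3.congr' ?_ EventuallyEq.rfl
    filter_upwards [nhdsWithin_le_nhds (eventually_im_pos hk')] with w hwk
    rw [hm.jostMinus_eq hu hsupp hL hwk.le, hm.jostPlus_eq hm' hu hsupp hL hwk.le, transmission,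
      hm.coeffA_eq hu hsupp hL hwk.le, Finset.sum_range]
    simp only [Prod.snd_sub, Prod.smul_snd, smul_eq_mul, hm'.fst_eq_one _ _ le_rfl, Fin.is_lt,
      dite_true, Fin.eta]
    rw [show -(Complex.I * w) * L = -(Complex.I * w * L) by ring, Complex.exp_neg]
    have := Complex.exp_ne_zero (Complex.I * w * L)
    field_simp
  · unfold spectralSumLeft exponentialSum
    rw [finsum_mem_eq_finite_toFinset_sum _ hfin]
    refine Finset.sum_congr rfl fun k _ => ?_
    rw [Finset.mul_sum, Finset.sum_range]
    refine Finset.sum_congr rfl fun s _ => ?_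
    simp only [normingLeft, Fin.is_lt, dite_true, Fin.eta]
    ring

/-- The norming constants from the right come, in the same way at `x = -L`, from the principal parts
of `c / a`. -/
lemma IsFundamental.exists_right_data (hm : IsFundamental u L m n)
    (hm' : IsFundamental (reflected u) L m' n') (hu : Integrable u)
    (hsupp : ∀ x, L < |x| → u x = 0) (hL : 0 < L) (h0 : m 0 L ≠ 0)
    (hfin : (boundStates u).Finite) :
    ∃ τ : ℂ → ℕ → ℂ, (∀ k ∈ hfin.toFinset, (fun w => n' w L / m' w L -
        ∑ s ∈ Finset.range (multiplicity u k), τ k s / (w - k) ^ (s + 1))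
          =O[𝓝[≠] k] (fun _ => (1 : ℝ))) ∧
      ∀ α : ℝ, spectralSumRight u α =
        exponentialSum hfin.toFinset (multiplicity u) τ (-α) := by
  classical
  refine ⟨fun k s => if h : s < multiplicity u k then
    Classical.epsilon (IsRightPrincipalPart u k) ⟨s, h⟩ else 0, fun k hk => ?_, fun α => ?_⟩
  · have hk' : 0 < k.im := ((hfin.mem_toFinset).1 hk).1
    have h1 := Classical.epsilon_spec (hm.exists_isRightPrincipalPart hm' hu hsupp hL h0 hk') (-L)
    have h2 := isBigO_fst_prod'.trans h1
    have h3 := (isBigO_one_of_continuousAt (k := k) (f := fun w => Complex.exp (-(Complex.I * w) * L))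
      (by fun_prop)).mul h2
    simp only [mul_one] at h3
    refine h3.congr' ?_ EventuallyEq.rfl
    filter_upwards [nhdsWithin_le_nhds (eventually_im_pos hk')] with w hwk
    rw [hm.jostMinus_eq hu hsupp hL hwk.le, hm.jostPlus_eq hm' hu hsupp hL hwk.le, transmission,
      hm.coeffA_eq hu hsupp hL hwk.le, hm.reflected_fst_eq hm', Finset.sum_range]
    simp only [Prod.fst_sub, Prod.smul_fst, smul_eq_mul, hm.fst_eq_one _ _ le_rfl, Fin.is_lt,
      dite_true, Fin.eta, neg_neg, Complex.ofReal_neg, neg_mul_neg]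
    rw [show -(Complex.I * w) * L = -(Complex.I * w * L) by ring, Complex.exp_neg]
    have := Complex.exp_ne_zero (Complex.I * w * L)
    field_simp
  · unfold spectralSumRight exponentialSum
    rw [finsum_mem_eq_finite_toFinset_sum _ hfin]
    refine Finset.sum_congr rfl fun k _ => ?_
    rw [Finset.mul_sum, Finset.sum_range]
    refine Finset.sum_congr rfl fun s _ => ?_
    simp only [normingRight, Fin.is_lt, dite_true, Fin.eta, Complex.ofReal_neg, mul_neg]
    rw [neg_pow Complex.I, neg_pow (α : ℂ)]
    ring

end SpectralData

end

/-! ### Behaviour at infinity in the closed upper half plane -/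

noncomputable section

/-- The filter of complex numbers tending to infinity within the closed upper half plane. -/
def upperInfty : Filter ℂ := cocompact ℂ ⊓ 𝓟 {w : ℂ | 0 ≤ w.im}

lemma eventually_upperInfty_iff {p : ℂ → Prop} :
    (∀ᶠ w in upperInfty, p w) ↔ ∃ K : ℝ, ∀ w : ℂ, 0 ≤ w.im → K ≤ ‖w‖ → p w := by
  rw [upperInfty, eventually_inf_principal, ← Metric.cobounded_eq_cocompact,
    ← comap_norm_atTop, eventually_comap]
  simp only [eventually_atTop, mem_ofPred_eq]
  constructor
  · rintro ⟨K, hK⟩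
    exact ⟨K, fun w hw hKw => hK _ hKw w rfl hw⟩
  · rintro ⟨K, hK⟩
    exact ⟨K, fun r hr w hwr hw => hK w hw (hwr ▸ hr)⟩

lemma tendsto_upperInfty_zero_iff {f : ℂ → ℂ} :
    Tendsto f upperInfty (𝓝 0) ↔
      ∀ ε > 0, ∃ K : ℝ, ∀ w : ℂ, 0 ≤ w.im → K ≤ ‖w‖ → ‖f w‖ ≤ ε := by
  rw [Metric.tendsto_nhds]
  simp only [dist_zero_right, eventually_upperInfty_iff]
  constructor
  · intro h ε hε
    obtain ⟨K, hK⟩ := h ε hε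
    exact ⟨K, fun w h1 h2 => (hK w h1 h2).le⟩
  · intro h ε hε
    obtain ⟨K, hK⟩ := h (ε / 2) (by positivity)
    exact ⟨K, fun w h1 h2 => (hK w h1 h2).trans_lt (by linarith)⟩

lemma eventually_upperInfty_im : ∀ᶠ w in upperInfty, 0 ≤ w.im :=
  eventually_upperInfty_iff.2 ⟨0, fun _ h _ => h⟩

lemma norm_cexp_I_mul_le {k : ℂ} (hk : 0 ≤ k.im) {c : ℝ} (hc : 0 ≤ c) :
    ‖Complex.exp (Complex.I * k * c)‖ ≤ 1 := by
  rw [Complex.norm_exp, Real.exp_le_one_iff]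
  simp only [Complex.mul_re, Complex.I_re, zero_mul, Complex.I_im, one_mul,
    zero_sub, Complex.ofReal_re, Complex.mul_im, Complex.ofReal_im, mul_zero, sub_zero]
  nlinarith

lemma tendsto_singularPart (B : Finset ℂ) (M : ℂ → ℕ) (τ : ℂ → ℕ → ℂ) :
    Tendsto (singularPart B M τ) upperInfty (𝓝 0) := by
  have h0 : Tendsto (singularPart B M τ) (cocompact ℂ) (𝓝 0) := by
    unfold singularPart
    rw [show (0 : ℂ) = ∑ k ∈ B, ∑ s ∈ Finset.range (M k), 0 by simp]
    refine tendsto_finsetSum _ fun k _ => tendsto_finsetSum _ fun s _ => ?_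
    have h1 : Tendsto (fun w : ℂ => w - k) (cocompact ℂ) (cocompact ℂ) := by
      simpa [sub_eq_add_neg] using (Homeomorph.addRight (-k)).isClosedEmbedding.tendsto_cocompact
    have h2 : Tendsto (fun w : ℂ => (w - k)⁻¹) (cocompact ℂ) (𝓝 0) :=
      tendsto_inv₀_cobounded.comp (by
        rw [← Metric.cobounded_eq_cocompact] at h1 ⊢; exact h1)
    have h3 := (h2.pow (s + 1)).const_mul (τ k s)
    simpa [div_eq_mul_inv] using h3
  exact h0.mono_left inf_le_left

/-- Riemann-Lebesgue lemma, uniform in the closed upper half plane and in the end points. -/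
lemma exists_norm_integral_cexp_le {v : ℝ → ℂ} (hv : Integrable v) {ε : ℝ} (hε : 0 < ε) :
    ∃ K : ℝ, ∀ k : ℂ, 0 ≤ k.im → K ≤ ‖k‖ → ∀ s x : ℝ, s ≤ x →
      ‖∫ t in s..x, v t * Complex.exp (2 * Complex.I * k * (x - t))‖ ≤ ε := by
  obtain ⟨g, hgc, hgd, hge⟩ := (memLp_one_iff_integrable.2 hv).exist_eLpNorm_sub_le
    ENNReal.one_ne_top le_rfl (half_pos hε)
  have hg1 : ContDiff ℝ 1 g := hgd.of_le (by exact_mod_cast le_top)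
  have hgi : Integrable g := hgd.continuous.integrable_of_hasCompactSupport hgc
  have hg'c : Continuous (deriv g) := hg1.continuous_deriv le_rfl
  have hg'i : Integrable (deriv g) := hg'c.integrable_of_hasCompactSupport hgc.deriv
  obtain ⟨C, hC⟩ := hgd.continuous.bounded_above_of_compact_support hgc
  have hC0 : 0 ≤ C := (norm_nonneg _).trans (hC 0)
  have hdiff : ∫ t, ‖v t - g t‖ ≤ ε / 2 := by
    have h := eLpNorm_one_eq_lintegral_enorm (f := v - g) (μ := volume)
    rw [h] at hge
    refine (integral_norm_eq_lintegral_enorm (hv.sub hgi).aestronglyMeasurable).le.trans ?_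
    exact ENNReal.toReal_le_of_le_ofReal (by positivity) hge
  set D := 2 * C + ∫ t, ‖deriv g t‖ with hD
  have hD0 : 0 ≤ D := by
    have : 0 ≤ ∫ t, ‖deriv g t‖ := integral_nonneg fun _ => norm_nonneg _
    positivity
  refine ⟨max 1 (D / ε), fun k hk hKk s x hsx => ?_⟩
  have hk1 : 1 ≤ ‖k‖ := (le_max_left _ _).trans hKk
  have hk0 : k ≠ 0 := norm_pos_iff.1 (by linarith)
  have hkD : D / ε ≤ ‖k‖ := (le_max_right _ _).trans hKk
  have hE : ∀ t ≤ x, ‖Complex.exp (2 * Complex.I * k * (x - t))‖ ≤ 1 := fun t ht => by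
    have := norm_cexp_I_mul_le hk (c := 2 * (x - t)) (by linarith)
    refine le_trans (le_of_eq ?_) this
    congr 2
    push_cast; ring
  have hEc : Continuous fun t : ℝ => Complex.exp (2 * Complex.I * k * (x - t)) := by fun_prop
  -- integration by parts for the smooth part
  have hsmooth : ‖∫ t in s..x, g t * Complex.exp (2 * Complex.I * k * (x - t))‖ ≤ ε / 2 := by
    have hder : ∀ t : ℝ, HasDerivAt (fun t : ℝ => -(1 / (2 * Complex.I * k)) *
        Complex.exp (2 * Complex.I * k * (x - t)))
        (Complex.exp (2 * Complex.I * k * (x - t))) t := fun t => by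
      have h1 : HasDerivAt (fun t : ℝ => 2 * Complex.I * k * ((x : ℂ) - (t : ℂ)))
          (2 * Complex.I * k * (0 - 1)) t :=
        ((hasDerivAt_const t (x : ℂ)).sub (Complex.ofRealCLM.hasDerivAt (x := t))).const_mul _
      convert! h1.cexp.const_mul (-(1 / (2 * Complex.I * k))) using 1
      have := Complex.I_ne_zero
      field_simp
      ring
    have hparts := intervalIntegral.integral_mul_deriv_eq_deriv_mul (a := s) (b := x)
      (fun t _ => (hg1.differentiable one_ne_zero t).hasDerivAt) (fun t _ => hder t)
      (hg'c.intervalIntegrable _ _) (hEc.intervalIntegrable _ _)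
    rw [hparts]
    have hn : ‖-(1 / (2 * Complex.I * k))‖ = 1 / (2 * ‖k‖) := by simp
    have hb : ∀ t ≤ x, ‖-(1 / (2 * Complex.I * k)) * Complex.exp (2 * Complex.I * k * (x - t))‖ ≤
        1 / (2 * ‖k‖) := fun t ht => by
      rw [norm_mul, hn]
      exact mul_le_of_le_one_right (by positivity) (hE t ht)
    have i1 : ‖∫ t in s..x, deriv g t * (-(1 / (2 * Complex.I * k)) *
        Complex.exp (2 * Complex.I * k * (x - t)))‖ ≤ (∫ t, ‖deriv g t‖) * (1 / (2 * ‖k‖)) := by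
      rw [intervalIntegral.integral_of_le hsx, ← integral_mul_const]
      refine (norm_integral_le_of_norm_le (g := fun t => ‖deriv g t‖ * (1 / (2 * ‖k‖)))
        (hg'i.norm.mul_const _).integrableOn ?_).trans
        (setIntegral_le_integral (hg'i.norm.mul_const _)
          (Eventually.of_forall fun t => mul_nonneg (norm_nonneg _) (by positivity)))
      refine (ae_restrict_iff' measurableSet_Ioc).2 (Eventually.of_forall fun t ht => ?_)
      rw [norm_mul]
      exact mul_le_mul_of_nonneg_left (hb t ht.2) (norm_nonneg _)
    have hDk : D * (1 / (2 * ‖k‖)) ≤ ε / 2 := by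
      rw [div_le_iff₀ hε] at hkD
      rw [mul_one_div, div_le_iff₀ (by positivity)]
      linarith
    refine le_trans ?_ hDk
    calc _ ≤ C * (1 / (2 * ‖k‖)) + C * (1 / (2 * ‖k‖)) +
          (∫ t, ‖deriv g t‖) * (1 / (2 * ‖k‖)) := by
          refine (norm_sub_le _ _).trans (add_le_add ((norm_sub_le _ _).trans (add_le_add ?_ ?_)) i1)
          · rw [norm_mul]
            exact mul_le_mul (hC _) (hb x le_rfl) (norm_nonneg _) hC0
          · rw [norm_mul]
            exact mul_le_mul (hC _) (hb s hsx) (norm_nonneg _) hC0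
      _ = D * (1 / (2 * ‖k‖)) := by rw [hD]; ring
  have hrough : ‖∫ t in s..x, (v t - g t) * Complex.exp (2 * Complex.I * k * (x - t))‖ ≤ ε / 2 := by
    refine le_trans ?_ hdiff
    rw [intervalIntegral.integral_of_le hsx]
    refine (norm_integral_le_of_norm_le (g := fun t => ‖v t - g t‖)
        (hv.sub hgi).norm.integrableOn ?_).trans
        (setIntegral_le_integral (hv.sub hgi).norm (Eventually.of_forall fun t => norm_nonneg _))
    refine (ae_restrict_iff' measurableSet_Ioc).2 (Eventually.of_forall fun t ht => ?_)
    rw [norm_mul]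
    exact mul_le_of_le_one_right (norm_nonneg _) (hE t ht.2)
  have hsplit : ∫ t in s..x, v t * Complex.exp (2 * Complex.I * k * (x - t)) =
      (∫ t in s..x, (v t - g t) * Complex.exp (2 * Complex.I * k * (x - t))) +
        ∫ t in s..x, g t * Complex.exp (2 * Complex.I * k * (x - t)) := by
    rw [← intervalIntegral.integral_add]
    · congr 1; funext t; ring
    · exact ((hv.sub hgi).intervalIntegrable (a := s) (b := x)).mul_continuousOn hEc.continuousOn
    · exact (hgi.intervalIntegrable (a := s) (b := x)).mul_continuousOn hEc.continuousOn
  rw [hsplit]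
  exact (norm_add_le _ _).trans (by linarith)

variable {u : ℝ → ℂ} {L : ℝ} {m n : ℂ → ℝ → ℂ}

/-- The equation for the second component after one integration by parts: the correction to the
Born approximation contains the product of two oscillating integrals. -/
lemma IsFundamental.snd_eq (hm : IsFundamental u L m n) (hu : Integrable u) (k : ℂ) (x : ℝ) :
    n k x = -(∫ t in (-L)..x, (starRingEnd ℂ) (u t) * Complex.exp (-(2 * Complex.I * k * t))) -
      ∫ s in (-L)..x, u s * Complex.exp (2 * Complex.I * k * s) * n k s *
        ∫ t in s..x, (starRingEnd ℂ) (u t) * Complex.exp (-(2 * Complex.I * k * t)) := by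
  have hloc : ∀ a b : ℝ, IntervalIntegrable (fun t : ℝ => (starRingEnd ℂ) (u t) *
      Complex.exp (-(2 * Complex.I * k * t))) volume a b := fun a b =>
    ((Complex.conjLIE.integrable_comp_iff.2 hu).intervalIntegrable (a := a) (b := b)).mul_continuousOn
      (by fun_prop)
  have hΦ : IsPrimitive (fun s => ∫ t in s..x, (starRingEnd ℂ) (u t) *
      Complex.exp (-(2 * Complex.I * k * t)))
      (fun t => -((starRingEnd ℂ) (u t) * Complex.exp (-(2 * Complex.I * k * t)))) :=
    ⟨fun a b => (hloc a b).neg, fun a b => by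
      rw [intervalIntegral.integral_neg, ← intervalIntegral.integral_add_adjacent_intervals
        (hloc a b) (hloc b x)]
      ring⟩
  have h1 := ((hm.sol k).fst.mul hΦ)
  have h2 := h1.sub_eq (-L) x
  have h3 := (hm.sol k).snd.sub_eq (-L) x
  rw [hm.snd_eq_zero k _ le_rfl, sub_zero] at h3
  simp only [intervalIntegral.integral_same, mul_zero, hm.fst_eq_one k _ le_rfl, one_mul] at h2
  rw [intervalIntegral.integral_add (((hm.sol k).fst.intervalIntegrable _ _).mul_continuousOn
      hΦ.continuous.continuousOn)
    (((hΦ.intervalIntegrable _ _).continuousOn_mul (hm.sol k).fst.continuous.continuousOn))] at h2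
  have h4 : ∫ t in (-L)..x, m k t * -((starRingEnd ℂ) (u t) *
      Complex.exp (-(2 * Complex.I * k * t))) = n k x := by
    rw [h3]; congr 1; funext t; ring
  rw [h4] at h2
  linear_combination -h2

/-- Uniform smallness of `e^{2ikx} n` and `m - 1` for large `k` in the closed upper half plane:
the supremum of `e^{2ikx} n` over `[-L, L]` is absorbed into the left-hand side of
`IsFundamental.snd_eq`, both oscillating integrals of which are small. -/
lemma IsFundamental.exists_bound (hm : IsFundamental u L m n) (hu : Integrable u) (hL : 0 < L)
    {ε : ℝ} (hε : 0 < ε) :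
    ∃ K : ℝ, ∀ k : ℂ, 0 ≤ k.im → K ≤ ‖k‖ → ∀ x ∈ Icc (-L) L,
      ‖Complex.exp (2 * Complex.I * k * x) * n k x‖ ≤ ε ∧ ‖m k x - 1‖ ≤ ε := by
  set A := ∫ t, ‖u t‖ with hA
  have hA0 : 0 ≤ A := integral_nonneg fun _ => norm_nonneg _
  set δ := min (ε / (2 * (A + 1))) (1 / (2 * (A + 1))) with hδ
  have hδ0 : 0 < δ := by positivity
  have hδ1 : δ * (2 * (A + 1)) ≤ ε := by
    rw [← le_div_iff₀ (by positivity)]; exact min_le_left _ _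
  have hδ2 : δ * (2 * (A + 1)) ≤ 1 := by
    rw [← le_div_iff₀ (by positivity)]; exact min_le_right _ _
  obtain ⟨K, hK⟩ := exists_norm_integral_cexp_le (Complex.conjLIE.integrable_comp_iff.2 hu) hδ0
  refine ⟨K, fun k hk hKk => ?_⟩
  set N : ℝ → ℂ := fun x => Complex.exp (2 * Complex.I * k * x) * n k x with hN
  have hNc : Continuous N :=
    (by fun_prop : Continuous fun x : ℝ => Complex.exp (2 * Complex.I * k * x)).mul
      (hm.sol k).snd.continuous
  have hq : ∀ s x : ℝ, s ≤ x → ‖Complex.exp (2 * Complex.I * k * x) *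
      ∫ t in s..x, (starRingEnd ℂ) (u t) * Complex.exp (-(2 * Complex.I * k * t))‖ ≤ δ := by
    intro s x hsx
    refine le_trans (le_of_eq ?_) (hK k hk hKk s x hsx)
    rw [← intervalIntegral.integral_const_mul]
    congr 2
    funext t
    rw [show 2 * Complex.I * k * ((x : ℂ) - t) = 2 * Complex.I * k * x + -(2 * Complex.I * k * t)
      by ring, Complex.exp_add]
    simp only [Complex.conjLIE_apply]
    ring
  have hInt : ∀ (F : ℝ → ℂ) (c : ℝ), 0 ≤ c → ∀ x, -L ≤ x → (∀ s ∈ Ioc (-L) x, ‖F s‖ ≤ c) →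
      ‖∫ s in (-L)..x, u s * F s‖ ≤ A * c := by
    intro F c hc x hx hF
    rw [intervalIntegral.integral_of_le hx, hA, ← integral_mul_const]
    refine (norm_integral_le_of_norm_le (g := fun t => ‖u t‖ * c)
      (hu.norm.mul_const _).integrableOn ?_).trans
      (setIntegral_le_integral (hu.norm.mul_const _)
        (Eventually.of_forall fun t => mul_nonneg (norm_nonneg _) hc))
    refine (ae_restrict_iff' measurableSet_Ioc).2 (Eventually.of_forall fun t ht => ?_)
    rw [norm_mul]
    exact mul_le_mul_of_nonneg_left (hF t ht) (norm_nonneg _)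
  obtain ⟨y, hy, hymax⟩ := (isCompact_Icc (a := -L) (b := L)).exists_isMaxOn
    ⟨0, by constructor <;> linarith⟩ hNc.norm.continuousOn
  have hyb : ∀ x ∈ Icc (-L) L, ‖N x‖ ≤ ‖N y‖ := fun x hx => hymax hx
  have hNy : ‖N y‖ ≤ δ + A * (‖N y‖ * δ) := by
    have e : N y = -(Complex.exp (2 * Complex.I * k * y) *
        ∫ t in (-L)..y, (starRingEnd ℂ) (u t) * Complex.exp (-(2 * Complex.I * k * t))) -
        ∫ s in (-L)..y, u s * (N s * (Complex.exp (2 * Complex.I * k * y) *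
          ∫ t in s..y, (starRingEnd ℂ) (u t) * Complex.exp (-(2 * Complex.I * k * t)))) := by
      simp only [hN]
      conv_lhs => rw [hm.snd_eq hu k y]
      rw [mul_sub, ← intervalIntegral.integral_const_mul]
      congr 1
      · ring
      · congr 1; funext s; ring
    conv_lhs => rw [e]
    refine (norm_sub_le _ _).trans (add_le_add ?_ ?_)
    · rw [norm_neg]; exact hq _ _ hy.1
    · refine hInt _ _ (by positivity) _ hy.1 fun s hs => ?_
      rw [norm_mul]
      exact mul_le_mul (hyb s ⟨hs.1.le, hs.2.trans hy.2⟩) (hq s y hs.2) (norm_nonneg _)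
        (norm_nonneg _)
  have hNy2 : ‖N y‖ ≤ 2 * δ := by
    have h1 : A * δ ≤ 1 / 2 := by linarith [hδ2, hδ0]
    nlinarith [norm_nonneg (N y)]
  intro x hx
  refine ⟨(hyb x hx).trans (hNy2.trans (by nlinarith)), ?_⟩
  have e : m k x - 1 = ∫ s in (-L)..x, u s * N s := by
    have := (hm.sol k).fst.sub_eq (-L) x
    rw [hm.fst_eq_one k _ le_rfl] at this
    rw [this]
    congr 1; funext s; simp only [hN]; ring
  rw [e]
  refine (hInt _ (2 * δ) (by positivity) x hx.1 fun s hs =>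
    (hyb s ⟨hs.1.le, hs.2.trans hx.2⟩).trans hNy2).trans ?_
  nlinarith

lemma IsFundamental.tendsto_snd (hm : IsFundamental u L m n) (hu : Integrable u) (hL : 0 < L)
    {x : ℝ} (hx : x ∈ Icc (-L) L) :
    Tendsto (fun k => Complex.exp (2 * Complex.I * k * x) * n k x) upperInfty (𝓝 0) :=
  tendsto_upperInfty_zero_iff.2 fun _ hε =>
    let ⟨K, hK⟩ := hm.exists_bound hu hL hε
    ⟨K, fun k h1 h2 => (hK k h1 h2 x hx).1⟩

lemma IsFundamental.tendsto_fst (hm : IsFundamental u L m n) (hu : Integrable u) (hL : 0 < L) :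
    Tendsto (fun k => m k L) upperInfty (𝓝 1) := by
  have : Tendsto (fun k => m k L - 1) upperInfty (𝓝 0) :=
    tendsto_upperInfty_zero_iff.2 fun _ hε =>
      let ⟨K, hK⟩ := hm.exists_bound hu hL hε
      ⟨K, fun k h1 h2 => (hK k h1 h2 L ⟨by linarith, le_rfl⟩).2⟩
  simpa using this.add_const 1

lemma IsFundamental.finite_boundStates (hm : IsFundamental u L m n) (hu : Integrable u)
    (hsupp : ∀ x, L < |x| → u x = 0) (hL : 0 < L) (h0 : m 0 L ≠ 0) : (boundStates u).Finite := by
  obtain ⟨K, hK⟩ := eventually_upperInfty_iff.1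
    ((hm.tendsto_fst hu hL).eventually_ne one_ne_zero)
  refine finite_zeros (hm.differentiable_fst L) h0 (r := K) fun z hz => ?_
  have hz' : m z L = 0 := by rw [← hm.coeffA_eq hu hsupp hL hz.1.le]; exact hz.2
  refine ⟨?_, hz'⟩
  by_contra h
  exact hK z hz.1.le (not_le.1 h).le hz'

end

/-! ### Contour integrals and Fourier integrals of rational functions -/

noncomputable section

lemma integral_exp_neg_mul_le {d M : ℝ} (hd : 0 < d) :
    ∫ y in (0 : ℝ)..M, Real.exp (-(d * y)) ≤ 1 / d := by
  have h : ∀ y ∈ uIcc (0 : ℝ) M, HasDerivAt (fun y => -(1 / d) * Real.exp (-(d * y)))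
      (Real.exp (-(d * y))) y := fun y _ => by
    have h1 : HasDerivAt (fun y => -(d * y)) (-(d * 1)) y := ((hasDerivAt_id y).const_mul d).neg
    convert! h1.exp.const_mul (-(1 / d)) using 1
    field_simp
  rw [intervalIntegral.integral_eq_sub_of_hasDerivAt h
    ((by fun_prop : Continuous fun y => Real.exp (-(d * y))).intervalIntegrable _ _)]
  have := Real.exp_pos (-(d * M))
  have h2 : 0 < 1 / d := by positivity
  simp only [mul_zero, neg_zero, Real.exp_zero]
  nlinarith

lemma norm_cexp_I_mul (w : ℂ) (d : ℝ) :
    ‖Complex.exp (Complex.I * w * d)‖ = Real.exp (-(d * w.im)) := by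
  rw [Complex.norm_exp]
  congr 1
  simp
  ring

/-- Jordan's lemma for rectangles: a holomorphic function in the upper half plane bounded by `ε`
away from a disc has truncated Fourier integrals at `d > 0` bounded by `2 ε / d`. -/
lemma norm_integral_mul_cexp_le {H : ℂ → ℂ} {ε K d N : ℝ} (hd : 0 < d) (hN : 0 < N) (hKN : K ≤ N)
    (hHd : ∀ w : ℂ, 0 ≤ w.im → DifferentiableAt ℂ H w)
    (hH : ∀ w : ℂ, 0 ≤ w.im → K ≤ ‖w‖ → ‖H w‖ ≤ ε) :
    ‖∫ k in (-N)..N, H k * Complex.exp (Complex.I * k * d)‖ ≤ 2 * ε / d := by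
  have hε : 0 ≤ ε := (norm_nonneg _).trans (hH N (by simp) (by simpa [abs_of_pos hN] using hKN))
  set f : ℂ → ℂ := fun w => H w * Complex.exp (Complex.I * w * d) with hf
  have hfd : ∀ w : ℂ, 0 ≤ w.im → DifferentiableAt ℂ f w := fun w hw =>
    (hHd w hw).mul (by fun_prop)
  have hfb : ∀ w : ℂ, 0 ≤ w.im → K ≤ ‖w‖ → ‖f w‖ ≤ ε * Real.exp (-(d * w.im)) := fun w h1 h2 => by
    rw [hf, norm_mul, norm_cexp_I_mul]
    exact mul_le_mul_of_nonneg_right (hH w h1 h2) (Real.exp_pos _).le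
  have hside : ∀ M, 0 ≤ M → ∀ c : ℝ, |c| = N →
      ‖∫ y in (0 : ℝ)..M, f (c + y * Complex.I)‖ ≤ ε * (1 / d) := by
    intro M hM c hc
    refine (intervalIntegral.norm_integral_le_of_norm_le hM (g := fun y => ε * Real.exp (-(d * y)))
      (Eventually.of_forall fun y hy => ?_)
      ((by fun_prop : Continuous fun y => ε * Real.exp (-(d * y))).intervalIntegrable _ _)).trans ?_
    · have h1 : ((c : ℂ) + y * Complex.I).im = y := by simp
      have h2 := hfb (c + y * Complex.I) (by rw [h1]; exact hy.1.le) (by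
        have := Complex.abs_re_le_norm ((c : ℂ) + y * Complex.I)
        simp [hc] at this
        linarith)
      rwa [h1] at h2
    · rw [intervalIntegral.integral_const_mul]
      exact mul_le_mul_of_nonneg_left (integral_exp_neg_mul_le hd) hε
  have hM : ∀ M, max K 0 ≤ M → ‖∫ k in (-N)..N, f k‖ ≤
      2 * ε / d + 2 * N * (ε * Real.exp (-(d * M))) := by
    intro M hM
    have hM0 : 0 ≤ M := (le_max_right _ _).trans hM
    have hrect := Complex.integral_boundary_rect_eq_zero_of_differentiableOn f ⟨-N, 0⟩ ⟨N, M⟩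
      fun w hw => (hfd w (by
        have := hw.2
        simp only [mem_preimage, uIcc_of_le hM0] at this
        exact this.1)).differentiableWithinAt
    simp only [Complex.ofReal_zero, zero_mul, add_zero, smul_eq_mul] at hrect
    have htop : ‖∫ x in (-N)..N, f (x + M * Complex.I)‖ ≤ 2 * N * (ε * Real.exp (-(d * M))) := by
      refine (intervalIntegral.norm_integral_le_of_norm_le_const
        (C := ε * Real.exp (-(d * M))) fun x _ => ?_).trans (le_of_eq ?_)
      · have h1 : ((x : ℂ) + M * Complex.I).im = M := by simp
        have h2 := hfb (x + M * Complex.I) (by rw [h1]; exact hM0) (by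
          have := Complex.abs_im_le_norm ((x : ℂ) + M * Complex.I)
          rw [h1, abs_of_nonneg hM0] at this
          exact ((le_max_left _ _).trans hM).trans this)
        rwa [h1] at h2
      · rw [abs_of_nonneg (by linarith)]; ring
    have e : ∫ k in (-N)..N, f k = (∫ x in (-N)..N, f (x + M * Complex.I)) -
        Complex.I * (∫ y in (0 : ℝ)..M, f (N + y * Complex.I)) +
        Complex.I * (∫ y in (0 : ℝ)..M, f ((-N : ℝ) + y * Complex.I)) := by
      linear_combination hrect
    rw [e]
    have n1 := hside M hM0 N (abs_of_pos hN)
    have n2 := hside M hM0 (-N) (by rw [abs_neg, abs_of_pos hN])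
    refine (norm_add_le _ _).trans ?_
    refine (add_le_add (norm_sub_le _ _) le_rfl).trans ?_
    rw [norm_mul, norm_mul, Complex.norm_I, one_mul, one_mul]
    refine (add_le_add (add_le_add htop n1) n2).trans (le_of_eq ?_)
    ring
  have hlim : Tendsto (fun M => 2 * ε / d + 2 * N * (ε * Real.exp (-(d * M)))) atTop
      (𝓝 (2 * ε / d + 2 * N * (ε * 0))) := by
    refine ((Tendsto.const_mul _ (Tendsto.const_mul _ ?_)).const_add _)
    exact Real.tendsto_exp_neg_atTop_nhds_zero.comp (tendsto_id.const_mul_atTop hd)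
  simp only [mul_zero, add_zero] at hlim
  exact ge_of_tendsto hlim ((eventually_ge_atTop _).mono hM)

lemma exists_norm_integral_mul_cexp_le {H : ℂ → ℂ}
    (hHd : ∀ w : ℂ, 0 ≤ w.im → DifferentiableAt ℂ H w) (hH : Tendsto H upperInfty (𝓝 0))
    {ε : ℝ} (hε : 0 < ε) : ∃ N₀ : ℝ, ∀ N, N₀ ≤ N → ∀ d : ℝ, 0 < d →
      ‖∫ k in (-N)..N, H k * Complex.exp (Complex.I * k * d)‖ ≤ ε / d := by
  obtain ⟨K, hK⟩ := tendsto_upperInfty_zero_iff.1 hH (ε / 2) (by positivity)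
  refine ⟨max K 1, fun N hN d hd => ?_⟩
  have := norm_integral_mul_cexp_le hd (lt_of_lt_of_le one_pos ((le_max_right _ _).trans hN))
    ((le_max_left _ _).trans hN) hHd hK
  refine this.trans (le_of_eq (by ring))

lemma tendsto_integral_mul_cexp_zero {H : ℂ → ℂ}
    (hHd : ∀ w : ℂ, 0 ≤ w.im → DifferentiableAt ℂ H w) (hH : Tendsto H upperInfty (𝓝 0))
    {d : ℝ} (hd : 0 < d) :
    Tendsto (fun N : ℝ => ∫ k in (-N)..N, H k * Complex.exp (Complex.I * k * d)) atTop (𝓝 0) := by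
  rw [Metric.tendsto_atTop]
  intro ε hε
  obtain ⟨N₀, h⟩ := exists_norm_integral_mul_cexp_le hHd hH (ε := ε * d / 2) (by positivity)
  refine ⟨N₀, fun N hN => ?_⟩
  rw [dist_zero_right]
  refine (h N hN d hd).trans_lt ?_
  rw [div_lt_iff₀ hd]
  nlinarith [mul_pos hε hd]

lemma tendsto_inv_sub_upperInfty (k₀ : ℂ) :
    Tendsto (fun w : ℂ => 1 / (w - k₀)) upperInfty (𝓝 0) := by
  have := tendsto_singularPart {k₀} (fun _ => 1) (fun _ _ => 1)
  exact this.congr fun w => by simp [singularPart]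

section Pole

variable {k₀ : ℂ}

lemma ofReal_sub_ne_zero (hk₀ : k₀.im ≠ 0) (k : ℝ) : (k : ℂ) - k₀ ≠ 0 := fun h => by
  have := congrArg Complex.im h
  simp at this
  exact hk₀ this

/-- The Fourier transform of `e^{i k₀ y}` on `y ≥ 0`, `e^{i k̄₀ y}` on `y < 0`. -/
lemma integral_two_sided_exp (hk₀ : 0 < k₀.im) (k : ℝ) :
    Integrable (fun y : ℝ => if 0 < y then Complex.exp (Complex.I * k₀ * y)
      else Complex.exp (Complex.I * (starRingEnd ℂ) k₀ * y)) ∧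
    ∫ y : ℝ, (if 0 < y then Complex.exp (Complex.I * k₀ * y)
      else Complex.exp (Complex.I * (starRingEnd ℂ) k₀ * y)) * Complex.exp (-(Complex.I * k * y)) =
      -Complex.I * (1 / (k - k₀) - 1 / (k - (starRingEnd ℂ) k₀)) := by
  have key : ∀ k : ℝ, Integrable (fun y : ℝ => (if 0 < y then Complex.exp (Complex.I * k₀ * y)
      else Complex.exp (Complex.I * (starRingEnd ℂ) k₀ * y)) * Complex.exp (-(Complex.I * k * y))) ∧
    ∫ y : ℝ, (if 0 < y then Complex.exp (Complex.I * k₀ * y)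
      else Complex.exp (Complex.I * (starRingEnd ℂ) k₀ * y)) * Complex.exp (-(Complex.I * k * y)) =
      -Complex.I * (1 / (k - k₀) - 1 / (k - (starRingEnd ℂ) k₀)) := by
    intro k
    set F : ℝ → ℂ := fun y => (if 0 < y then Complex.exp (Complex.I * k₀ * y)
      else Complex.exp (Complex.I * (starRingEnd ℂ) k₀ * y)) * Complex.exp (-(Complex.I * k * y))
    have r1 : (Complex.I * k₀ - Complex.I * k).re < 0 := by simpa using hk₀
    have r2 : 0 < (Complex.I * (starRingEnd ℂ) k₀ - Complex.I * k).re := by simpa using hk₀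
    have e1 : EqOn (fun y : ℝ => Complex.exp ((Complex.I * k₀ - Complex.I * k) * y)) F (Ioi 0) :=
      fun y hy => by
        simp only [F, if_pos (mem_Ioi.1 hy)]
        rw [← Complex.exp_add]; congr 1; ring
    have e2 : EqOn (fun y : ℝ => Complex.exp ((Complex.I * (starRingEnd ℂ) k₀ - Complex.I * k) * y))
        F (Iic 0) := fun y hy => by
        simp only [F, if_neg (not_lt.2 (mem_Iic.1 hy))]
        rw [← Complex.exp_add]; congr 1; ring
    have i1 : IntegrableOn F (Ioi 0) :=
      (integrableOn_exp_mul_complex_Ioi r1 0).congr_fun e1 measurableSet_Ioi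
    have i2 : IntegrableOn F (Iic 0) :=
      (integrableOn_exp_mul_complex_Iic r2 0).congr_fun e2 measurableSet_Iic
    have hint : Integrable F := by
      rw [← integrableOn_univ, ← Iic_union_Ioi (a := (0 : ℝ))]
      exact i2.union i1
    refine ⟨hint, ?_⟩
    rw [← intervalIntegral.integral_Iic_add_Ioi i2 i1, ← setIntegral_congr_fun measurableSet_Ioi e1,
      ← setIntegral_congr_fun measurableSet_Iic e2, integral_exp_mul_complex_Ioi r1,
      integral_exp_mul_complex_Iic r2]
    have n1 : (k : ℂ) - k₀ ≠ 0 := ofReal_sub_ne_zero hk₀.ne' k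
    have n2 : (k : ℂ) - (starRingEnd ℂ) k₀ ≠ 0 :=
      ofReal_sub_ne_zero (by simpa using hk₀.ne') k
    have n3 : Complex.I * k₀ - Complex.I * k ≠ 0 := by
      rw [← mul_sub]; exact mul_ne_zero Complex.I_ne_zero (by rw [← neg_sub]; exact neg_ne_zero.2 n1)
    have n4 : Complex.I * (starRingEnd ℂ) k₀ - Complex.I * k ≠ 0 := by
      rw [← mul_sub]; exact mul_ne_zero Complex.I_ne_zero (by rw [← neg_sub]; exact neg_ne_zero.2 n2)
    have a1 : -Complex.exp ((Complex.I * k₀ - Complex.I * k) * (0 : ℝ)) / (Complex.I * k₀ - Complex.I * k) =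
        -Complex.I * (1 / (k - k₀)) := by
      simp only [Complex.ofReal_zero, mul_zero, Complex.exp_zero]
      rw [mul_one_div, div_eq_div_iff n3 n1]
      linear_combination (k₀ - k) * Complex.I_sq
    have a2 : Complex.exp ((Complex.I * (starRingEnd ℂ) k₀ - Complex.I * k) * (0 : ℝ)) /
        (Complex.I * (starRingEnd ℂ) k₀ - Complex.I * k) =
        Complex.I * (1 / (k - (starRingEnd ℂ) k₀)) := by
      simp only [Complex.ofReal_zero, mul_zero, Complex.exp_zero]
      rw [mul_one_div, div_eq_div_iff n4 n2]
      linear_combination (-(starRingEnd ℂ) k₀ + k) * Complex.I_sq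
    rw [a1, a2]
    ring
  refine ⟨?_, (key k).2⟩
  simpa using (key 0).1

lemma integrable_inv_sub_sub_inv_sub (hk₀ : 0 < k₀.im) :
    Integrable fun k : ℝ => 1 / ((k : ℂ) - k₀) - 1 / (k - (starRingEnd ℂ) k₀) := by
  have h1 : Integrable fun k : ℝ => (1 + ((k - k₀.re) / k₀.im) ^ 2)⁻¹ :=
    (integrable_inv_one_add_sq.comp_div hk₀.ne').comp_sub_right k₀.re
  have h2 := (h1.ofReal (𝕜 := ℂ)).const_mul (2 * Complex.I / k₀.im)
  refine h2.congr (Eventually.of_forall fun k => ?_)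
  have n1 : (k : ℂ) - k₀ ≠ 0 := ofReal_sub_ne_zero hk₀.ne' k
  have n2 : (k : ℂ) - (starRingEnd ℂ) k₀ ≠ 0 := ofReal_sub_ne_zero (by simpa using hk₀.ne') k
  have hb : (k₀.im : ℂ) ≠ 0 := by exact_mod_cast hk₀.ne'
  have hsub : (k₀ : ℂ) - (starRingEnd ℂ) k₀ = 2 * Complex.I * k₀.im := by
    rw [Complex.sub_conj]; push_cast; ring
  have hprod : ((k : ℂ) - k₀) * (k - (starRingEnd ℂ) k₀) = (k - k₀.re) ^ 2 + k₀.im ^ 2 := by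
    apply Complex.ext <;> simp [pow_two] <;> ring
  have hq : ((k : ℂ) - k₀.re) ^ 2 + k₀.im ^ 2 ≠ 0 := hprod ▸ mul_ne_zero n1 n2
  have hq2 : (1 : ℂ) + ((k - k₀.re) / k₀.im) ^ 2 ≠ 0 := by
    have : (1 : ℂ) + ((k - k₀.re) / k₀.im) ^ 2 = ((k - k₀.re) ^ 2 + k₀.im ^ 2) / k₀.im ^ 2 := by
      field_simp; ring
    rw [this]; exact div_ne_zero hq (pow_ne_zero _ hb)
  beta_reduce
  rw [div_sub_div _ _ n1 n2, hprod]
  simp only [Complex.coe_algebraMap]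
  push_cast
  rw [← div_eq_mul_inv, div_div, div_eq_div_iff (mul_ne_zero hb hq2) hq]
  field_simp
  linear_combination -((k - (k₀.re : ℂ)) ^ 2 + k₀.im ^ 2) * hsub

/-- Principal value Fourier integral of a simple pole in the upper half plane. -/
lemma tendsto_integral_simplePole (hk₀ : 0 < k₀.im) {z : ℝ} (hz : 0 < z) :
    Tendsto (fun N : ℝ => ∫ k in (-N)..N, 1 / ((k : ℂ) - k₀) * Complex.exp (Complex.I * k * z))
      atTop (𝓝 (2 * Real.pi * Complex.I * Complex.exp (Complex.I * k₀ * z))) := by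
  set f : ℝ → ℂ := fun y : ℝ => if 0 < y then Complex.exp (Complex.I * k₀ * y)
      else Complex.exp (Complex.I * (starRingEnd ℂ) k₀ * y) with hf
  set D : ℝ → ℂ := fun k : ℝ => 1 / ((k : ℂ) - k₀) - 1 / (k - (starRingEnd ℂ) k₀) with hD
  have hfi : Integrable f := (integral_two_sided_exp hk₀ 0).1
  have hDi : Integrable D := integrable_inv_sub_sub_inv_sub hk₀
  have hF : FourierTransform.fourier f = fun ξ : ℝ => -Complex.I * D (2 * Real.pi * ξ) := by
    funext ξ
    rw [Real.fourier_real_eq_integral_exp_smul, hD]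
    simp only
    rw [← (integral_two_sided_exp hk₀ (2 * Real.pi * ξ)).2]
    refine integral_congr_ae (Eventually.of_forall fun y => ?_)
    simp only [smul_eq_mul, hf]
    rw [mul_comm]
    congr 2
    push_cast; ring
  have hFi : Integrable (FourierTransform.fourier f) := by
    rw [hF]
    exact (hDi.comp_mul_left' (by positivity)).const_mul _
  have hcont : ContinuousAt f z := by
    have h1 : Continuous fun y : ℝ => Complex.exp (Complex.I * k₀ * y) := by fun_prop
    refine h1.continuousAt.congr ?_
    filter_upwards [lt_mem_nhds hz] with y hy
    simp [hf, hy]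
  have hinv := hfi.fourierInv_fourier_eq hFi hcont
  rw [Real.fourierInv_eq', hF] at hinv
  have hfull : ∫ k : ℝ, D k * Complex.exp (Complex.I * k * z) =
      2 * Real.pi * Complex.I * Complex.exp (Complex.I * k₀ * z) := by
    have h1 := Measure.integral_comp_mul_left
      (fun k : ℝ => -Complex.I * (D k * Complex.exp (Complex.I * k * z))) (2 * Real.pi)
    have h2 : f z = Complex.exp (Complex.I * k₀ * z) := by simp [hf, hz]
    rw [h2] at hinv
    have h3 : ∫ ξ : ℝ, -Complex.I * (D (2 * Real.pi * ξ) *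
        Complex.exp (Complex.I * ((2 * Real.pi * ξ : ℝ) : ℂ) * z)) =
        Complex.exp (Complex.I * k₀ * z) := by
      rw [← hinv]
      refine integral_congr_ae (Eventually.of_forall fun ξ => ?_)
      simp only [smul_eq_mul, RCLike.inner_apply, conj_trivial]
      rw [show ((2 * Real.pi * (z * ξ) : ℝ) : ℂ) * Complex.I =
        Complex.I * ((2 * Real.pi * ξ : ℝ) : ℂ) * z by push_cast; ring]
      ring
    rw [h3, integral_const_mul, abs_of_pos (by positivity)] at h1
    rw [h1, Complex.real_smul]
    generalize ∫ k : ℝ, D k * Complex.exp (Complex.I * k * z) = J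
    have : (Real.pi : ℂ) ≠ 0 := by exact_mod_cast Real.pi_ne_zero
    have e : ((2 * Real.pi : ℝ)⁻¹ : ℝ) * (2 * Real.pi : ℂ) = 1 := by
      push_cast; field_simp
    linear_combination (J * ((2 * Real.pi : ℝ)⁻¹ : ℝ) * (2 * Real.pi : ℂ)) * Complex.I_sq - J * e
  have hlim1 : Tendsto (fun N : ℝ => ∫ k in (-N)..N, D k * Complex.exp (Complex.I * k * z))
      atTop (𝓝 (2 * Real.pi * Complex.I * Complex.exp (Complex.I * k₀ * z))) := by
    rw [← hfull]
    refine intervalIntegral_tendsto_integral ?_ tendsto_neg_atTop_atBot tendsto_id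
    refine hDi.mul_bdd (c := 1) (by fun_prop) (Eventually.of_forall fun k => ?_)
    exact norm_cexp_I_mul_le (k := (k : ℂ)) (by simp) hz.le
  have hlim2 := tendsto_integral_mul_cexp_zero (H := fun w => 1 / (w - (starRingEnd ℂ) k₀))
    (fun w hw => by
      have : w - (starRingEnd ℂ) k₀ ≠ 0 := fun h => by
        have := congrArg Complex.im h
        simp at this
        linarith
      exact (differentiableAt_const _).div (by fun_prop) this)
    (tendsto_inv_sub_upperInfty _) hz
  -- the pole at `conj k₀` in the lower half plane contributes nothing
  have hsum := hlim1.add hlim2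
  rw [add_zero] at hsum
  refine hsum.congr fun N => ?_
  have c1 : Continuous fun k : ℝ => 1 / ((k : ℂ) - k₀) :=
    continuous_const.div (by fun_prop) (ofReal_sub_ne_zero hk₀.ne')
  have c2 : Continuous fun k : ℝ => 1 / ((k : ℂ) - (starRingEnd ℂ) k₀) :=
    continuous_const.div (by fun_prop) (ofReal_sub_ne_zero (by simpa using hk₀.ne'))
  have c3 : Continuous fun k : ℝ => Complex.exp (Complex.I * k * z) := by fun_prop
  have c4 : IntervalIntegrable (fun k : ℝ => D k * Complex.exp (Complex.I * k * z)) volume (-N) N :=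
    ((c1.sub c2).mul c3).intervalIntegrable _ _
  have c5 : IntervalIntegrable (fun k : ℝ => 1 / ((k : ℂ) - (starRingEnd ℂ) k₀) *
    Complex.exp (Complex.I * k * z)) volume (-N) N := (c2.mul c3).intervalIntegrable _ _
  rw [← intervalIntegral.integral_add c4 c5]
  congr 1; funext k
  simp only [hD]
  ring

/-- Principal value Fourier integral of a pole of arbitrary order in the upper half plane. -/
lemma tendsto_integral_pole (hk₀ : 0 < k₀.im) {z : ℝ} (hz : 0 < z) (s : ℕ) :
    Tendsto (fun N : ℝ => ∫ k in (-N)..N,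
        1 / ((k : ℂ) - k₀) ^ (s + 1) * Complex.exp (Complex.I * k * z))
      atTop (𝓝 (2 * Real.pi * Complex.I * Complex.I ^ s *
        ((z : ℂ) ^ s / (Nat.factorial s : ℂ) * Complex.exp (Complex.I * k₀ * z)))) := by
  induction s with
  | zero => simpa using tendsto_integral_simplePole hk₀ hz
  | succ s ih =>
    set F : ℝ → ℂ := fun k => 1 / ((k : ℂ) - k₀) ^ (s + 1) * Complex.exp (Complex.I * k * z) with hF
    have hne := ofReal_sub_ne_zero hk₀.ne'
    have c1 : ∀ j : ℕ, Continuous fun k : ℝ =>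
        1 / ((k : ℂ) - k₀) ^ j * Complex.exp (Complex.I * k * z) := fun j =>
      (continuous_const.div (by fun_prop) fun k => pow_ne_zero _ (hne k)).mul (by fun_prop)
    have hder : ∀ k : ℝ, HasDerivAt F (Complex.I * z * F k -
        (s + 1) * (1 / ((k : ℂ) - k₀) ^ (s + 2) * Complex.exp (Complex.I * k * z))) k := fun k => by
      have h1 : HasDerivAt (fun w : ℂ => 1 / (w - k₀) ^ (s + 1) * Complex.exp (Complex.I * w * z))
          (Complex.I * z * F k -
        (s + 1) * (1 / ((k : ℂ) - k₀) ^ (s + 2) * Complex.exp (Complex.I * k * z))) (k : ℂ) := by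
        have g1 : HasDerivAt (fun w : ℂ => w - k₀) 1 (k : ℂ) := (hasDerivAt_id _).sub_const _
        have g2 := (g1.pow (s + 1)).inv (pow_ne_zero _ (hne k))
        have g3 : HasDerivAt (fun w : ℂ => Complex.I * w * z) (Complex.I * 1 * z) (k : ℂ) :=
          ((hasDerivAt_id _).const_mul _).mul_const _
        have g4 := g2.mul g3.cexp
        simp only [one_div]
        convert! g4 using 1
        simp only [hF, Pi.inv_apply, Pi.pow_apply]
        have := hne k
        push_cast
        field_simp
        ring
      exact h1.comp_ofReal
    have hF0 : ∀ g : ℝ → ℝ, Tendsto (fun N => |g N|) atTop atTop →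
        Tendsto (fun N => F (g N)) atTop (𝓝 0) := by
      intro g hg
      have h1 : Tendsto (fun w : ℂ => 1 / (w - k₀) ^ (s + 1)) upperInfty (𝓝 0) := by
        have := (tendsto_inv_sub_upperInfty k₀).pow (s + 1)
        simpa using this
      have h2 : Tendsto (fun N => ((g N : ℝ) : ℂ)) atTop upperInfty := by
        rw [upperInfty, tendsto_inf, tendsto_principal]
        refine ⟨?_, Eventually.of_forall fun N => by simp⟩
        rw [← Metric.cobounded_eq_cocompact, ← tendsto_norm_atTop_iff_cobounded]
        simpa using hg
      refine squeeze_zero_norm (fun N => ?_) (tendsto_zero_iff_norm_tendsto_zero.1 (h1.comp h2))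
      simp only [hF, norm_mul, Function.comp_apply]
      exact mul_le_of_le_one_right (norm_nonneg _)
        (norm_cexp_I_mul_le (k := ((g N : ℝ) : ℂ)) (by simp) hz.le)
    have hbd : Tendsto (fun N : ℝ => F N - F (-N)) atTop (𝓝 0) := by
      have b1 := hF0 id tendsto_abs_atTop_atTop
      have b2 := hF0 (fun N => -N) (by simpa using tendsto_abs_atTop_atTop)
      simpa using b1.sub b2
    have hs : ((s : ℂ) + 1) ≠ 0 := by exact_mod_cast Nat.succ_ne_zero s
    have hmain := ((ih.const_mul (Complex.I * z)).sub hbd).const_mul (1 / ((s : ℂ) + 1))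
    have hlimeq : 1 / ((s : ℂ) + 1) * (Complex.I * z * (2 * Real.pi * Complex.I * Complex.I ^ s *
        ((z : ℂ) ^ s / (Nat.factorial s : ℂ) * Complex.exp (Complex.I * k₀ * z))) - 0) =
        2 * Real.pi * Complex.I * Complex.I ^ (s + 1) *
        ((z : ℂ) ^ (s + 1) / (Nat.factorial (s + 1) : ℂ) * Complex.exp (Complex.I * k₀ * z)) := by
      rw [Nat.factorial_succ]
      have := Nat.factorial_ne_zero s
      push_cast
      field_simp
      ring
    rw [hlimeq] at hmain
    refine hmain.congr fun N => ?_
    have h3 := intervalIntegral.integral_eq_sub_of_hasDerivAt (a := -N) (b := N)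
      (fun k _ => hder k) (((((c1 (s + 1)).const_mul (Complex.I * z)).sub
        ((c1 (s + 2)).const_mul ((s : ℂ) + 1)))).intervalIntegrable _ _)
    rw [intervalIntegral.integral_sub (((c1 (s + 1)).const_mul (Complex.I * z)).intervalIntegrable _ _)
      (((c1 (s + 2)).const_mul ((s : ℂ) + 1)).intervalIntegrable _ _),
      intervalIntegral.integral_const_mul, intervalIntegral.integral_const_mul] at h3
    rw [← h3]
    change 1 / ((s : ℂ) + 1) * (Complex.I * z * (∫ k in (-N)..N, F k) -
      (Complex.I * z * (∫ k in (-N)..N, F k) - ((s : ℂ) + 1) * ∫ k in (-N)..N,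
        1 / ((k : ℂ) - k₀) ^ (s + 2) * Complex.exp (Complex.I * k * z))) = ∫ k in (-N)..N,
        1 / ((k : ℂ) - k₀) ^ (s + 2) * Complex.exp (Complex.I * k * z)
    rw [sub_sub_cancel, ← mul_assoc, one_div_mul_cancel hs, one_mul]

lemma integrableOn_pow_mul_cexp {c : ℂ} (hc : c.re < 0) (s : ℕ) :
    IntegrableOn (fun y : ℝ => (y : ℂ) ^ s * Complex.exp (c * y)) (Ioi 0) := by
  have h1 := integrableOn_rpow_mul_exp_neg_mul_rpow (s := s) (p := 1) (b := -c.re)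
    (by linarith [(Nat.cast_nonneg s : (0 : ℝ) ≤ s)]) one_pos (by linarith)
  refine Integrable.mono' h1 (Continuous.aestronglyMeasurable (by fun_prop)) ?_
  refine (ae_restrict_iff' measurableSet_Ioi).2 (Eventually.of_forall fun y hy => le_of_eq ?_)
  rw [norm_mul, norm_pow, Complex.norm_real, Real.norm_of_nonneg (le_of_lt hy), Complex.norm_exp,
    Real.rpow_natCast, Real.rpow_one]
  simp

lemma integral_pow_mul_cexp {c : ℂ} (hc : c.re < 0) (s : ℕ) :
    ∫ y in Ioi (0 : ℝ), (y : ℂ) ^ s * Complex.exp (c * y) =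
      (Nat.factorial s : ℂ) * (-1 / c) ^ (s + 1) := by
  have hc0 : c ≠ 0 := fun h => by simp [h] at hc
  induction s with
  | zero =>
    simp only [pow_zero, one_mul]
    rw [integral_exp_mul_complex_Ioi hc]; simp [neg_div]
  | succ s ih =>
    have hder : ∀ y ∈ Ici (0 : ℝ), HasDerivAt (fun y : ℝ => (y : ℂ) ^ (s + 1) * Complex.exp (c * y))
        ((s + 1) * ((y : ℂ) ^ s * Complex.exp (c * y)) +
          c * ((y : ℂ) ^ (s + 1) * Complex.exp (c * y))) y := fun y _ => by
      have h1 := (Complex.ofRealCLM.hasDerivAt (x := y)).pow (s + 1)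
      convert! h1.mul (hasDerivAt_cexp_mul c y) using 1
      simp
      ring
    have hlim : Tendsto (fun y : ℝ => (y : ℂ) ^ (s + 1) * Complex.exp (c * y)) atTop (𝓝 0) := by
      rw [tendsto_zero_iff_norm_tendsto_zero]
      have := tendsto_rpow_mul_exp_neg_mul_atTop_nhds_zero (s + 1 : ℕ) (-c.re) (by linarith)
      refine this.congr' ?_
      filter_upwards [eventually_ge_atTop 0] with y hy
      rw [norm_mul, norm_pow, Complex.norm_real, Real.norm_of_nonneg hy, Complex.norm_exp,
        Real.rpow_natCast]
      simp
    have i1 := integrableOn_pow_mul_cexp hc s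
    have i2 := integrableOn_pow_mul_cexp hc (s + 1)
    have h := integral_Ioi_of_hasDerivAt_of_tendsto' hder
      ((i1.const_mul ((s : ℂ) + 1)).add (i2.const_mul c)) hlim
    rw [integral_add (i1.const_mul _) (i2.const_mul _), integral_const_mul, integral_const_mul,
      ih] at h
    simp only [Complex.ofReal_zero, ne_eq, Nat.add_eq_zero_iff, one_ne_zero, and_false,
      not_false_eq_true, zero_pow, zero_mul, sub_zero] at h
    have h2 : ∫ y in Ioi (0 : ℝ), (y : ℂ) ^ (s + 1) * Complex.exp (c * y) =
        -(((s : ℂ) + 1) * ((Nat.factorial s : ℂ) * (-1 / c) ^ (s + 1))) / c := by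
      rw [eq_div_iff hc0]; linear_combination h
    rw [h2, Nat.factorial_succ]
    push_cast
    ring

end Pole

section ExponentialSum

variable {B : Finset ℂ} {M : ℂ → ℕ} {τ : ℂ → ℕ → ℂ}

lemma continuous_singularPart_ofReal (hB : ∀ k ∈ B, 0 < k.im) :
    Continuous fun k : ℝ => singularPart B M τ k := by
  unfold singularPart
  refine continuous_finsetSum _ fun k hk => continuous_finsetSum _ fun s _ => ?_
  exact continuous_const.div (by fun_prop) fun x => pow_ne_zero _ (ofReal_sub_ne_zero (hB k hk).ne' x)

lemma tendsto_integral_singularPart (hB : ∀ k ∈ B, 0 < k.im) {z : ℝ} (hz : 0 < z) :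
    Tendsto (fun N : ℝ => ∫ k in (-N)..N, singularPart B M τ k * Complex.exp (Complex.I * k * z))
      atTop (𝓝 (-(2 * Real.pi) * exponentialSum B M τ z)) := by
  have h : Tendsto (fun N : ℝ => ∑ k₀ ∈ B, ∑ s ∈ Finset.range (M k₀), τ k₀ s *
      ∫ k in (-N)..N, 1 / ((k : ℂ) - k₀) ^ (s + 1) * Complex.exp (Complex.I * k * z)) atTop
      (𝓝 (∑ k₀ ∈ B, ∑ s ∈ Finset.range (M k₀), τ k₀ s * (2 * Real.pi * Complex.I * Complex.I ^ s *
        ((z : ℂ) ^ s / (Nat.factorial s : ℂ) * Complex.exp (Complex.I * k₀ * z))))) :=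
    tendsto_finsetSum _ fun k₀ hk₀ => tendsto_finsetSum _ fun s _ =>
      (tendsto_integral_pole (hB k₀ hk₀) hz s).const_mul _
  have e : ∑ k₀ ∈ B, ∑ s ∈ Finset.range (M k₀), τ k₀ s * (2 * Real.pi * Complex.I * Complex.I ^ s *
        ((z : ℂ) ^ s / (Nat.factorial s : ℂ) * Complex.exp (Complex.I * k₀ * z))) =
      -(2 * Real.pi) * exponentialSum B M τ z := by
    unfold exponentialSum
    rw [Finset.mul_sum]
    refine Finset.sum_congr rfl fun k₀ _ => ?_
    rw [Finset.mul_sum]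
    refine Finset.sum_congr rfl fun s _ => ?_
    ring
  rw [e] at h
  refine h.congr fun N => ?_
  have hc : ∀ k₀ ∈ B, ∀ s : ℕ, Continuous fun k : ℝ =>
      1 / ((k : ℂ) - k₀) ^ (s + 1) * Complex.exp (Complex.I * k * z) := fun k₀ hk₀ s =>
    (continuous_const.div (by fun_prop) fun k =>
      pow_ne_zero _ (ofReal_sub_ne_zero (hB k₀ hk₀).ne' k)).mul (by fun_prop)
  simp_rw [← intervalIntegral.integral_const_mul]
  have e1 : ∀ k₀ ∈ B, ∑ s ∈ Finset.range (M k₀), (∫ k in (-N)..N,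
      τ k₀ s * (1 / ((k : ℂ) - k₀) ^ (s + 1) * Complex.exp (Complex.I * k * z))) =
      ∫ k in (-N)..N, ∑ s ∈ Finset.range (M k₀),
      τ k₀ s * (1 / ((k : ℂ) - k₀) ^ (s + 1) * Complex.exp (Complex.I * k * z)) := fun k₀ hk₀ =>
    (intervalIntegral.integral_finsetSum fun s _ =>
      ((hc k₀ hk₀ s).const_mul _).intervalIntegrable _ _).symm
  rw [Finset.sum_congr rfl e1, ← intervalIntegral.integral_finsetSum fun k₀ hk₀ =>
    (continuous_finsetSum _ fun s _ => (hc k₀ hk₀ s).const_mul _).intervalIntegrable _ _]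
  congr 1; funext k
  unfold singularPart
  rw [Finset.sum_mul]
  refine Finset.sum_congr rfl fun k₀ _ => ?_
  rw [Finset.sum_mul]
  refine Finset.sum_congr rfl fun s _ => ?_
  ring

/-- On the real line the singular part is, up to sign, the Fourier transform of the exponential sum
restricted to the positive half line. -/
lemma integral_exponentialSum (hB : ∀ k ∈ B, 0 < k.im) (k : ℝ) :
    IntegrableOn (exponentialSum B M τ) (Ioi 0) ∧
    ∫ y in Ioi (0 : ℝ), exponentialSum B M τ y * Complex.exp (-(Complex.I * k * y)) =
      -singularPart B M τ k := by
  have key : ∀ k₀ ∈ B, ∀ s : ℕ, ∀ k : ℝ, IntegrableOn (fun y : ℝ => -Complex.I * Complex.I ^ s * τ k₀ s *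
      ((y : ℂ) ^ s / (Nat.factorial s : ℂ) * Complex.exp (Complex.I * k₀ * y)) *
        Complex.exp (-(Complex.I * k * y))) (Ioi 0) ∧
      ∫ y in Ioi (0 : ℝ), -Complex.I * Complex.I ^ s * τ k₀ s *
      ((y : ℂ) ^ s / (Nat.factorial s : ℂ) * Complex.exp (Complex.I * k₀ * y)) *
        Complex.exp (-(Complex.I * k * y)) = -(τ k₀ s / ((k : ℂ) - k₀) ^ (s + 1)) := by
    intro k₀ hk₀ s k
    have r1 : (Complex.I * k₀ - Complex.I * k).re < 0 := by simpa using hB k₀ hk₀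
    have e : (fun y : ℝ => -Complex.I * Complex.I ^ s * τ k₀ s *
      ((y : ℂ) ^ s / (Nat.factorial s : ℂ) * Complex.exp (Complex.I * k₀ * y)) *
        Complex.exp (-(Complex.I * k * y))) = fun y : ℝ => (-Complex.I * Complex.I ^ s * τ k₀ s /
        (Nat.factorial s : ℂ)) *
        ((y : ℂ) ^ s * Complex.exp ((Complex.I * k₀ - Complex.I * k) * y)) := by
      funext y
      rw [sub_mul, sub_eq_add_neg, Complex.exp_add]
      ring
    rw [e]
    refine ⟨(integrableOn_pow_mul_cexp r1 s).const_mul _, ?_⟩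
    rw [integral_const_mul, integral_pow_mul_cexp r1]
    have n1 : (k : ℂ) - k₀ ≠ 0 := ofReal_sub_ne_zero (hB k₀ hk₀).ne' k
    have h2 : -1 / (Complex.I * k₀ - Complex.I * k) = 1 / (Complex.I * (k - k₀)) := by
      rw [show Complex.I * k₀ - Complex.I * k = -(Complex.I * (k - k₀)) by ring, neg_div_neg_eq]
    rw [h2, one_div, inv_pow, mul_pow]
    have := Nat.factorial_ne_zero s
    have hI := Complex.I_ne_zero
    field_simp
    ring
  have hint : ∀ k₀ ∈ B, ∀ s : ℕ, IntegrableOn (fun y : ℝ => -Complex.I * Complex.I ^ s * τ k₀ s *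
      ((y : ℂ) ^ s / (Nat.factorial s : ℂ) * Complex.exp (Complex.I * k₀ * y))) (Ioi 0) :=
    fun k₀ hk₀ s => by simpa using (key k₀ hk₀ s 0).1
  refine ⟨?_, ?_⟩
  · exact integrable_finsetSum _ fun k₀ hk₀ => integrable_finsetSum _ fun s _ => hint k₀ hk₀ s
  · simp_rw [exponentialSum, Finset.sum_mul]
    rw [integral_finsetSum _ fun k₀ hk₀ => integrable_finsetSum _ fun s _ => (key k₀ hk₀ s k).1]
    unfold singularPart
    rw [← Finset.sum_neg_distrib]
    refine Finset.sum_congr rfl fun k₀ hk₀ => ?_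
    rw [integral_finsetSum _ fun s _ => (key k₀ hk₀ s k).1, ← Finset.sum_neg_distrib]
    exact Finset.sum_congr rfl fun s _ => (key k₀ hk₀ s k).2

end ExponentialSum

end

/-! ### Localized Fourier inversion and Plancherel's theorem -/

noncomputable section

lemma norm_cexp_I_mul_ofReal (k y : ℝ) : ‖Complex.exp (Complex.I * k * y)‖ = 1 := by
  rw [norm_cexp_I_mul]; simp

lemma norm_cexp_neg_I_mul_ofReal (k y : ℝ) : ‖Complex.exp (-(Complex.I * k * y))‖ = 1 := by
  rw [show -(Complex.I * k * y) = Complex.I * k * ((-y : ℝ) : ℂ) by push_cast; ring,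
    norm_cexp_I_mul_ofReal]

lemma fourier_eq_integral_cexp (f : ℝ → ℂ) (ξ : ℝ) :
    𝓕 f ξ = ∫ y : ℝ, f y * Complex.exp (-(Complex.I * (2 * Real.pi * ξ : ℝ) * y)) := by
  rw [Real.fourier_real_eq_integral_exp_smul]
  refine integral_congr_ae (Eventually.of_forall fun y => ?_)
  simp only [smul_eq_mul]
  rw [mul_comm]
  congr 2
  push_cast; ring

lemma fourierInv_eq_integral_cexp (f : ℝ → ℂ) (ξ : ℝ) :
    𝓕⁻ f ξ = ∫ y : ℝ, f y * Complex.exp (Complex.I * (2 * Real.pi * ξ : ℝ) * y) := by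
  rw [Real.fourierInv_eq_fourier_neg, fourier_eq_integral_cexp]
  refine integral_congr_ae (Eventually.of_forall fun y => ?_)
  simp only
  congr 2
  push_cast; ring

/-- Parseval's formula for an integrable function and a test function. -/
lemma integral_testFunction_mul {f χ : ℝ → ℂ} (hf : Integrable f) (hχ : ContDiff ℝ ∞ χ)
    (hχc : HasCompactSupport χ) :
    Integrable (fun k : ℝ => ∫ z : ℝ, χ z * Complex.exp (Complex.I * k * z)) ∧
    ∫ z, χ z * f z = (1 / (2 * Real.pi)) * ∫ k : ℝ, (∫ z : ℝ, χ z * Complex.exp (Complex.I * k * z)) *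
      ∫ y : ℝ, f y * Complex.exp (-(Complex.I * k * y)) := by
  set X : ℝ → ℂ := fun k => ∫ z : ℝ, χ z * Complex.exp (Complex.I * k * z) with hX
  set F : ℝ → ℂ := fun k => ∫ y : ℝ, f y * Complex.exp (-(Complex.I * k * y)) with hF
  set S : SchwartzMap ℝ ℂ := hχc.toSchwartzMap hχ with hS
  have hSχ : (S : ℝ → ℂ) = χ := rfl
  have hSX : ((𝓕⁻ S : SchwartzMap ℝ ℂ) : ℝ → ℂ) = fun ξ => X (2 * Real.pi * ξ) := by
    rw [SchwartzMap.fourierInv_coe, hSχ]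
    funext ξ
    rw [fourierInv_eq_integral_cexp]
  have hSi : Integrable ((𝓕⁻ S : SchwartzMap ℝ ℂ) : ℝ → ℂ) := (𝓕⁻ S : SchwartzMap ℝ ℂ).integrable
  have hpi : (2 * Real.pi : ℝ) ≠ 0 := by positivity
  refine ⟨?_, ?_⟩
  · rw [hSX] at hSi
    have := hSi.comp_mul_left' (R := (2 * Real.pi)⁻¹) (inv_ne_zero hpi)
    refine this.congr (Eventually.of_forall fun k => ?_)
    simp only
    rw [mul_inv_cancel_left₀ hpi]
  · have h1 : 𝓕 ((𝓕⁻ S : SchwartzMap ℝ ℂ) : ℝ → ℂ) = χ := by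
      rw [← SchwartzMap.fourier_coe, FourierTransform.fourier_fourierInv_eq, hSχ]
    have h2 := VectorFourier.integral_fourierIntegral_smul_eq_flip (L := innerₗ ℝ)
      (μ := volume) (ν := volume) Real.continuous_fourierChar continuous_inner hSi hf
    have h3 : ∫ z, χ z * f z = ∫ ξ, X (2 * Real.pi * ξ) * F (2 * Real.pi * ξ) := by
      rw [← h1]
      refine Eq.trans h2 ?_
      rw [hSX]
      refine integral_congr_ae (Eventually.of_forall fun ξ => ?_)
      simp only [smul_eq_mul, flip_innerₗ]
      congr 1
      exact fourier_eq_integral_cexp f ξ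
    rw [h3, Measure.integral_comp_mul_left (fun k => X k * F k) (2 * Real.pi),
      abs_of_pos (by positivity), Complex.real_smul]
    push_cast
    simp only [one_div]
    rfl

/-- Localized Fourier inversion: on `(c, ∞)` the part `H` of the Fourier transform whose product
with `e^{ikc}` is holomorphic and vanishes at infinity in the upper half plane is invisible. -/
theorem ae_eq_of_fourier_eq {f h : ℝ → ℂ} {H : ℂ → ℂ} {c : ℝ} (hf : Integrable f) (hh : Integrable h)
    (hHd : ∀ w : ℂ, 0 ≤ w.im → DifferentiableAt ℂ H w)
    (hH : Tendsto (fun w => H w * Complex.exp (Complex.I * w * c)) upperInfty (𝓝 0))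
    (hfh : ∀ k : ℝ, ∫ y : ℝ, f y * Complex.exp (-(Complex.I * k * y)) = H k + h k) :
    ∀ᵐ z : ℝ, c < z → f z = (1 / (2 * Real.pi)) * ∫ k : ℝ, h k * Complex.exp (Complex.I * k * z) := by
  set g : ℝ → ℂ := fun z => (1 / (2 * Real.pi)) * ∫ k : ℝ, h k * Complex.exp (Complex.I * k * z)
    with hg
  have hgc : Continuous g := by
    refine continuous_const.mul (continuous_of_dominated (bound := fun k => ‖h k‖) (fun z => ?_)
      (fun z => Eventually.of_forall fun k => ?_) hh.norm (Eventually.of_forall fun k => by fun_prop))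
    · exact hh.aestronglyMeasurable.mul (by fun_prop : Continuous fun k : ℝ =>
        Complex.exp (Complex.I * k * z)).aestronglyMeasurable
    · rw [norm_mul, norm_cexp_I_mul_ofReal, mul_one]
  have key := IsOpen.ae_eq_zero_of_integral_contDiff_smul_eq_zero (μ := volume) (f := fun z => f z - g z)
    (isOpen_Ioi (a := c)) ((hf.locallyIntegrable.sub hgc.locallyIntegrable).locallyIntegrableOn _) ?_
  · filter_upwards [key] with z hz hcz
    exact sub_eq_zero.1 (hz hcz)
  intro φ hφ hφc hφs
  set χ : ℝ → ℂ := fun z => (φ z : ℂ) with hχ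
  have hχd : ContDiff ℝ ∞ χ := Complex.ofRealCLM.contDiff.comp hφ
  have hχc : HasCompactSupport χ := hφc.comp_left (g := fun x : ℝ => (x : ℂ)) rfl
  have hχi : Integrable χ := hχd.continuous.integrable_of_hasCompactSupport hχc
  obtain ⟨hXi, hpars⟩ := integral_testFunction_mul hf hχd hχc
  set X : ℝ → ℂ := fun k => ∫ z : ℝ, χ z * Complex.exp (Complex.I * k * z) with hX
  have hXc : Continuous X := by
    refine continuous_of_dominated (bound := fun z => ‖χ z‖) (fun k => ?_)
      (fun k => Eventually.of_forall fun z => ?_) hχi.norm (Eventually.of_forall fun z => by fun_prop)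
    · exact (hχd.continuous.mul (by fun_prop)).aestronglyMeasurable
    · rw [norm_mul, norm_cexp_I_mul_ofReal, mul_one]
  have hXb : ∀ k, ‖X k‖ ≤ ∫ z, ‖χ z‖ := fun k => by
    refine (norm_integral_le_integral_norm _).trans (le_of_eq ?_)
    simp only [norm_mul, norm_cexp_I_mul_ofReal, mul_one]
  -- the support of the test function keeps a positive distance from `c`
  obtain ⟨δ, hδ, hδs⟩ : ∃ δ > 0, ∀ z, χ z ≠ 0 → c + δ ≤ z := by
    rcases (tsupport φ).eq_empty_or_nonempty with h0 | h0
    · refine ⟨1, one_pos, fun z hz => ?_⟩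
      have : z ∈ tsupport φ := subset_tsupport _ (by simpa [hχ] using hz)
      simp [h0] at this
    · obtain ⟨z₀, hz₀, hmin⟩ := hφc.isCompact.exists_isMinOn h0 continuousOn_id
      refine ⟨z₀ - c, sub_pos.2 (hφs hz₀), fun z hz => ?_⟩
      have : z ∈ tsupport φ := subset_tsupport _ (by simpa [hχ] using hz)
      have := hmin this
      simp only [id, mem_ofPred_eq] at this
      linarith
  have hhX : ∫ k, X k * h k = ∫ z, χ z * ∫ k : ℝ, h k * Complex.exp (Complex.I * k * z) := by
    simp_rw [hX, ← integral_const_mul, ← integral_mul_const]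
    rw [integral_integral_swap]
    · refine integral_congr_ae (Eventually.of_forall fun z => integral_congr_ae
        (Eventually.of_forall fun k => ?_))
      simp only; ring
    · have h1 : Integrable (fun p : ℝ × ℝ => h p.1 * χ p.2) (volume.prod volume) := hh.mul_prod hχi
      have h2 : Integrable (fun p : ℝ × ℝ => (h p.1 * χ p.2) * Complex.exp (Complex.I * p.1 * p.2))
          (volume.prod volume) := h1.mul_bdd (c := 1)
        (by fun_prop : Continuous fun p : ℝ × ℝ =>
          Complex.exp (Complex.I * p.1 * p.2)).aestronglyMeasurable
        (Eventually.of_forall fun p => (norm_cexp_I_mul_ofReal _ _).le)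
      refine h2.congr (Eventually.of_forall fun p => ?_)
      simp only [Function.uncurry]; ring
  have hHc : Continuous fun k : ℝ => H k := by
    refine continuous_iff_continuousAt.2 fun k => ?_
    exact ContinuousAt.comp (f := fun k : ℝ => (k : ℂ)) (hHd k (by simp)).continuousAt
      Complex.continuous_ofReal.continuousAt
  have hHX : Tendsto (fun N : ℝ => ∫ k in (-N)..N, X k * H k) atTop (𝓝 0) := by
    rw [Metric.tendsto_atTop]
    intro ε hε
    set A := ∫ z, ‖χ z‖ with hA
    have hA0 : 0 ≤ A := integral_nonneg fun _ => norm_nonneg _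
    obtain ⟨N₀, hN₀⟩ := exists_norm_integral_mul_cexp_le
      (H := fun w => H w * Complex.exp (Complex.I * w * c))
      (fun w hw => (hHd w hw).mul (by fun_prop)) hH (ε := ε * δ / (2 * (A + 1))) (by positivity)
    refine ⟨max N₀ 0, fun N hN => ?_⟩
    rw [dist_zero_right]
    have hN0 : 0 ≤ N := (le_max_right _ _).trans hN
    have e : ∫ k in (-N)..N, X k * H k =
        ∫ z, χ z * ∫ k in (-N)..N, H k * Complex.exp (Complex.I * k * z) := by
      simp_rw [intervalIntegral.integral_of_le (neg_le_self hN0), hX, ← integral_const_mul,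
        ← integral_mul_const]
      rw [integral_integral_swap]
      · refine integral_congr_ae (Eventually.of_forall fun z => integral_congr_ae
          (Eventually.of_forall fun k => ?_))
        simp only; ring
      · have h0 : Integrable (fun k : ℝ => H k) (volume.restrict (Ioc (-N) N)) :=
          (hHc.integrableOn_Icc (a := -N) (b := N)).mono_set Ioc_subset_Icc_self
        have h1 := h0.mul_prod hχi
        have h2 := h1.mul_bdd (c := 1)
          (by fun_prop : Continuous fun p : ℝ × ℝ =>
            Complex.exp (Complex.I * p.1 * p.2)).aestronglyMeasurable
          (Eventually.of_forall fun p => (norm_cexp_I_mul_ofReal _ _).le)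
        refine h2.congr (Eventually.of_forall fun p => ?_)
        simp only [Function.uncurry]; ring
    rw [e]
    have hb : ‖∫ z, χ z * ∫ k in (-N)..N, H k * Complex.exp (Complex.I * k * z)‖ ≤
        ∫ z, ‖χ z‖ * (ε / (2 * (A + 1))) := by
      refine norm_integral_le_of_norm_le (hχi.norm.mul_const _) (Eventually.of_forall fun z => ?_)
      rw [norm_mul]
      by_cases hz : χ z = 0
      · simp [hz]
      refine mul_le_mul_of_nonneg_left ?_ (norm_nonneg _)
      have hzc := hδs z hz
      have := hN₀ N ((le_max_left _ _).trans hN) (z - c) (by linarith)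
      have e2 : ∀ k : ℝ, H k * Complex.exp (Complex.I * k * c) *
          Complex.exp (Complex.I * k * (z - c : ℝ)) = H k * Complex.exp (Complex.I * k * z) := fun k => by
        rw [mul_assoc, ← Complex.exp_add]
        congr 2
        push_cast; ring
      simp_rw [e2] at this
      refine this.trans ?_
      rw [div_le_iff₀ (by linarith)]
      rw [mul_div_right_comm]
      exact mul_le_mul_of_nonneg_left (by linarith) (by positivity)
    refine hb.trans_lt ?_
    rw [integral_mul_const, ← hA, ← mul_div_assoc, div_lt_iff₀ (by positivity)]
    nlinarith
  have hXh : Integrable fun k => X k * h k :=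
    hh.bdd_mul hXc.aestronglyMeasurable (Eventually.of_forall hXb)
  have hXF : Integrable fun k : ℝ => X k * ∫ y : ℝ, f y * Complex.exp (-(Complex.I * k * y)) := by
    refine hXi.mul_bdd (c := ∫ y, ‖f y‖) ?_ (Eventually.of_forall fun k => ?_)
    · refine Continuous.aestronglyMeasurable (continuous_of_dominated (bound := fun y => ‖f y‖)
        (fun k => ?_) (fun k => Eventually.of_forall fun y => ?_) hf.norm
        (Eventually.of_forall fun y => by fun_prop))
      · exact hf.aestronglyMeasurable.mul (by fun_prop : Continuous fun y : ℝ =>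
          Complex.exp (-(Complex.I * k * y))).aestronglyMeasurable
      · rw [norm_mul, norm_cexp_neg_I_mul_ofReal, mul_one]
    · refine (norm_integral_le_integral_norm _).trans (le_of_eq ?_)
      simp only [norm_mul, norm_cexp_neg_I_mul_ofReal, mul_one]
  have hlim1 : Tendsto (fun N : ℝ => ∫ k in (-N)..N, X k *
      ∫ y : ℝ, f y * Complex.exp (-(Complex.I * k * y))) atTop (𝓝 (∫ k : ℝ, X k *
      ∫ y : ℝ, f y * Complex.exp (-(Complex.I * k * y)))) :=
    intervalIntegral_tendsto_integral hXF tendsto_neg_atTop_atBot tendsto_id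
  have hlim2 : Tendsto (fun N : ℝ => ∫ k in (-N)..N, X k *
      ∫ y : ℝ, f y * Complex.exp (-(Complex.I * k * y))) atTop (𝓝 (∫ k, X k * h k)) := by
    have h1 := hHX.add (intervalIntegral_tendsto_integral hXh tendsto_neg_atTop_atBot tendsto_id)
    rw [zero_add] at h1
    refine h1.congr fun N => ?_
    have i1 : IntervalIntegrable (fun k : ℝ => X k * H k) volume (-N) N :=
      (hXc.mul hHc).intervalIntegrable _ _
    rw [id, ← intervalIntegral.integral_add i1 hXh.intervalIntegrable]
    refine intervalIntegral.integral_congr fun k _ => ?_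
    simp only [hfh]; ring
  have hgX : ∫ z, χ z * g z = (1 / (2 * Real.pi)) * ∫ k, X k * h k := by
    rw [hhX, ← integral_const_mul]
    refine integral_congr_ae (Eventually.of_forall fun z => ?_)
    simp only [hg]; ring
  have hfin : ∫ z, χ z * f z = ∫ z, χ z * g z := by
    rw [hpars, hgX, tendsto_nhds_unique hlim1 hlim2]
  have i2 : Integrable fun z => χ z * f z := by
    obtain ⟨C, hC⟩ := hχc.exists_bound_of_continuous hχd.continuous
    exact hf.bdd_mul hχd.continuous.aestronglyMeasurable (Eventually.of_forall hC)
  have i3 : Integrable fun z => χ z * g z :=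
    (hχd.continuous.mul hgc).integrable_of_hasCompactSupport hχc.mul_right
  simp only [Complex.real_smul, mul_sub]
  rw [integral_sub i2 i3, hfin, sub_self]

/-- Plancherel's theorem on `L¹ ∩ L²`. -/
lemma lintegral_enorm_sq_fourier {f : ℝ → ℂ} (hf : Integrable f) (hf2 : MemLp f 2) :
    ∫⁻ ξ, ‖𝓕 f ξ‖ₑ ^ 2 = ∫⁻ x, ‖f x‖ₑ ^ 2 := by
  set g : Lp ℂ 2 (volume : Measure ℝ) := hf2.toLp f with hg
  have hfc : Continuous (𝓕 f) := VectorFourier.fourierIntegral_continuous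
    Real.continuous_fourierChar continuous_inner hf
  have hG : LocallyIntegrable ((𝓕 g : Lp ℂ 2 (volume : Measure ℝ)) : ℝ → ℂ) :=
    (Lp.memLp _).locallyIntegrable (by norm_num)
  -- both Fourier transforms define the same distribution
  have hae : ((𝓕 g : Lp ℂ 2 (volume : Measure ℝ)) : ℝ → ℂ) =ᵐ[volume] 𝓕 f := by
    refine ae_eq_of_integral_contDiff_smul_eq hG hfc.locallyIntegrable fun φ hφ hφc => ?_
    set χ : ℝ → ℂ := fun z => (φ z : ℂ) with hχ
    have hχd : ContDiff ℝ ∞ χ := Complex.ofRealCLM.contDiff.comp hφ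
    have hχc : HasCompactSupport χ := hφc.comp_left (g := fun x : ℝ => (x : ℂ)) rfl
    set S : SchwartzMap ℝ ℂ := hχc.toSchwartzMap hχd with hS
    have h1 := congrArg (fun T => T S) (Lp.fourier_toTemperedDistribution_eq g)
    simp only [TemperedDistribution.fourier_apply, Lp.toTemperedDistribution_apply] at h1
    have h2 := VectorFourier.integral_fourierIntegral_smul_eq_flip (L := innerₗ ℝ)
      (μ := volume) (ν := volume) Real.continuous_fourierChar continuous_inner S.integrable hf
    have h3 : ∫ x, φ x • ((𝓕 g : Lp ℂ 2 (volume : Measure ℝ)) : ℝ → ℂ) x =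
      ∫ x, S x • ((𝓕 g : Lp ℂ 2 (volume : Measure ℝ)) : ℝ → ℂ) x := rfl
    rw [h3, ← h1]
    have h4 : ∫ x, (𝓕 S : SchwartzMap ℝ ℂ) x • (g : ℝ → ℂ) x = ∫ x, 𝓕 (S : ℝ → ℂ) x • f x := by
      refine integral_congr_ae ?_
      filter_upwards [hf2.coeFn_toLp] with x hx
      rw [hg, hx, SchwartzMap.fourier_coe]
    rw [h4]
    rw [flip_innerₗ] at h2
    exact h2
  have e1 : eLpNorm (𝓕 f) 2 = eLpNorm f 2 := by
    rw [← eLpNorm_congr_ae hae, ← eLpNorm_congr_ae hf2.coeFn_toLp, ← Lp.enorm_def, ← Lp.enorm_def,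
      enorm_eq_iff_norm_eq, ← hg, Lp.norm_fourier_eq]
  rw [eLpNorm_eq_lintegral_rpow_enorm_toReal (by norm_num) (by norm_num),
    eLpNorm_eq_lintegral_rpow_enorm_toReal (by norm_num) (by norm_num)] at e1
  simp only [ENNReal.toReal_ofNat, ENNReal.rpow_ofNat] at e1
  have := congrArg (fun x : ℝ≥0∞ => x ^ (2 : ℝ)) e1
  simp only [← ENNReal.rpow_mul] at this
  norm_num at this
  exact this

end

/-! ### Potentials of small mass: the reflection coefficient and its Born approximation -/

noncomputable section

variable {v : ℝ → ℂ} {L : ℝ} {m n : ℂ → ℝ → ℂ}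

/-- The first Born approximation of the second component in the interaction picture. -/
def bornTerm (v : ℝ → ℂ) (k s : ℝ) : ℂ :=
  -∫ t in Iic s, (starRingEnd ℂ) (v t) * Complex.exp (-(2 * Complex.I * k * t))

lemma norm_cexp_two_I_mul_ofReal (k t : ℝ) : ‖Complex.exp (2 * Complex.I * k * t)‖ = 1 := by
  rw [show 2 * Complex.I * k * t = Complex.I * k * ((2 * t : ℝ) : ℂ) by push_cast; ring,
    norm_cexp_I_mul_ofReal]

lemma norm_cexp_neg_two_I_mul_ofReal (k t : ℝ) :
    ‖Complex.exp (-(2 * Complex.I * k * t))‖ = 1 := by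
  rw [show -(2 * Complex.I * k * t) = 2 * Complex.I * k * ((-t : ℝ) : ℂ) by push_cast; ring,
    norm_cexp_two_I_mul_ofReal]

lemma integrable_conj_mul_cexp (hv : Integrable v) (k : ℝ) :
    Integrable fun t : ℝ => (starRingEnd ℂ) (v t) * Complex.exp (-(2 * Complex.I * k * t)) :=
  (Complex.conjLIE.integrable_comp_iff.2 hv).mul_bdd (c := 1)
    (by fun_prop : Continuous fun t : ℝ =>
      Complex.exp (-(2 * Complex.I * k * t))).aestronglyMeasurable
    (Eventually.of_forall fun t => (norm_cexp_neg_two_I_mul_ofReal k t).le)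

lemma isPrimitive_bornTerm (hv : Integrable v) (k : ℝ) :
    IsPrimitive (bornTerm v k)
      fun t => -(starRingEnd ℂ) (v t) * Complex.exp (-(2 * Complex.I * k * t)) := by
  have := (IsPrimitive.of_integral_Iic (integrable_conj_mul_cexp hv k) 0).const_mul (-1)
  simp only [zero_add, neg_one_mul] at this
  exact this.congr fun t => by ring

lemma bornTerm_eq_zero (hsupp : ∀ x, L < |x| → v x = 0) {s : ℝ} (hs : s ≤ -L) (k : ℝ) :
    bornTerm v k s = 0 := by
  unfold bornTerm
  rw [integral_Iic_eq_integral_Iio, neg_eq_zero]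
  refine setIntegral_eq_zero_of_forall_eq_zero fun t ht => ?_
  rw [hsupp t (by
    have h1 : t < s := ht
    have := neg_le_abs t
    linarith), map_zero, zero_mul]

lemma norm_bornTerm_le (hv : Integrable v) (k s : ℝ) : ‖bornTerm v k s‖ ≤ ∫ t, ‖v t‖ := by
  unfold bornTerm
  rw [norm_neg]
  refine (norm_integral_le_integral_norm _).trans ((setIntegral_le_integral
    (integrable_conj_mul_cexp hv k).norm (Eventually.of_forall fun _ => norm_nonneg _)).trans_eq ?_)
  simp only [norm_mul, norm_cexp_neg_two_I_mul_ofReal, mul_one, RCLike.norm_conj]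

/-- Plancherel's theorem for the Born term. -/
lemma lintegral_enorm_sq_bornTerm_le (hv : Integrable v) (hv2 : MemLp v 2) (s : ℝ) :
    ∫⁻ k, ‖bornTerm v k s‖ₑ ^ 2 ≤ ENNReal.ofReal Real.pi * ∫⁻ t, ‖v t‖ₑ ^ 2 := by
  set f : ℝ → ℂ := (Iic s).indicator fun t => (starRingEnd ℂ) (v t) with hf
  have hc2 : MemLp (fun t => (starRingEnd ℂ) (v t)) 2 := hv2.star
  have hfi : Integrable f := (Complex.conjLIE.integrable_comp_iff.2 hv).indicator measurableSet_Iic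
  have hf2 : MemLp f 2 := hc2.indicator measurableSet_Iic
  have e : ∀ k : ℝ, ‖bornTerm v k s‖ₑ ^ 2 = ‖𝓕 f (Real.pi⁻¹ * k)‖ₑ ^ 2 := fun k => by
    rw [fourier_eq_integral_cexp, bornTerm, enorm_neg, ← integral_indicator measurableSet_Iic]
    congr 3
    funext t
    by_cases ht : t ∈ Iic s
    · rw [indicator_of_mem ht, hf, indicator_of_mem ht]
      congr 3
      have : (Real.pi : ℂ) ≠ 0 := by exact_mod_cast Real.pi_ne_zero
      push_cast
      field_simp
    · rw [indicator_of_notMem ht, hf, indicator_of_notMem ht, zero_mul]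
  simp_rw [e]
  have hpi : Real.pi⁻¹ ≠ 0 := inv_ne_zero Real.pi_ne_zero
  have h1 := (measurableEmbedding_mulLeft₀ hpi).lintegral_map (μ := volume)
    (fun ξ => ‖𝓕 f ξ‖ₑ ^ 2)
  rw [Real.map_volume_mul_left hpi, lintegral_smul_measure, inv_inv,
    abs_of_pos Real.pi_pos, lintegral_enorm_sq_fourier hfi hf2, smul_eq_mul] at h1
  rw [← h1]
  gcongr with t
  by_cases ht : t ∈ Iic s
  · rw [hf, indicator_of_mem ht, RCLike.enorm_conj]
  · rw [hf, indicator_of_notMem ht]; simp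

lemma aestronglyMeasurable_bornTerm (hv : Integrable v) :
    AEStronglyMeasurable (fun p : ℝ × ℝ => bornTerm v p.2 p.1) (volume.prod volume) := by
  have h1 : AEStronglyMeasurable (fun q : (ℝ × ℝ) × ℝ => (starRingEnd ℂ) (v q.2))
      ((volume.prod volume).prod volume) :=
    (Complex.conjLIE.integrable_comp_iff.2 hv).aestronglyMeasurable.comp_snd
  have h2 : AEStronglyMeasurable (fun q : (ℝ × ℝ) × ℝ => (starRingEnd ℂ) (v q.2) *
      Complex.exp (-(2 * Complex.I * q.1.2 * q.2))) ((volume.prod volume).prod volume) :=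
    h1.mul (by fun_prop : Continuous fun q : (ℝ × ℝ) × ℝ =>
      Complex.exp (-(2 * Complex.I * q.1.2 * q.2))).aestronglyMeasurable
  have hS : MeasurableSet {q : (ℝ × ℝ) × ℝ | q.2 ≤ q.1.1} :=
    measurableSet_le measurable_snd (measurable_fst.comp measurable_fst)
  have h3 := (h2.indicator hS).integral_prod_right'
  refine h3.neg.congr (Eventually.of_forall fun p => ?_)
  simp only [Pi.neg_apply, bornTerm]
  rw [← integral_indicator measurableSet_Iic]
  congr 1

namespace IsFundamental

variable (hm : IsFundamental v L m n) (hv : Integrable v) (hsupp : ∀ x, L < |x| → v x = 0)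
  (hL : 0 < L) (hμ : ∫ t, ‖v t‖ ≤ 1 / 2)
include hm hv hL hμ

/-- A priori bounds in the closed upper half plane for potentials of small mass. -/
lemma norm_le_of_small {k : ℂ} (hk : 0 ≤ k.im) {x : ℝ} (hx : x ∈ Icc (-L) L) :
    ‖m k x‖ ≤ 4 / 3 ∧ ‖Complex.exp (2 * Complex.I * k * x) * n k x‖ ≤ 2 / 3 := by
  set μ := ∫ t, ‖v t‖ with hμd
  have hμ0 : 0 ≤ μ := integral_nonneg fun _ => norm_nonneg _
  have hLL : -L ≤ L := by linarith
  obtain ⟨x₀, hx₀, hmax⟩ := isCompact_Icc.exists_isMaxOn (nonempty_Icc.2 hLL)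
    (hm.sol k).fst.continuous.norm.continuousOn
  have hb : ∀ y ∈ Icc (-L) L, ‖m k y‖ ≤ ‖m k x₀‖ := fun y hy => hmax hy
  set A := ‖m k x₀‖ with hA
  have hA0 : 0 ≤ A := norm_nonneg _
  have hint : ∀ y ∈ Icc (-L) L, ∫ t in (-L)..y, ‖v t‖ ≤ μ := fun y hy => by
    rw [intervalIntegral.integral_of_le hy.1]
    exact setIntegral_le_integral hv.norm (Eventually.of_forall fun _ => norm_nonneg _)
  have hn : ∀ y ∈ Icc (-L) L, ‖Complex.exp (2 * Complex.I * k * y) * n k y‖ ≤ A * μ := by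
    intro y hy
    have e := (hm.sol k).snd.eq_add (-L) y
    rw [hm.snd_eq_zero k _ le_rfl, zero_add] at e
    rw [e, ← intervalIntegral.integral_const_mul]
    refine (intervalIntegral.norm_integral_le_of_norm_le hy.1 (g := fun t => A * ‖v t‖)
      (Eventually.of_forall fun t ht => ?_) (hv.norm.const_mul A).intervalIntegrable).trans ?_
    · have e2 : Complex.exp (2 * Complex.I * k * y) * (-(starRingEnd ℂ) (v t) *
          Complex.exp (-(2 * Complex.I * k * t)) * m k t) = -(starRingEnd ℂ) (v t) *
          Complex.exp (Complex.I * k * (2 * (y - t) : ℝ)) * m k t := by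
        rw [show Complex.I * k * (2 * (y - t) : ℝ) = 2 * Complex.I * k * y +
          -(2 * Complex.I * k * t) by push_cast; ring, Complex.exp_add]
        ring
      rw [e2, norm_mul, norm_mul, norm_neg, RCLike.norm_conj]
      have h1 := norm_cexp_I_mul_le hk (c := 2 * (y - t)) (by linarith [ht.2])
      have h2 := hb t ⟨ht.1.le, ht.2.trans hy.2⟩
      calc _ ≤ ‖v t‖ * 1 * A := by gcongr
        _ = A * ‖v t‖ := by ring
    · rw [intervalIntegral.integral_const_mul]
      exact mul_le_mul_of_nonneg_left (hint y hy) hA0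
  have hm1 : ∀ y ∈ Icc (-L) L, ‖m k y - 1‖ ≤ A * μ * μ := by
    intro y hy
    have e := (hm.sol k).fst.eq_add (-L) y
    rw [hm.fst_eq_one k _ le_rfl] at e
    rw [e, add_sub_cancel_left]
    refine (intervalIntegral.norm_integral_le_of_norm_le hy.1 (g := fun t => A * μ * ‖v t‖)
      (Eventually.of_forall fun t ht => ?_)
      (hv.norm.const_mul (A * μ)).intervalIntegrable).trans ?_
    · rw [mul_assoc, norm_mul, mul_comm]
      exact mul_le_mul_of_nonneg_right (hn t ⟨ht.1.le, ht.2.trans hy.2⟩) (norm_nonneg _)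
    · rw [intervalIntegral.integral_const_mul]
      exact mul_le_mul_of_nonneg_left (hint y hy) (by positivity)
  -- the supremum `A` of `|m|` is absorbed, as `μ² ≤ 1 / 4`
  have hA1 : A ≤ 1 + A * μ * μ := by
    have := norm_add_le (m k x₀ - 1) 1
    rw [sub_add_cancel, norm_one] at this
    linarith [hm1 x₀ hx₀]
  have hA2 : A ≤ 4 / 3 := by
    have : A * μ * μ ≤ A * (1 / 2) * (1 / 2) := by gcongr
    linarith
  refine ⟨(hb x hx).trans hA2, (hn x hx).trans ?_⟩
  calc A * μ ≤ 4 / 3 * (1 / 2) := by gcongr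
    _ = 2 / 3 := by norm_num

lemma two_thirds_le_norm_fst {k : ℂ} (hk : 0 ≤ k.im) : 2 / 3 ≤ ‖m k L‖ := by
  have hLL : -L ≤ L := by linarith
  have e := (hm.sol k).fst.eq_add (-L) L
  rw [hm.fst_eq_one k _ le_rfl] at e
  have h1 : ‖m k L - 1‖ ≤ 1 / 3 := by
    rw [e, add_sub_cancel_left]
    refine (intervalIntegral.norm_integral_le_of_norm_le hLL (g := fun t => 2 / 3 * ‖v t‖)
      (Eventually.of_forall fun t ht => ?_)
      (hv.norm.const_mul (2 / 3)).intervalIntegrable).trans ?_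
    · rw [mul_assoc, norm_mul, mul_comm]
      exact mul_le_mul_of_nonneg_right (hm.norm_le_of_small hv hL hμ hk ⟨ht.1.le, ht.2⟩).2
        (norm_nonneg _)
    · rw [intervalIntegral.integral_const_mul, intervalIntegral.integral_of_le hLL]
      have := setIntegral_le_integral (s := Ioc (-L) L) hv.norm
        (Eventually.of_forall fun _ => norm_nonneg _)
      linarith
  have := norm_sub_norm_le 1 (1 - m k L)
  rw [sub_sub_cancel, norm_one, norm_sub_rev] at this
  linarith

include hsupp

/-- The error of the Born approximation is quadratic in the Born term. -/
lemma norm_reflection_sub_bornTerm_le (k : ℝ) :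
    ‖n k L / m k L - bornTerm v k L‖ ≤ 8 / 3 * ∫ s, ‖v s‖ * ‖bornTerm v k s‖ ^ 2 := by
  have hLL : -L ≤ L := by linarith
  set β := bornTerm v k with hβ
  have hp := isPrimitive_bornTerm hv k
  have hβc : Continuous β := hp.continuous
  have hnc : Continuous (n k) := (hm.sol k).snd.continuous
  have hk : 0 ≤ (k : ℂ).im := by simp
  set μ := ∫ t, ‖v t‖ with hμd
  have hμ0 : 0 ≤ μ := integral_nonneg fun _ => norm_nonneg _
  -- `β m - n` is a primitive of `β v e^{2iks} n`
  have hcor : ∀ x, n k x = β x * m k x - ∫ s in (-L)..x,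
      β s * (v s * Complex.exp (2 * Complex.I * k * s) * n k s) := fun x => by
    have h1 := ((hp.mul (hm.sol k).fst).sub (hm.sol k).snd).congr (f' := fun s =>
      β s * (v s * Complex.exp (2 * Complex.I * k * s) * n k s)) fun s => by
        simp only [hβ]; ring
    have h2 := h1.eq_add (-L) x
    rw [hm.snd_eq_zero k _ le_rfl, bornTerm_eq_zero hsupp le_rfl] at h2
    linear_combination -h2
  have hiK : Integrable fun s => ‖v s‖ * (‖n k s‖ * ‖β s‖) := by
    have : (fun s => ‖v s‖ * (‖n k s‖ * ‖β s‖)) =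
        (Icc (-L) L).indicator fun s => ‖v s‖ * (‖n k s‖ * ‖β s‖) := by
      funext s
      by_cases hs : s ∈ Icc (-L) L
      · rw [indicator_of_mem hs]
      · rw [indicator_of_notMem hs, hsupp s (by
          rw [mem_Icc, ← abs_le] at hs; exact not_le.1 hs)]
        simp
    rw [this, integrable_indicator_iff measurableSet_Icc]
    exact hv.norm.integrableOn.mul_continuousOn (hnc.norm.mul hβc.norm).continuousOn isCompact_Icc
  have hiJ : Integrable fun s => ‖v s‖ * ‖β s‖ ^ 2 := by
    refine hv.norm.mul_bdd (c := μ ^ 2) (hβc.norm.pow 2).aestronglyMeasurable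
      (Eventually.of_forall fun s => ?_)
    rw [norm_pow, norm_norm]
    exact pow_le_pow_left₀ (norm_nonneg _) (norm_bornTerm_le hv k s) 2
  set K := ∫ s, ‖v s‖ * (‖n k s‖ * ‖β s‖) with hK
  set J := ∫ s, ‖v s‖ * ‖β s‖ ^ 2 with hJ
  have hK0 : 0 ≤ K := integral_nonneg fun _ => by positivity
  have hKx : ∀ x ∈ Icc (-L) L, ‖∫ s in (-L)..x,
      β s * (v s * Complex.exp (2 * Complex.I * k * s) * n k s)‖ ≤ K := fun x hx => by
    refine (intervalIntegral.norm_integral_le_of_norm_le hx.1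
      (g := fun s => ‖v s‖ * (‖n k s‖ * ‖β s‖))
      (Eventually.of_forall fun s _ => le_of_eq ?_) hiK.intervalIntegrable).trans ?_
    · rw [norm_mul, norm_mul, norm_mul, norm_cexp_two_I_mul_ofReal]; ring
    · rw [intervalIntegral.integral_of_le hx.1]
      exact setIntegral_le_integral hiK (Eventually.of_forall fun _ => by positivity)
  have hnb : ∀ x ∈ Icc (-L) L, ‖n k x‖ ≤ 4 / 3 * ‖β x‖ + K := fun x hx => by
    rw [hcor x]
    refine (norm_sub_le _ _).trans (add_le_add ?_ (hKx x hx))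
    rw [norm_mul, mul_comm]
    exact mul_le_mul_of_nonneg_right (hm.norm_le_of_small hv hL hμ hk hx).1 (norm_nonneg _)
  have hKJ : K ≤ 4 / 3 * J + K * μ * μ := by
    have h1 : K ≤ ∫ s, (4 / 3 * (‖v s‖ * ‖β s‖ ^ 2) + K * μ * ‖v s‖) := by
      refine integral_mono hiK ((hiJ.const_mul _).add (hv.norm.const_mul _)) fun s => ?_
      by_cases hs : s ∈ Icc (-L) L
      · have h2 := hnb s hs
        have h3 := norm_bornTerm_le hv k s
        calc ‖v s‖ * (‖n k s‖ * ‖β s‖) ≤ ‖v s‖ * ((4 / 3 * ‖β s‖ + K) * ‖β s‖) := by gcongr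
          _ = 4 / 3 * (‖v s‖ * ‖β s‖ ^ 2) + K * ‖β s‖ * ‖v s‖ := by ring
          _ ≤ 4 / 3 * (‖v s‖ * ‖β s‖ ^ 2) + K * μ * ‖v s‖ := by gcongr
      · simp [hsupp s (by rw [mem_Icc, ← abs_le] at hs; exact not_le.1 hs)]
    rwa [integral_add (hiJ.const_mul _) (hv.norm.const_mul _), integral_const_mul,
      integral_const_mul] at h1
  have hK2 : K ≤ 16 / 9 * J := by
    have : K * μ * μ ≤ K * (1 / 2) * (1 / 2) := by gcongr
    linarith
  have hmL := hm.two_thirds_le_norm_fst hv hL hμ hk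
  have hmL0 : m k L ≠ 0 := fun h => by rw [h, norm_zero] at hmL; norm_num at hmL
  have e : n k L / m k L - β L = -(∫ s in (-L)..L,
      β s * (v s * Complex.exp (2 * Complex.I * k * s) * n k s)) / m k L := by
    rw [eq_div_iff hmL0, sub_mul, div_mul_cancel₀ _ hmL0]
    linear_combination hcor L
  rw [e, norm_div, norm_neg, div_le_iff₀ (by linarith)]
  have h1 := hKx L (right_mem_Icc.2 hLL)
  have hJ0 : 0 ≤ J := integral_nonneg fun _ => by positivity
  nlinarith

/-- The Born approximation of the reflection coefficient of a small bounded potential has an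
integrable error, quadratic in the mass of the potential. -/
lemma integrable_reflection_sub_bornTerm {C : ℝ} (hC : ∀ x, ‖v x‖ ≤ C) :
    Integrable (fun k : ℝ => n k L / m k L - bornTerm v k L) ∧
    ∫ k : ℝ, ‖n k L / m k L - bornTerm v k L‖ ≤ 8 / 3 * Real.pi * C * (∫ t, ‖v t‖) ^ 2 := by
  set μ := ∫ t, ‖v t‖ with hμd
  have hμ0 : 0 ≤ μ := integral_nonneg fun _ => norm_nonneg _
  have hC0 : 0 ≤ C := (norm_nonneg _).trans (hC 0)
  have hv1 : ∫⁻ t, ‖v t‖ₑ = ENNReal.ofReal μ := (ofReal_integral_norm_eq_lintegral_enorm hv).symm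
  have hv2 : MemLp v 2 := by
    refine (memLp_two_iff_integrable_sq_norm hv.aestronglyMeasurable).2 ?_
    simp_rw [pow_two]
    exact hv.norm.mul_bdd (c := C) hv.aestronglyMeasurable.norm
      (Eventually.of_forall fun t => by rw [norm_norm]; exact hC t)
  have hvC : ∀ t, ‖v t‖ₑ ≤ ENNReal.ofReal C := fun t => by
    rw [← ofReal_norm]; exact ENNReal.ofReal_le_ofReal (hC t)
  have hvsq : ∫⁻ t, ‖v t‖ₑ ^ 2 ≤ ENNReal.ofReal C * ENNReal.ofReal μ := by
    rw [← hv1, ← lintegral_const_mul' _ _ ENNReal.ofReal_ne_top]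
    refine lintegral_mono fun t => ?_
    rw [pow_two]
    exact mul_le_mul_left (hvC t) _
  set r : ℝ → ℂ := fun k => n k L / m k L - bornTerm v k L with hr
  have hβm : ∀ k, Continuous (bornTerm v k) := fun k => (isPrimitive_bornTerm hv k).continuous
  have hpt : ∀ k, ‖r k‖ₑ ≤ ENNReal.ofReal (8 / 3) * ∫⁻ s, ‖v s‖ₑ * ‖bornTerm v k s‖ₑ ^ 2 := by
    intro k
    have hiJ : Integrable fun s => ‖v s‖ * ‖bornTerm v k s‖ ^ 2 := by
      refine hv.norm.mul_bdd (c := μ ^ 2) ((hβm k).norm.pow 2).aestronglyMeasurable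
        (Eventually.of_forall fun s => ?_)
      rw [norm_pow, norm_norm]
      exact pow_le_pow_left₀ (norm_nonneg _) (norm_bornTerm_le hv k s) 2
    rw [← ofReal_norm]
    refine (ENNReal.ofReal_le_ofReal
      (hm.norm_reflection_sub_bornTerm_le hv hsupp hL hμ k)).trans_eq ?_
    rw [ENNReal.ofReal_mul (by norm_num),
      ofReal_integral_eq_lintegral_ofReal hiJ (Eventually.of_forall fun _ => by positivity)]
    congr 2
    funext s
    rw [ENNReal.ofReal_mul (norm_nonneg _), ENNReal.ofReal_pow (norm_nonneg _), ofReal_norm,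
      ofReal_norm]
  have hmeas : AEMeasurable (fun p : ℝ × ℝ => ‖v p.1‖ₑ * ‖bornTerm v p.2 p.1‖ₑ ^ 2)
      (volume.prod volume) :=
    hv.aestronglyMeasurable.comp_fst.enorm.mul ((aestronglyMeasurable_bornTerm hv).enorm.pow_const 2)
  have hlin : ∫⁻ k, ‖r k‖ₑ ≤ ENNReal.ofReal (8 / 3 * Real.pi * C * μ ^ 2) := by
    calc ∫⁻ k, ‖r k‖ₑ ≤ ∫⁻ k, ENNReal.ofReal (8 / 3) * ∫⁻ s, ‖v s‖ₑ * ‖bornTerm v k s‖ₑ ^ 2 :=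
          lintegral_mono hpt
      _ = ENNReal.ofReal (8 / 3) * ∫⁻ k, ∫⁻ s, ‖v s‖ₑ * ‖bornTerm v k s‖ₑ ^ 2 :=
          lintegral_const_mul' _ _ ENNReal.ofReal_ne_top
      _ = ENNReal.ofReal (8 / 3) * ∫⁻ s, ∫⁻ k, ‖v s‖ₑ * ‖bornTerm v k s‖ₑ ^ 2 := by
          rw [lintegral_lintegral_swap (f := fun s k => ‖v s‖ₑ * ‖bornTerm v k s‖ₑ ^ 2) hmeas]
      _ ≤ ENNReal.ofReal (8 / 3) * ∫⁻ s, ‖v s‖ₑ *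
            (ENNReal.ofReal Real.pi * (ENNReal.ofReal C * ENNReal.ofReal μ)) := by
          gcongr with s
          rw [lintegral_const_mul' _ _ enorm_ne_top]
          gcongr
          exact (lintegral_enorm_sq_bornTerm_le hv hv2 s).trans (by gcongr)
      _ = ENNReal.ofReal (8 / 3 * Real.pi * C * μ ^ 2) := by
          rw [lintegral_mul_const' _ _ (by finiteness), hv1, ← ENNReal.ofReal_mul hC0,
            ← ENNReal.ofReal_mul Real.pi_pos.le, ← ENNReal.ofReal_mul hμ0,
            ← ENNReal.ofReal_mul (by norm_num)]
          congr 1; ring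
  have hrm : AEStronglyMeasurable r := by
    have hmL : ∀ k : ℝ, m k L ≠ 0 := fun k h => by
      have := hm.two_thirds_le_norm_fst hv hL hμ (k := k) (by simp)
      rw [h, norm_zero] at this; norm_num at this
    have h1 : Continuous fun k : ℝ => n k L / m k L :=
      ((hm.differentiable_snd L).continuous.comp Complex.continuous_ofReal).div
        ((hm.differentiable_fst L).continuous.comp Complex.continuous_ofReal) hmL
    have h2 : Continuous fun k : ℝ => bornTerm v k L := by
      unfold bornTerm
      refine (continuous_of_dominated (bound := fun t => ‖v t‖) (fun k => ?_)
        (fun k => Eventually.of_forall fun t => ?_) hv.norm.integrableOn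
        (Eventually.of_forall fun t => by fun_prop)).neg
      · exact (integrable_conj_mul_cexp hv k).aestronglyMeasurable.restrict
      · rw [norm_mul, norm_cexp_neg_two_I_mul_ofReal, mul_one, RCLike.norm_conj]
    exact (h1.sub h2).aestronglyMeasurable
  have hri : Integrable r := ⟨hrm, hlin.trans_lt ENNReal.ofReal_lt_top⟩
  refine ⟨hri, ?_⟩
  rw [← ENNReal.ofReal_le_ofReal_iff (by positivity), ofReal_integral_norm_eq_lintegral_enorm hri]
  exact hlin

end IsFundamental

end

/-! ### The Marchenko kernel near the end of its support -/

noncomputable section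

variable {u : ℝ → ℂ} {L : ℝ} {m n : ℂ → ℝ → ℂ} {B : Finset ℂ} {M : ℂ → ℕ} {τ : ℂ → ℕ → ℂ}

/-- `B`, `M`, `τ` describe the principal parts of the meromorphic function `b / a` at the zeros of
`a` in the closed upper half plane, all of which lie in the open upper half plane. -/
structure IsPolarData (a b : ℂ → ℂ) (B : Finset ℂ) (M : ℂ → ℕ) (τ : ℂ → ℕ → ℂ) : Prop where
  im_pos : ∀ k ∈ B, 0 < k.im
  mem : ∀ k, 0 ≤ k.im → a k = 0 → k ∈ B
  isBigO : ∀ k ∈ B, (fun w => b w / a w - ∑ s ∈ Finset.range (M k), τ k s / (w - k) ^ (s + 1))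
    =O[𝓝[≠] k] (fun _ => (1 : ℝ))

lemma eventually_upperInfty_notMem (B : Finset ℂ) : ∀ᶠ w in upperInfty, w ∉ B :=
  (B.finite_toSet.isCompact.compl_mem_cocompact : (↑B : Set ℂ)ᶜ ∈ cocompact ℂ) |>
    (mem_inf_of_left (g := 𝓟 {w : ℂ | 0 ≤ w.im}))

lemma tendsto_singularPart_mul_cexp (B : Finset ℂ) (M : ℂ → ℕ) (τ : ℂ → ℕ → ℂ) {c : ℝ}
    (hc : 0 ≤ c) :
    Tendsto (fun w => singularPart B M τ w * Complex.exp (Complex.I * w * c)) upperInfty (𝓝 0) := by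
  refine squeeze_zero_norm' ?_ (tendsto_zero_iff_norm_tendsto_zero.1 (tendsto_singularPart B M τ))
  filter_upwards [eventually_upperInfty_im] with w hw
  rw [norm_mul]
  exact mul_le_of_le_one_right (norm_nonneg _) (norm_cexp_I_mul_le hw hc)

lemma cexp_two_mul (w : ℂ) (x : ℝ) :
    Complex.exp (Complex.I * w * ((2 * x : ℝ) : ℂ)) = Complex.exp (2 * Complex.I * w * x) := by
  congr 1; push_cast; ring

namespace IsFundamental

variable (hm : IsFundamental u L m n) (hu : Integrable u) (hL : 0 < L)
  (hP : IsPolarData (fun k => m k L) (fun k => n k L) B M τ)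
include hm hu hL hP

/-- The reflection coefficient minus its singular part. -/
lemma exists_regularPart_reflection : ∃ G : ℂ → ℂ,
    (∀ w, w ∉ B → G w = n w L / m w L - singularPart B M τ w) ∧
    (∀ w, 0 ≤ w.im → DifferentiableAt ℂ G w) ∧
    Tendsto (fun w => G w * Complex.exp (Complex.I * w * ((2 * L : ℝ) : ℂ))) upperInfty (𝓝 0) := by
  have h0 : m 0 L ≠ 0 := fun h => (hP.im_pos 0 (hP.mem 0 (by simp) h)).ne' (by simp)
  obtain ⟨G, hG, hGd⟩ := exists_regularPart (hm.differentiable_fst L) (hm.differentiable_snd L) h0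
    hP.mem hP.isBigO
  refine ⟨G, hG, hGd, ?_⟩
  have h1 := (hm.tendsto_snd hu hL (x := L) ⟨by linarith, le_rfl⟩).div (hm.tendsto_fst hu hL)
    one_ne_zero
  have h2 := h1.sub (tendsto_singularPart_mul_cexp B M τ (c := 2 * L) (by linarith))
  rw [zero_div, sub_zero] at h2
  refine h2.congr' ?_
  filter_upwards [eventually_upperInfty_notMem B] with w hw
  rw [hG w hw, cexp_two_mul]
  simp only [Pi.div_apply]
  ring

omit hm hu hL in
lemma ofReal_notMem (k : ℝ) : (k : ℂ) ∉ B := fun h => (hP.im_pos _ h).ne' (by simp)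

lemma tendsto_integral_reflection {z : ℝ} (hz : 2 * L < z) :
    Tendsto (fun N : ℝ => (1 / (2 * (Real.pi : ℂ))) *
      (∫ k in (-N)..N, n (k : ℂ) L / m k L * Complex.exp (Complex.I * k * z)) +
        exponentialSum B M τ z) atTop (𝓝 0) := by
  obtain ⟨G, hG, hGd, hGt⟩ := hm.exists_regularPart_reflection hu hL hP
  have h1 := tendsto_integral_mul_cexp_zero
    (H := fun w => G w * Complex.exp (Complex.I * w * ((2 * L : ℝ) : ℂ)))
    (fun w hw => (hGd w hw).mul (by fun_prop)) hGt (d := z - 2 * L) (by linarith)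
  have h2 := tendsto_integral_singularPart (M := M) (τ := τ) hP.im_pos (z := z) (by linarith)
  have h3 := ((h1.add h2).const_mul (1 / (2 * (Real.pi : ℂ)))).add_const (exponentialSum B M τ z)
  have hpi : (Real.pi : ℂ) ≠ 0 := by exact_mod_cast Real.pi_ne_zero
  have e : 1 / (2 * (Real.pi : ℂ)) * (0 + -(2 * Real.pi) * exponentialSum B M τ z) +
      exponentialSum B M τ z = 0 := by
    field_simp; ring
  rw [e] at h3
  refine h3.congr fun N => ?_
  have hGc : Continuous fun k : ℝ => G k := continuous_iff_continuousAt.2 fun k =>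
    ContinuousAt.comp (f := fun k : ℝ => (k : ℂ)) (hGd k (by simp)).continuousAt
      Complex.continuous_ofReal.continuousAt
  have i1 : IntervalIntegrable (fun k : ℝ => G k * Complex.exp (Complex.I * k * ((2 * L : ℝ) : ℂ)) *
      Complex.exp (Complex.I * k * ((z - 2 * L : ℝ) : ℂ))) volume (-N) N :=
    ((hGc.mul (by fun_prop)).mul (by fun_prop)).intervalIntegrable _ _
  have i2 : IntervalIntegrable (fun k : ℝ => singularPart B M τ k * Complex.exp (Complex.I * k * z))
      volume (-N) N :=
    ((continuous_singularPart_ofReal hP.im_pos).mul (by fun_prop)).intervalIntegrable _ _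
  rw [← intervalIntegral.integral_add i1 i2]
  congr 2
  refine intervalIntegral.integral_congr fun k _ => ?_
  rw [hG k (ofReal_notMem hP k), mul_assoc, ← Complex.exp_add,
    show Complex.I * k * ((2 * L : ℝ) : ℂ) + Complex.I * k * ((z - 2 * L : ℝ) : ℂ) =
      Complex.I * k * z by push_cast; ring]
  ring

omit hm hu hL in
/-- The Fourier transform of the Marchenko kernel, extended by the reflection part to the negative
half line, is the regular part of the reflection coefficient. -/
lemma fourier_kernel {ρ : ℝ → ℂ} (hρ : Integrable ρ)
    (hρR : ∀ k : ℝ, n k L / m k L = ∫ y : ℝ, ρ y * Complex.exp (-(Complex.I * k * y))) :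
    Integrable (fun y => ρ y + (Ioi (0 : ℝ)).indicator (exponentialSum B M τ) y) ∧
    ∀ k : ℝ, ∫ y : ℝ, (ρ y + (Ioi (0 : ℝ)).indicator (exponentialSum B M τ) y) *
      Complex.exp (-(Complex.I * k * y)) = n k L / m k L - singularPart B M τ k := by
  have hS : Integrable ((Ioi (0 : ℝ)).indicator (exponentialSum B M τ)) :=
    ((integral_exponentialSum hP.im_pos 0).1).integrable_indicator measurableSet_Ioi
  have hmul : ∀ (k : ℝ) {f : ℝ → ℂ}, Integrable f →
      Integrable fun y : ℝ => f y * Complex.exp (-(Complex.I * k * y)) := fun k f hf =>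
    hf.mul_bdd (c := 1) (by fun_prop : Continuous fun y : ℝ =>
      Complex.exp (-(Complex.I * k * y))).aestronglyMeasurable
      (Eventually.of_forall fun y => (norm_cexp_neg_I_mul_ofReal k y).le)
  refine ⟨hρ.add hS, fun k => ?_⟩
  simp_rw [add_mul]
  rw [integral_add (hmul k hρ) (hmul k hS), ← hρR, sub_eq_add_neg,
    ← (integral_exponentialSum hP.im_pos k).2, ← integral_indicator measurableSet_Ioi]
  congr 2
  funext y
  by_cases hy : y ∈ Ioi (0 : ℝ)
  · rw [indicator_of_mem hy, indicator_of_mem hy]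
  · rw [indicator_of_notMem hy, indicator_of_notMem hy, zero_mul]

lemma kernel_ae_eq_zero {ρ : ℝ → ℂ} (hρ : Integrable ρ)
    (hρR : ∀ k : ℝ, n k L / m k L = ∫ y : ℝ, ρ y * Complex.exp (-(Complex.I * k * y))) :
    ∀ᵐ z : ℝ, 2 * L < z → ρ z + exponentialSum B M τ z = 0 := by
  obtain ⟨G, hG, hGd, hGt⟩ := hm.exists_regularPart_reflection hu hL hP
  obtain ⟨hi, hF⟩ := fourier_kernel hP hρ hρR
  have := ae_eq_of_fourier_eq (h := fun _ => 0) hi (integrable_zero _ _ _) hGd hGt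
    fun k => by rw [hF k, add_zero, hG k (ofReal_notMem hP k)]
  filter_upwards [this] with z hz hLz
  have h := hz hLz
  rw [indicator_of_mem (show z ∈ Ioi (0 : ℝ) from by simp only [mem_Ioi]; linarith)] at h
  simpa using h

omit hu hL hP in
/-- The Wronskian of the solutions for `u` and for its restriction to `(x₀, ∞)`. -/
lemma wronskian_indicator {x₀ : ℝ} (hx₀ : x₀ ∈ Icc (-L) L) {m₂ n₂ : ℂ → ℝ → ℂ}
    (hm₂ : IsFundamental ((Ioi x₀).indicator u) L m₂ n₂) (k : ℂ) :
    m k L * n₂ k L - n k L * m₂ k L = -n k x₀ := by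
  have h1 : m₂ k x₀ = 1 ∧ n₂ k x₀ = 0 := by
    have h0 : ∀ t ∈ uIoc (-L) x₀, (Ioi x₀).indicator u t = 0 := fun t ht => by
      rw [uIoc_of_le hx₀.1] at ht
      exact indicator_of_notMem (by simpa using ht.2) _
    constructor
    · rw [← hm₂.fst_eq_one k _ le_rfl]
      exact (hm₂.sol k).fst.eq_of_ae_eq_zero (Eventually.of_forall fun t ht => by simp [h0 t ht])
    · rw [← hm₂.snd_eq_zero k _ le_rfl]
      exact (hm₂.sol k).snd.eq_of_ae_eq_zero (Eventually.of_forall fun t ht => by simp [h0 t ht])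
  have h2 := (((hm.sol k).fst.mul (hm₂.sol k).snd).sub
    ((hm.sol k).snd.mul (hm₂.sol k).fst)).eq_of_ae_eq_zero (a := x₀) (b := L)
    (Eventually.of_forall fun t ht => by
      rw [uIoc_of_le hx₀.2] at ht
      rw [indicator_of_mem (show t ∈ Ioi x₀ from ht.1)]
      ring)
  simp only [h1.1, h1.2] at h2
  linear_combination h2

/-- Comparison of the Marchenko kernel with its Born approximation near the end of the support:
if `u` is bounded by `C` on `(x₀, L]`, the difference is at most quadratic in `L - x₀`. -/
theorem norm_kernel_add_half_conj_le (hsupp : ∀ x, L < |x| → u x = 0) {x₀ C : ℝ} (hx₀ : 0 ≤ x₀)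
    (hx₀L : x₀ ≤ L) (hC : ∀ x, x₀ < x → ‖u x‖ ≤ C) (hsmall : C * (L - x₀) ≤ 1 / 2) {ρ : ℝ → ℂ}
    (hρ : Integrable ρ)
    (hρR : ∀ k : ℝ, n k L / m k L = ∫ y : ℝ, ρ y * Complex.exp (-(Complex.I * k * y))) :
    ∀ᵐ z : ℝ, 2 * x₀ < z → ‖ρ z + exponentialSum B M τ z + (starRingEnd ℂ) (u (z / 2)) / 2‖ ≤
      4 / 3 * C * (C * (L - x₀)) ^ 2 := by
  set v := (Ioi x₀).indicator u with hvd
  have hC0 : 0 ≤ C := (norm_nonneg _).trans (hC (x₀ + 1) (by linarith))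
  have hv : Integrable v := hu.indicator measurableSet_Ioi
  have hvsupp : ∀ x, L < |x| → v x = 0 := fun x hx => by
    rw [hvd, indicator_apply, hsupp x hx, ite_self]
  have hvC : ∀ x, ‖v x‖ ≤ C := fun x => by
    by_cases hx : x ∈ Ioi x₀
    · rw [hvd, indicator_of_mem hx]; exact hC x hx
    · rw [hvd, indicator_of_notMem hx, norm_zero]; exact hC0
  have hμC : ∫ t, ‖v t‖ ≤ C * (L - x₀) := by
    have e : (fun t => ‖v t‖) = (Ioc x₀ L).indicator fun t => ‖v t‖ := by
      funext t
      by_cases ht : t ∈ Ioc x₀ L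
      · rw [indicator_of_mem ht]
      · rw [indicator_of_notMem ht, norm_eq_zero]
        by_cases h1 : x₀ < t
        · exact hvsupp t ((not_le.1 fun h => ht ⟨h1, h⟩).trans_le (le_abs_self t))
        · exact indicator_of_notMem h1 _
    rw [e, integral_indicator measurableSet_Ioc, ← intervalIntegral.integral_of_le hx₀L]
    have := intervalIntegral.norm_integral_le_of_norm_le_const (a := x₀) (b := L) (C := C)
      (f := fun t => ‖v t‖) fun t _ => by rw [norm_norm]; exact hvC t
    rw [abs_of_nonneg (by linarith)] at this
    exact (le_abs_self _).trans this
  have hμ0 : 0 ≤ ∫ t, ‖v t‖ := integral_nonneg fun _ => norm_nonneg _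
  have hμ := hμC.trans hsmall
  obtain ⟨m₂, n₂, hm₂⟩ := exists_isFundamental hv hvsupp
  obtain ⟨hri, hrb⟩ := hm₂.integrable_reflection_sub_bornTerm hv hvsupp hL hμ hvC
  have hm₂0 : ∀ w : ℂ, 0 ≤ w.im → m₂ w L ≠ 0 := fun w hw h => by
    have := hm₂.two_thirds_le_norm_fst hv hL hμ hw
    rw [h, norm_zero] at this; norm_num at this
  obtain ⟨G, hG, hGd, -⟩ := hm.exists_regularPart_reflection hu hL hP
  obtain ⟨hi, hF⟩ := fourier_kernel hP hρ hρR
  -- the Born term is minus the Fourier transform of the rescaled potential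
  set q : ℝ → ℂ := fun z => (starRingEnd ℂ) (v (z / 2)) / 2 with hq
  have hqi : Integrable q :=
    ((Complex.conjLIE.integrable_comp_iff.2 hv).comp_div two_ne_zero).div_const 2
  have hqF : ∀ k : ℝ, ∫ y : ℝ, q y * Complex.exp (-(Complex.I * k * y)) = -bornTerm v k L := fun k => by
    have h1 := Measure.integral_comp_div
      (fun t : ℝ => (starRingEnd ℂ) (v t) * Complex.exp (-(2 * Complex.I * k * t))) 2
    rw [abs_of_pos two_pos, Complex.real_smul] at h1
    have h2 : ∫ t : ℝ, (starRingEnd ℂ) (v t) * Complex.exp (-(2 * Complex.I * k * t)) =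
        -bornTerm v k L := by
      rw [bornTerm, neg_neg]
      symm
      refine setIntegral_eq_integral_of_forall_compl_eq_zero fun t ht => ?_
      rw [hvsupp t ((not_le.1 ht).trans_le (le_abs_self t)), map_zero, zero_mul]
    rw [h2] at h1
    have h3 : ∫ y : ℝ, q y * Complex.exp (-(Complex.I * k * y)) = 1 / 2 * ∫ x : ℝ,
        (starRingEnd ℂ) (v (x / 2)) * Complex.exp (-(2 * Complex.I * k * ((x / 2 : ℝ) : ℂ))) := by
      rw [← integral_const_mul]
      refine integral_congr_ae (Eventually.of_forall fun y => ?_)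
      simp only [hq]
      rw [show -(2 * Complex.I * k * ((y / 2 : ℝ) : ℂ)) = -(Complex.I * k * y) by push_cast; ring]
      ring
    rw [h3, h1]
    push_cast
    ring
  set H : ℂ → ℂ := fun w => G w - n₂ w L / m₂ w L with hH
  have hHd : ∀ w : ℂ, 0 ≤ w.im → DifferentiableAt ℂ H w := fun w hw =>
    (hGd w hw).sub ((hm₂.differentiable_snd L w).div (hm₂.differentiable_fst L w) (hm₂0 w hw))
  have hHt : Tendsto (fun w => H w * Complex.exp (Complex.I * w * ((2 * x₀ : ℝ) : ℂ)))
      upperInfty (𝓝 0) := by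
    have ha := hm.tendsto_fst hu hL
    have h1 := (hm.tendsto_snd hu hL (x := x₀) ⟨by linarith, hx₀L⟩).div
      (ha.mul (hm₂.tendsto_fst hv hL)) (by norm_num)
    have h2 := h1.sub (tendsto_singularPart_mul_cexp B M τ (c := 2 * x₀) (by linarith))
    rw [zero_div, sub_zero] at h2
    refine h2.congr' ?_
    filter_upwards [eventually_upperInfty_notMem B, eventually_upperInfty_im,
      ha.eventually_ne one_ne_zero] with w hw him haw
    have hW := hm.wronskian_indicator ⟨by linarith, hx₀L⟩ hm₂ w
    have h2w := hm₂0 w him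
    have e : n w L / m w L - n₂ w L / m₂ w L = n w x₀ / (m w L * m₂ w L) := by
      rw [div_sub_div _ _ haw h2w]
      congr 1
      linear_combination -hW
    simp only [hH, Pi.div_apply]
    rw [hG w hw, cexp_two_mul, show n w L / m w L - singularPart B M τ w - n₂ w L / m₂ w L =
      n w x₀ / (m w L * m₂ w L) - singularPart B M τ w by rw [← e]; ring]
    ring
  have key := ae_eq_of_fourier_eq (hi.add hqi) hri hHd hHt fun k => by
    have hmul : ∀ {f : ℝ → ℂ}, Integrable f →
        Integrable fun y : ℝ => f y * Complex.exp (-(Complex.I * k * y)) := fun {f} hf =>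
      hf.mul_bdd (c := 1) (by fun_prop : Continuous fun y : ℝ =>
        Complex.exp (-(Complex.I * k * y))).aestronglyMeasurable
        (Eventually.of_forall fun y => (norm_cexp_neg_I_mul_ofReal k y).le)
    simp_rw [Pi.add_apply, add_mul _ (q _)]
    rw [integral_add (hmul hi) (hmul hqi), hF k, hqF k]
    simp only [hH]
    rw [hG k (ofReal_notMem hP k)]
    ring
  filter_upwards [key] with z hz hz0
  have h := hz hz0
  rw [Pi.add_apply, indicator_of_mem (show z ∈ Ioi (0 : ℝ) from by simp only [mem_Ioi]; linarith)] at h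
  have hvz : v (z / 2) = u (z / 2) := indicator_of_mem (by simp only [mem_Ioi]; linarith) _
  simp only [hq, hvz] at h
  rw [h, norm_mul]
  have h1 : ‖(1 / (2 * (Real.pi : ℂ)))‖ = 1 / (2 * Real.pi) := by
    rw [norm_div, norm_mul, Complex.norm_real, Real.norm_of_nonneg Real.pi_pos.le]; simp
  have h2 : ‖∫ k : ℝ, (n₂ k L / m₂ k L - bornTerm v k L) * Complex.exp (Complex.I * k * z)‖ ≤
      8 / 3 * Real.pi * C * (C * (L - x₀)) ^ 2 := by
    refine (norm_integral_le_integral_norm _).trans ?_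
    simp only [norm_mul, norm_cexp_I_mul_ofReal, mul_one]
    refine hrb.trans ?_
    have := Real.pi_pos
    gcongr
  rw [h1]
  have hpi := Real.pi_pos
  calc _ ≤ 1 / (2 * Real.pi) * (8 / 3 * Real.pi * C * (C * (L - x₀)) ^ 2) := by gcongr
    _ = 4 / 3 * C * (C * (L - x₀)) ^ 2 := by field_simp; ring

end IsFundamental

end

/-! ### Representatives of the kernels -/

variable {u : ℝ → ℂ} {L : ℝ} {m n m' n' : ℂ → ℝ → ℂ}

/-- A function with an essential left limit `v` at `c` can be modified on a null set so as to be
left-continuous at `c` with value `v`. -/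
lemma exists_representative {Ω : ℝ → ℂ} {c : ℝ} {v : ℂ} (h0 : ∀ᵐ z : ℝ, c < z → Ω z = 0)
    (hlim : ∀ ε > 0, ∃ δ > 0, ∀ᵐ z : ℝ, c - δ < z → z < c → ‖Ω z - v‖ ≤ ε) :
    ∃ Ω' : ℝ → ℂ, (∀ᵐ z : ℝ, Ω' z = Ω z) ∧ (∀ z, c < z → Ω' z = 0) ∧
      ContinuousWithinAt Ω' (Iic c) c ∧ Ω' c = v := by
  classical
  choose! δ hδ0 hδ using hlim
  set N : Set ℝ := {z | ∀ j : ℕ, c - δ (1 / (j + 1)) < z → z < c → ‖Ω z - v‖ ≤ 1 / (j + 1)} with hN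
  have hNae : ∀ᵐ z, z ∈ N := by
    rw [hN]
    exact ae_all_iff.2 fun j => hδ _ (by positivity)
  refine ⟨fun z => if c < z then 0 else if z = c then v else if z ∈ N then Ω z else v, ?_, ?_, ?_, ?_⟩
  · filter_upwards [h0, hNae, compl_mem_ae_iff.2 (measure_singleton c)] with z h1 h2 h3
    by_cases hz : c < z
    · rw [if_pos hz, h1 hz]
    · rw [if_neg hz, if_neg (by simpa using h3), if_pos h2]
  · exact fun z hz => if_pos hz
  · rw [Metric.continuousWithinAt_iff]
    intro ε hε
    obtain ⟨j, hj⟩ := exists_nat_one_div_lt hε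
    refine ⟨δ (1 / (j + 1)), hδ0 _ (by positivity), fun {z} hz hzd => ?_⟩
    have hz' : ¬ c < z := not_lt.2 hz
    simp only [lt_irrefl, if_false, if_true, hz']
    by_cases hzc : z = c
    · simpa [hzc] using hε
    rw [if_neg hzc]
    by_cases hzN : z ∈ N
    · rw [if_pos hzN, dist_eq_norm]
      rw [Real.dist_eq, abs_lt] at hzd
      exact (hzN j (by linarith) (lt_of_le_of_ne hz hzc)).trans_lt hj
    · simpa [hzN] using hε
  · simp

namespace IsFundamental

lemma reflectionRight_eq (hm : IsFundamental u L m n) (hu : Integrable u)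
    (hsupp : ∀ x, L < |x| → u x = 0) (hL : 0 < L) (k : ℝ) :
    reflectionRight u k = n k L / m k L := by
  rw [reflectionRight, hm.coeffA_eq hu hsupp hL (by simp), hm.coeffB_eq hu hsupp hL]

lemma reflectionLeft_eq (hm : IsFundamental u L m n) (hm' : IsFundamental (reflected u) L m' n')
    (hu : Integrable u) (hsupp : ∀ x, L < |x| → u x = 0) (hL : 0 < L) (k : ℝ) :
    reflectionLeft u k = n' k L / m' k L := by
  rw [reflectionLeft, hm.coeffA_eq hu hsupp hL (by simp), hm.coeffC_eq hm' hu hsupp hL,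
    hm.reflected_fst_eq hm']

/-- The essential left limit of the Marchenko kernel at the end of its support. -/
lemma exists_norm_kernel_sub_le {B : Finset ℂ} {M : ℂ → ℕ} {τ : ℂ → ℕ → ℂ}
    (hm : IsFundamental u L m n) (hu : Integrable u) (hsupp : ∀ x, L < |x| → u x = 0) (hL : 0 < L)
    (hP : IsPolarData (fun k => m k L) (fun k => n k L) B M τ)
    (hc : ContinuousWithinAt u (Iic L) L) {ρ : ℝ → ℂ} (hρ : Integrable ρ)
    (hρR : ∀ k : ℝ, n k L / m k L = ∫ y : ℝ, ρ y * Complex.exp (-(Complex.I * k * y)))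
    {ε : ℝ} (hε : 0 < ε) : ∃ δ > 0, δ ≤ 2 * L ∧ ∀ᵐ z : ℝ, 2 * L - δ < z → z < 2 * L →
      ‖ρ z + exponentialSum B M τ z - -(starRingEnd ℂ) (u L) / 2‖ ≤ ε := by
  set C := ‖u L‖ + 1 with hC
  have hC1 : 1 ≤ C := by linarith [norm_nonneg (u L)]
  obtain ⟨η, hη, hηu⟩ := Metric.continuousWithinAt_iff.1 hc (min 1 ε) (by positivity)
  set δ := min (min L η) (min (1 / (2 * C)) (3 * ε / (4 * C ^ 2))) with hδ
  have hδ0 : 0 < δ := by positivity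
  have d1 : δ ≤ L := (min_le_left _ _).trans (min_le_left _ _)
  have d2 : δ ≤ η := (min_le_left _ _).trans (min_le_right _ _)
  have d3 : C * δ ≤ 1 / 2 := by
    have : δ ≤ 1 / (2 * C) := (min_le_right _ _).trans (min_le_left _ _)
    rw [le_div_iff₀ (by positivity)] at this
    linarith
  have d4 : 4 / 3 * C * (C * δ) ^ 2 ≤ ε / 2 := by
    have : δ ≤ 3 * ε / (4 * C ^ 2) := (min_le_right _ _).trans (min_le_right _ _)
    rw [le_div_iff₀ (by positivity)] at this
    calc 4 / 3 * C * (C * δ) ^ 2 = 4 / 3 * (C ^ 2 * δ) * (C * δ) := by ring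
      _ ≤ 4 / 3 * (C ^ 2 * δ) * (1 / 2) := by gcongr
      _ ≤ ε / 2 := by linarith
  have hnear : ∀ x, L - δ < x → x ≤ L → ‖u x - u L‖ < min 1 ε := fun x h1 h2 => by
    rw [← dist_eq_norm]
    refine hηu h2 ?_
    rw [Real.dist_eq, abs_lt]
    constructor <;> linarith
  have hbd : ∀ x, L - δ < x → ‖u x‖ ≤ C := fun x hx => by
    rcases le_or_gt x L with h | h
    · have h1 := (hnear x hx h).le.trans (min_le_left _ _)
      have h2 := norm_add_le (u x - u L) (u L)
      rw [sub_add_cancel] at h2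
      linarith
    · rw [hsupp x (h.trans_le (le_abs_self x)), norm_zero]; linarith
  refine ⟨2 * δ, by positivity, by linarith, ?_⟩
  have key := hm.norm_kernel_add_half_conj_le hu hL hP hsupp (x₀ := L - δ) (by linarith)
    (by linarith) hbd (by rwa [sub_sub_cancel]) hρ hρR
  rw [sub_sub_cancel] at key
  filter_upwards [key] with z hz h1 h2
  have e : ρ z + exponentialSum B M τ z - -(starRingEnd ℂ) (u L) / 2 =
      (ρ z + exponentialSum B M τ z + (starRingEnd ℂ) (u (z / 2)) / 2) -
        (starRingEnd ℂ) (u (z / 2) - u L) / 2 := by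
    rw [map_sub]; ring
  rw [e]
  refine (norm_sub_le _ _).trans ?_
  have h3 := (hz (by linarith)).trans d4
  have h4 := (hnear (z / 2) (by linarith) (by linarith)).le.trans (min_le_right _ _)
  rw [norm_div, RCLike.norm_conj, RCLike.norm_ofNat]
  linarith

end IsFundamental

end ZakharovShabat

theorem lemma5p3 (u : ℝ → ℂ) (L : ℝ) (hL : 0 < L) (hu : Integrable u)
    (hsupp : ∀ x : ℝ, L < |x| → u x = 0)
    (hreg : ∀ k : ℝ, ZakharovShabat.coeffA u k ≠ 0) :
    (ZakharovShabat.boundStates u).Finite ∧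
    (∀ z : ℝ, 2 * L < z → ZakharovShabat.LeftKernelHasValue u z 0) ∧
    (∀ z : ℝ, z < -(2 * L) → ZakharovShabat.RightKernelHasValue u z 0) ∧
    (∀ Ω : ℝ → ℂ, ZakharovShabat.IsLeftKernel u Ω →
      ∃ Ω' : ℝ → ℂ, (∀ᵐ z : ℝ, 0 < z → Ω' z = Ω z) ∧
        (∀ z : ℝ, 2 * L < z → Ω' z = 0) ∧
        (ContinuousWithinAt u (Iic L) L →
          ContinuousWithinAt Ω' (Iic (2 * L)) (2 * L) ∧
          Ω' (2 * L) = -(starRingEnd ℂ) (u L) / 2)) ∧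
    (∀ Ω : ℝ → ℂ, ZakharovShabat.IsRightKernel u Ω →
      ∃ Ω' : ℝ → ℂ, (∀ᵐ z : ℝ, z < 0 → Ω' z = Ω z) ∧
        (∀ z : ℝ, z < -(2 * L) → Ω' z = 0)) := by
  classical
  obtain ⟨m, n, hm⟩ := ZakharovShabat.exists_isFundamental hu hsupp
  have hu' := ZakharovShabat.integrable_reflected hu
  obtain ⟨m', n', hm'⟩ := ZakharovShabat.exists_isFundamental hu'
    (ZakharovShabat.reflected_eq_zero hsupp)
  have hmm : ∀ k, m' k L = m k L := fun k => hm.reflected_fst_eq hm' k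
  have hmR : ∀ k : ℝ, m k L ≠ 0 := fun k => by
    rw [← hm.coeffA_eq hu hsupp hL (by simp)]; exact hreg k
  have h0 : m 0 L ≠ 0 := by simpa using hmR 0
  have hfin := hm.finite_boundStates hu hsupp hL h0
  obtain ⟨τ, hτ, hSl⟩ := hm.exists_left_data hm' hu hsupp hL h0 hfin
  obtain ⟨σ, hσ, hSr⟩ := hm.exists_right_data hm' hu hsupp hL h0 hfin
  have him : ∀ k ∈ hfin.toFinset, 0 < k.im := fun k hk => ((hfin.mem_toFinset).1 hk).1
  have hmem : ∀ k : ℂ, 0 ≤ k.im → m k L = 0 → k ∈ hfin.toFinset := fun k hk h => by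
    rw [hfin.mem_toFinset]
    refine ⟨lt_of_le_of_ne hk fun h1 => ?_, by rw [hm.coeffA_eq hu hsupp hL hk, h]⟩
    refine hmR k.re ?_
    rw [← h]
    congr 1
    exact Complex.ext (by simp) (by simp [← h1])
  have hPl : ZakharovShabat.IsPolarData (fun k => m k L) (fun k => n k L) hfin.toFinset
      (ZakharovShabat.multiplicity u) τ := ⟨him, hmem, hτ⟩
  have hPr : ZakharovShabat.IsPolarData (fun k => m' k L) (fun k => n' k L) hfin.toFinset
      (ZakharovShabat.multiplicity u) σ := ⟨him, fun k hk h => hmem k hk (by rw [← hmm, h]), hσ⟩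
  refine ⟨hfin, fun z hz => ?_, fun z hz => ?_, ?_, ?_⟩
  · unfold ZakharovShabat.LeftKernelHasValue
    simp_rw [hm.reflectionRight_eq hu hsupp hL, hSl]
    exact hm.tendsto_integral_reflection hu hL hPl hz
  · unfold ZakharovShabat.RightKernelHasValue
    simp_rw [hm.reflectionLeft_eq hm' hu hsupp hL, hSr]
    have := hm'.tendsto_integral_reflection hu' hL hPr (z := -z) (by linarith)
    simpa only [Complex.ofReal_neg, mul_neg] using this
  · rintro Ω ⟨ρ, hρ, hρR, hΩ⟩
    simp_rw [hm.reflectionRight_eq hu hsupp hL] at hρR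
    simp_rw [hSl] at hΩ
    have hz0 : ∀ᵐ z : ℝ, 2 * L < z → Ω z = 0 := by
      filter_upwards [hΩ, hm.kernel_ae_eq_zero hu hL hPl hρ hρR] with z h1 h2 hz
      rw [h1 (by linarith), h2 hz]
    by_cases hc : ContinuousWithinAt u (Iic L) L
    · obtain ⟨Ω', h1, h2, h3, h4⟩ := ZakharovShabat.exists_representative hz0
        (v := -(starRingEnd ℂ) (u L) / 2) fun ε hε => by
          obtain ⟨δ, hδ, hδL, h⟩ := hm.exists_norm_kernel_sub_le hu hsupp hL hPl hc hρ hρR hε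
          refine ⟨δ, hδ, ?_⟩
          filter_upwards [h, hΩ] with z ha hb hz1 hz2
          rw [hb (by linarith)]
          exact ha hz1 hz2
      exact ⟨Ω', h1.mono fun z hz _ => hz, h2, fun _ => ⟨h3, h4⟩⟩
    · refine ⟨fun z => if 2 * L < z then 0 else Ω z, ?_, fun z hz => if_pos hz, fun h => (hc h).elim⟩
      filter_upwards [hz0] with z h _
      by_cases hz : 2 * L < z
      · rw [if_pos hz, h hz]
      · rw [if_neg hz]
  · rintro Ω ⟨l, hl, hlR, hΩ⟩
    simp_rw [hm.reflectionLeft_eq hm' hu hsupp hL] at hlR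
    simp_rw [hSr] at hΩ
    have hlR' : ∀ k : ℝ, n' k L / m' k L =
        ∫ y : ℝ, l (-y) * Complex.exp (-(Complex.I * k * y)) := fun k => by
      rw [hlR k, ← integral_neg_eq_self]
      refine integral_congr_ae (Eventually.of_forall fun y => ?_)
      simp
    have hk := hm'.kernel_ae_eq_zero hu' hL hPr (ρ := fun y => l (-y)) hl.comp_neg hlR'
    have hk' := (Measure.measurePreserving_neg (volume : Measure ℝ)).quasiMeasurePreserving.ae hk
    have hz0 : ∀ᵐ z : ℝ, z < -(2 * L) → Ω z = 0 := by
      filter_upwards [hΩ, hk'] with z h1 h2 hz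
      have := h2 (by linarith)
      rw [neg_neg] at this
      rw [h1 (by linarith), this]
    refine ⟨fun z => if z < -(2 * L) then 0 else Ω z, ?_, fun z hz => if_pos hz⟩
    filter_upwards [hz0] with z h _
    by_cases hz : z < -(2 * L)
    · rw [if_pos hz, h hz]
    · rw [if_neg hz]
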